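/- Let $k$ be a field. For a proper, smooth, geometrically connected curve $X$ over $k$ with function field $K_X$, let $K_X^{\mathrm{sep}}$ be a separable closure of $K_X$, let $\bar k$ be the algebraic closure of $k$ in $K_X^{\mathrm{sep}}$, and put $G_X=\mathrm{Gal}(K_X^{\mathrm{sep}}/K_X)$ and $G_k=\mathrm{Gal}(\bar k/k)$. A *section* is a continuous homomorphism $s:G_k\to G_X$ with $\mathrm{pr}_X\circ s=\mathrm{id}_{G_k}$, where $\mathrm{pr}_X:G_X\to G_k$ is the restriction map. A *decomposition subgroup* $D_x\subset G_X$ associated to a rational point $x\in X(k)$ is the stabilizer of a valuation ring of $K_X^{\mathrm{sep}}$ whose intersection with $K_X$ is the local ring $\mathcal O_{X,x}$. The birational Grothendieck anabelian section conjecture (BGASC) *holds true for $X$* if for every section $s:G_k\to G_X$ there is a unique rational point $x\in X(k)$ such that $s(G_k)$ is contained in a decomposition subgroup $D_x\subset G_X$ associated to $x$. **Proposition 2.2.** Let $k$ be a field and let $g\ge 1$ be an integer. Assume that the BGASC holds true for every proper, smooth, geometrically connected curve of genus $g$ over $k$. Then the BGASC holds true for the projective line $\mathbb P^1_k$. -/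

import Mathlib

open AlgebraicGeometry CategoryTheory

universe u

namespace BirationalSection

noncomputable section

/-! ### Galois groups, sections and decomposition groups of a field extension `K / k`

Throughout, `Ω` is a separable closure of `K`, and `algebraicClosure k Ω` is the algebraic closure
of `k` in `Ω`. The absolute Galois groups of `K` and of `k` are
`Ω ≃ₐ[K] Ω` and `algebraicClosure k Ω ≃ₐ[k] algebraicClosure k Ω`, with their Krull topologies. -/

section Galois

variable (k K Ω : Type u) [Field k] [Field K] [Field Ω] [Algebra k K] [Algebra K Ω] [Algebra k Ω]
  [IsScalarTower k K Ω]

/-- The natural projection `Gal (Ω / K) → Gal (k̄ / k)`, the restriction of automorphisms to the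
algebraic closure `k̄` of `k` in `Ω`. -/
def galProj : (Ω ≃ₐ[K] Ω) →* (algebraicClosure k Ω ≃ₐ[k] algebraicClosure k Ω) where
  toFun σ := algebraicClosure.algEquivOfAlgEquiv (σ.restrictScalars k)
  map_one' := rfl
  map_mul' _ _ := rfl

theorem galProj_apply_coe (σ : Ω ≃ₐ[K] Ω) (a : algebraicClosure k Ω) :
    (galProj k K Ω σ a : Ω) = σ a := rfl

/-- A group-theoretic section: a continuous homomorphism `s : Gal (k̄ / k) → Gal (Ω / K)` that
splits the natural projection. -/
def IsGaloisSection
    (s : (algebraicClosure k Ω ≃ₐ[k] algebraicClosure k Ω) →* (Ω ≃ₐ[K] Ω)) : Prop :=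
  Continuous s ∧ (galProj k K Ω).comp s = MonoidHom.id _

variable {K}

/-- The decomposition subgroups in `Gal (Ω / K)` of a subring `O` of `K` (to be applied to the local
ring of a closed point of a smooth curve): the stabilizers of the valuation rings of `Ω` whose
intersection with `K` is `O`. -/
def decompositionGroups (O : Subring K) : Set (Subgroup (Ω ≃ₐ[K] Ω)) :=
  {D | ∃ W : ValuationSubring Ω,
    W.toSubring.comap (algebraMap K Ω) = O ∧ D = W.decompositionSubgroup K}

end Galois

/-! ### Curves over a field -/

section Curve

variable {k : Type u} [Field k] {X : Scheme.{u}} (f : X ⟶ Spec (.of k)) [AlgebraicGeometry.IsIntegral X]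

/-- The embedding of the base field in the function field of an integral `k`-scheme. -/
def constantsHom : k →+* X.functionField :=
  (X.presheaf.germ ⊤ (genericPoint X) trivial).hom.comp (f.appTop.hom.comp (Scheme.ΓSpecIso (.of k)).inv.hom)

/-- The function field as an extension of the base field. -/
abbrev functionFieldAlgebra : Algebra k X.functionField := (constantsHom f).toAlgebra

/-- The local ring of an integral scheme at a point, as a subring of the function field. -/
def localRing (x : X) : Subring X.functionField :=
  (algebraMap (X.presheaf.stalk x) X.functionField).range

/-- The `k`-rational points `X(k)`: the sections of the structure morphism. -/
def RationalPoint : Type u := {x : Spec (.of k) ⟶ X // x ≫ f = 𝟙 _}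

/-- The underlying point of the scheme `X` of a rational point. -/
def RationalPoint.point {f : X ⟶ Spec (.of k)} (x : RationalPoint f) : X :=
  x.1 (IsLocalRing.closedPoint k)

/-- The space `H⁰(X, Ω¹_{X/k})` of global differentials of a smooth integral `k`-scheme `X`, as the
space of those `ω` in `Ω¹_{K/k}`, with `K` the function field, which for every point `x` of `X` lie
in the image of `Ω¹_{O/k}`, where `O` is the local ring at `x`. This image is the set of sums of
elements `a • db` with `a` and `b` in `O`. -/
def globalDifferentials :
    letI := functionFieldAlgebra f
    Submodule k (KaehlerDifferential k X.functionField) :=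
  letI := functionFieldAlgebra f
  ⨅ x : X, Submodule.span k {ω | ∃ a ∈ localRing x, ∃ b ∈ localRing x,
    ω = a • KaehlerDifferential.D k X.functionField b}

/-- The genus `dim_k H⁰(X, Ω¹_{X/k})` of a smooth proper geometrically connected curve. -/
def genus : ℕ :=
  letI := functionFieldAlgebra f
  Module.finrank k (globalDifferentials f)

/-- The birational Grothendieck anabelian section conjecture holds true for the `k`-curve `X`: for
every section `s` of the projection from the absolute Galois group of the function field of `X` to
that of `k`, there is a unique rational point `x` of `X` such that the image of `s` is contained in
a decomposition subgroup associated to `x`. -/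
def BGASC : Prop :=
  letI := functionFieldAlgebra f
  ∀ (Ω : Type u) [Field Ω] [Algebra X.functionField Ω] [Algebra k Ω]
    [IsScalarTower k X.functionField Ω] [IsSepClosure X.functionField Ω]
    (s : (algebraicClosure k Ω ≃ₐ[k] algebraicClosure k Ω) →* (Ω ≃ₐ[X.functionField] Ω)),
    IsGaloisSection k X.functionField Ω s →
      ∃! x : RationalPoint f, ∃ D ∈ decompositionGroups Ω (localRing x.point), s.range ≤ D

end Curve

/-! ### The projective line -/

section ProjectiveLine

attribute [local instance] MvPolynomial.gradedAlgebra

variable (k : Type u) [Field k]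

/-- The projective line `Proj k[X₀, X₁]`. -/
def projectiveLine : Scheme.{u} := Proj (MvPolynomial.homogeneousSubmodule (Fin 2) k)

/-- The structure morphism of the projective line. -/
def projectiveLineHom : projectiveLine k ⟶ Spec (.of k) :=
  Proj.toSpecZero (MvPolynomial.homogeneousSubmodule (Fin 2) k) ≫
    Spec.map (CommRingCat.ofHom
      (algebraMap k (MvPolynomial.homogeneousSubmodule (Fin 2) k 0)))

theorem irreducibleSpace_projectiveLine : IrreducibleSpace (projectiveLine k) := by
  let η : ProjectiveSpectrum (MvPolynomial.homogeneousSubmodule (Fin 2) k) :=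
    ⟨⊥, by
      simpa using (inferInstance : (⊥ : Ideal (MvPolynomial (Fin 2) k)).IsPrime), by
      intro h
      have h1 : (MvPolynomial.X 0 : MvPolynomial (Fin 2) k) ∈ HomogeneousIdeal.irrelevant
          (MvPolynomial.homogeneousSubmodule (Fin 2) k) := by
        rw [HomogeneousIdeal.mem_irrelevant_iff, GradedRing.proj_apply,
          DirectSum.decompose_of_mem_ne (i := 1) _ (MvPolynomial.isHomogeneous_X k 0) (by simp)]
      have h2 := h h1
      exact MvPolynomial.X_ne_zero (R := k) (0 : Fin 2)
        ((Submodule.mem_bot (MvPolynomial (Fin 2) k)).1 h2)⟩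
  have h : IsIrreducible (Set.univ :
      Set (ProjectiveSpectrum (MvPolynomial.homogeneousSubmodule (Fin 2) k))) := by
    have : closure {η} = Set.univ := by
      refine Set.eq_univ_of_forall fun y => ?_
      rw [← ProjectiveSpectrum.le_iff_mem_closure, ← ProjectiveSpectrum.as_ideal_le_as_ideal]
      exact bot_le
    rw [← this]
    exact isIrreducible_singleton.closure
  exact (irreducibleSpace_def _).2 h

instance isIntegral_projectiveLine : AlgebraicGeometry.IsIntegral (projectiveLine k) := by
  have := irreducibleSpace_projectiveLine k
  have : IsReduced (projectiveLine k) := by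
    let 𝒰 := (Proj.affineOpenCover (MvPolynomial.homogeneousSubmodule (Fin 2) k)).openCover
    have (i : 𝒰.I₀) : IsReduced (𝒰.X i) := by
      have : _root_.IsReduced (HomogeneousLocalization.Away
          (MvPolynomial.homogeneousSubmodule (Fin 2) k) (i.2 : MvPolynomial (Fin 2) k)) :=
        isReduced_of_injective (algebraMap _ (Localization.Away (i.2 : MvPolynomial (Fin 2) k)))
          (HomogeneousLocalization.val_injective _)
      exact (inferInstance : IsReduced (Spec (.of (HomogeneousLocalization.Away
          (MvPolynomial.homogeneousSubmodule (Fin 2) k) (i.2 : MvPolynomial (Fin 2) k)))))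
    exact IsReduced.of_openCover _ 𝒰
  exact isIntegral_of_irreducibleSpace_of_isReduced _

end ProjectiveLine

end

end BirationalSection

namespace BirationalSection

open Polynomial

section QuadraticCover

/-- The polynomial `Y ^ 2 + b Y - c`. -/
noncomputable def quadPoly {R : Type*} [CommRing R] (b c : R) : R[X] := X ^ 2 + C b * X - C c

section

variable {R : Type*} [CommRing R] (b c : R)

theorem quadPoly_eq : quadPoly b c = X ^ 2 + (C b * X + C (-c)) := by
  rw [quadPoly, map_neg]; ring

theorem degree_linear_lt : (C b * X + C (-c) : R[X]).degree < ((2 : ℕ) : WithBot ℕ) :=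
  degree_linear_le.trans_lt (by norm_num)

theorem monic_quadPoly : (quadPoly b c).Monic := by
  rw [quadPoly_eq]
  exact monic_X_pow_add (degree_linear_lt b c)

theorem natDegree_quadPoly [Nontrivial R] : (quadPoly b c).natDegree = 2 := by
  have : quadPoly b c = C 1 * X ^ 2 + C b * X + C (-c) := by rw [quadPoly_eq, map_one]; ring
  rw [this]
  exact natDegree_quadratic one_ne_zero

theorem eval₂_quadPoly {S : Type*} [CommRing S] (φ : R →+* S) (y : S) :
    (quadPoly b c).eval₂ φ y = y ^ 2 + φ b * y - φ c := by
  simp [quadPoly]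

theorem prime_quadPoly [IsDomain R] [UniqueFactorizationMonoid R]
    (h : ∀ r : R, r ^ 2 + b * r ≠ c) : Prime (quadPoly b c) := by
  rw [← irreducible_iff_prime, (monic_quadPoly b c).irreducible_iff_roots_eq_zero_of_degree_le_three
    (by rw [natDegree_quadPoly]) (by rw [natDegree_quadPoly]; norm_num)]
  refine Multiset.eq_zero_of_forall_notMem fun r hr => h r ?_
  have := isRoot_of_mem_roots hr
  simpa [quadPoly, sub_eq_zero] using this

theorem isDomain_adjoinRoot_quadPoly [IsDomain R] [UniqueFactorizationMonoid R]
    (h : ∀ r : R, r ^ 2 + b * r ≠ c) : IsDomain (AdjoinRoot (quadPoly b c)) :=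
  AdjoinRoot.isDomain_of_prime (prime_quadPoly b c h)

end

/-- The plane curve `y ^ 2 + b(x) y = c(x)` is smooth and geometrically integral over `k`. -/
structure IsSmoothQuadratic {k : Type u} [Field k] (b c : k[X]) : Prop where
  jacobian : ∀ {B : Type u} [CommRing B] [Algebra k B] (t y : B),
    y ^ 2 + aeval t b * y = aeval t c → ∃ p q : B,
      p * (2 * y + aeval t b) + q * (aeval t (derivative b) * y - aeval t (derivative c)) = 1
  no_root : ∀ {L : Type u} [Field L] [Algebra k L] (r : L[X]),
    r ^ 2 + b.map (algebraMap k L) * r ≠ c.map (algebraMap k L)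

variable {k : Type u} [Field k] {b c : k[X]}

theorem IsSmoothQuadratic.no_root_self (h : IsSmoothQuadratic b c) (r : k[X]) :
    r ^ 2 + b * r ≠ c := by
  simpa using h.no_root (L := k) r

section Eval

variable {B : Type*} [CommRing B] [Algebra k B] (t y : B)

/-- Evaluation of the coordinate ring of a plane curve `y ^ 2 + b(x) y = c(x)` at a point. -/
noncomputable def quadEval (hy : y ^ 2 + aeval t b * y = aeval t c) :
    AdjoinRoot (quadPoly b c) →ₐ[k] B :=
  AdjoinRoot.liftAlgHom (quadPoly b c) (aeval t) y
    (by erw [eval₂_quadPoly]; simp [hy])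

@[simp] theorem quadEval_of (hy : y ^ 2 + aeval t b * y = aeval t c) (p : k[X]) :
    quadEval t y hy (AdjoinRoot.of _ p) = aeval t p := by
  simp [quadEval]

@[simp] theorem quadEval_root (hy : y ^ 2 + aeval t b * y = aeval t c) :
    quadEval t y hy (AdjoinRoot.root _) = y := by
  simp [quadEval]

theorem exists_eq_of_add_of_mul_root (z : AdjoinRoot (quadPoly b c)) :
    ∃ p q : k[X], z = AdjoinRoot.of _ p + AdjoinRoot.of _ q * AdjoinRoot.root _ := by
  induction z using AdjoinRoot.induction_on with
  | ih f =>
    have hm := monic_quadPoly b c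
    set r := f %ₘ quadPoly b c with hr
    have h1 : r.natDegree ≤ 1 := by
      have := natDegree_modByMonic_lt f hm (by
        intro h; have := natDegree_quadPoly b c; rw [h, natDegree_one] at this; omega)
      rw [natDegree_quadPoly, ← hr] at this
      omega
    refine ⟨r.coeff 0, r.coeff 1, ?_⟩
    have h2 : AdjoinRoot.mk (quadPoly b c) f = AdjoinRoot.mk _ r := by
      rw [AdjoinRoot.mk_eq_mk]
      exact ⟨f /ₘ quadPoly b c, by rw [sub_eq_iff_eq_add, add_comm, hr, modByMonic_add_div]⟩
    rw [h2, eq_X_add_C_of_natDegree_le_one h1]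
    simp [add_comm]

theorem range_quadEval (hy : y ^ 2 + aeval t b * y = aeval t c) :
    (quadEval t y hy).range = Algebra.adjoin k {t, y} := by
  apply le_antisymm
  · rintro _ ⟨z, rfl⟩
    obtain ⟨p, q, rfl⟩ := exists_eq_of_add_of_mul_root z
    have ht : t ∈ Algebra.adjoin k {t, y} := Algebra.subset_adjoin (by simp)
    have hy' : y ∈ Algebra.adjoin k {t, y} := Algebra.subset_adjoin (by simp)
    simp only [AlgHom.toRingHom_eq_coe, RingHom.coe_coe, map_add, map_mul, quadEval_of,
      quadEval_root]
    have h (p : k[X]) : aeval t p ∈ Algebra.adjoin k {t, y} :=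
      Algebra.adjoin_mono (by simp) (aeval_mem_adjoin_singleton k t (p := p))
    exact add_mem (h _) (mul_mem (h _) hy')
  · rw [Algebra.adjoin_le_iff]
    rintro z (rfl | rfl)
    · exact ⟨AdjoinRoot.of _ X, by simp⟩
    · exact ⟨AdjoinRoot.root _, by simp⟩

theorem quadEval_injective [IsDomain B] (h : ∀ r : k[X], r ^ 2 + b * r ≠ c)
    (ht : Transcendental k t) (hy : y ^ 2 + aeval t b * y = aeval t c) :
    Function.Injective (quadEval t y hy) := by
  have := isDomain_adjoinRoot_quadPoly b c h
  have : Algebra.IsIntegral k[X] (AdjoinRoot (quadPoly b c)) :=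
    have := (monic_quadPoly b c).finite_adjoinRoot
    inferInstance
  rw [← AlgHom.coe_toRingHom, RingHom.injective_iff_ker_eq_bot]
  apply Ideal.eq_bot_of_comap_eq_bot (R := k[X])
  rw [eq_bot_iff]
  intro p hp
  have hp' : quadEval t y hy (AdjoinRoot.of _ p) = 0 := hp
  rw [quadEval_of] at hp'
  by_contra hp0
  exact ht ⟨p, hp0, hp'⟩

/-- The coordinate ring, as a ring of functions. -/
noncomputable def quadEquiv [IsDomain B] (h : ∀ r : k[X], r ^ 2 + b * r ≠ c)
    (ht : Transcendental k t) (hy : y ^ 2 + aeval t b * y = aeval t c) :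
    AdjoinRoot (quadPoly b c) ≃ₐ[k] Algebra.adjoin k {t, y} :=
  (AlgEquiv.ofInjective _ (quadEval_injective t y h ht hy)).trans
    (Subalgebra.equivOfEq _ _ (range_quadEval t y hy))

theorem quadEquiv_coe [IsDomain B] (h : ∀ r : k[X], r ^ 2 + b * r ≠ c)
    (ht : Transcendental k t) (hy : y ^ 2 + aeval t b * y = aeval t c)
    (z : AdjoinRoot (quadPoly b c)) : (quadEquiv t y h ht hy z : B) = quadEval t y hy z := rfl

theorem exists_algHom_adjoin [IsDomain B] (h : ∀ r : k[X], r ^ 2 + b * r ≠ c)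
    (ht : Transcendental k t) (hy : y ^ 2 + aeval t b * y = aeval t c)
    {B' : Type*} [CommRing B'] [Algebra k B'] (t' y' : B')
    (hy' : y' ^ 2 + aeval t' b * y' = aeval t' c) :
    ∃ φ : Algebra.adjoin k {t, y} →ₐ[k] B', ∀ p q : k[X],
      φ ⟨aeval t p + aeval t q * y, by
        rw [← range_quadEval t y hy]; exact ⟨AdjoinRoot.of _ p + AdjoinRoot.of _ q *
          AdjoinRoot.root _, by simp⟩⟩ = aeval t' p + aeval t' q * y' := by
  refine ⟨(quadEval t' y' hy').comp (quadEquiv t y h ht hy).symm.toAlgHom, fun p q => ?_⟩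
  have : (quadEquiv t y h ht hy).symm ⟨aeval t p + aeval t q * y, by
        rw [← range_quadEval t y hy]; exact ⟨AdjoinRoot.of _ p + AdjoinRoot.of _ q *
          AdjoinRoot.root _, by simp⟩⟩ = AdjoinRoot.of _ p + AdjoinRoot.of _ q *
          AdjoinRoot.root _ := by
    rw [AlgEquiv.symm_apply_eq]
    apply Subtype.ext
    simp [quadEquiv_coe]
  simp [this]

theorem mem_adjoin_pair_iff (hy : y ^ 2 + aeval t b * y = aeval t c) (z : B) :
    z ∈ Algebra.adjoin k {t, y} ↔ ∃ p q : k[X], z = aeval t p + aeval t q * y := by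
  rw [← range_quadEval t y hy]
  constructor
  · rintro ⟨z, rfl⟩
    obtain ⟨p, q, rfl⟩ := exists_eq_of_add_of_mul_root z
    exact ⟨p, q, by simp⟩
  · rintro ⟨p, q, rfl⟩
    exact ⟨AdjoinRoot.of _ p + AdjoinRoot.of _ q * AdjoinRoot.root _, by simp⟩

theorem aeval_add_aeval_mul_eq_zero [IsDomain B] (h : ∀ r : k[X], r ^ 2 + b * r ≠ c)
    (ht : Transcendental k t) (hy : y ^ 2 + aeval t b * y = aeval t c) {p q : k[X]}
    (hpq : aeval t p + aeval t q * y = 0) : p = 0 ∧ q = 0 := by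
  have h1 : quadEval t y hy (AdjoinRoot.of _ p + AdjoinRoot.of _ q * AdjoinRoot.root _) = 0 := by
    simpa using hpq
  have h2 := (map_eq_zero_iff _ (quadEval_injective t y h ht hy)).1 h1
  have h3 : AdjoinRoot.mk (quadPoly b c) (C q * X + C p) = 0 := by
    rw [← h2]; simp [add_comm]
  rw [AdjoinRoot.mk_eq_zero] at h3
  have h4 : (C q * X + C p : k[X][X]) = 0 :=
    eq_zero_of_dvd_of_natDegree_lt h3 (by
      rw [natDegree_quadPoly]; exact natDegree_linear_le.trans_lt (by norm_num))
  constructor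
  · simpa using congrArg (fun f => f.coeff 0) h4
  · simpa using congrArg (fun f => f.coeff 1) h4

end Eval

end QuadraticCover

end BirationalSection

namespace BirationalSection

open Polynomial

section FractionField

variable {k : Type u} [Field k] {M : Type u} [Field M] [Algebra k M] {t : M}

theorem dvd_of_isIntegralElem (ht : Transcendental k t) {p d : k[X]} (hd : d ≠ 0) {x : M}
    (hx : (aeval t : k[X] →ₐ[k] M).toRingHom.IsIntegralElem x)
    (h : aeval t d * x = aeval t p) : d ∣ p := by
  let : Algebra k[X] M := (aeval t : k[X] →ₐ[k] M).toRingHom.toAlgebra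
  have hinj : Function.Injective (algebraMap k[X] M) :=
    transcendental_iff_injective.1 ht
  have : FaithfulSMul k[X] M := (faithfulSMul_iff_algebraMap_injective _ _).2 hinj
  let ψ : FractionRing k[X] →ₐ[k[X]] M := IsFractionRing.liftAlgHom (g := Algebra.ofId k[X] M) hinj
  have hx' : IsIntegral k[X] x := hx
  have hdM : algebraMap k[X] M d ≠ 0 := by
    rw [Ne, map_eq_zero_iff _ hinj]; exact hd
  have hdF : algebraMap k[X] (FractionRing k[X]) d ≠ 0 := by
    rwa [Ne, map_eq_zero_iff _ (IsFractionRing.injective k[X] (FractionRing k[X]))]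
  have h1 : ψ (algebraMap _ _ p / algebraMap _ _ d) = x := by
    rw [map_div₀, AlgHom.commutes, AlgHom.commutes, div_eq_iff hdM, mul_comm]
    exact h.symm
  rw [← h1, isIntegral_algHom_iff ψ ψ.toRingHom.injective,
    IsIntegrallyClosed.isIntegral_iff] at hx'
  obtain ⟨r, hr⟩ := hx'
  rw [eq_div_iff hdF, ← map_mul] at hr
  exact ⟨r, by rw [mul_comm]; exact (IsFractionRing.injective k[X] (FractionRing k[X]) hr).symm⟩

variable {y : M} {b c : k[X]}

theorem exists_conj (h : ∀ r : k[X], r ^ 2 + b * r ≠ c) (ht : Transcendental k t)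
    (hy : y ^ 2 + aeval t b * y = aeval t c)
    [IsFractionRing (Algebra.adjoin k {t, y}) M] :
    ∃ σ : M →+* M, (∀ p : k[X], σ (aeval t p) = aeval t p) ∧ σ y = - aeval t b - y := by
  have hy' : (- aeval t b - y) ^ 2 + aeval t b * (- aeval t b - y) = aeval t c := by
    rw [← hy]; ring
  obtain ⟨φ, hφ⟩ := exists_algHom_adjoin t y h ht hy t (- aeval t b - y) hy'
  have hinj : Function.Injective φ := by
    rw [injective_iff_map_eq_zero]
    rintro ⟨z, hz⟩ h0
    obtain ⟨p, q, rfl⟩ := (mem_adjoin_pair_iff t y hy z).1 hz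
    rw [hφ] at h0
    obtain ⟨rfl, rfl⟩ := aeval_add_aeval_mul_eq_zero t _ h ht hy' h0
    exact Subtype.ext (by simp)
  have key : ∀ (p q : k[X]) (hm : aeval t p + aeval t q * y ∈ Algebra.adjoin k {t, y}),
      (IsFractionRing.lift (K := M) (g := φ.toRingHom) hinj) (aeval t p + aeval t q * y) =
        aeval t p + aeval t q * (- aeval t b - y) := by
    intro p q hm
    rw [← hφ]
    exact IsFractionRing.lift_algebraMap (K := M) (g := φ.toRingHom) hinj ⟨_, hm⟩
  refine ⟨IsFractionRing.lift (K := M) (g := φ.toRingHom) hinj, fun p => ?_, ?_⟩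
  · have := key p 0 ((mem_adjoin_pair_iff t y hy _).2 ⟨p, 0, rfl⟩)
    simpa using this
  · have := key 0 1 ((mem_adjoin_pair_iff t y hy _).2 ⟨0, 1, rfl⟩)
    simpa using this

theorem isIntegralElem_of_mem_adjoin (hy : y ^ 2 + aeval t b * y = aeval t c) {z : M}
    (hz : z ∈ Algebra.adjoin k {t, y}) :
    (aeval t : k[X] →ₐ[k] M).toRingHom.IsIntegralElem z := by
  obtain ⟨p, q, rfl⟩ := (mem_adjoin_pair_iff t y hy z).1 hz
  have hyi : (aeval t : k[X] →ₐ[k] M).toRingHom.IsIntegralElem y :=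
    ⟨quadPoly b c, monic_quadPoly b c, by rw [eval₂_quadPoly]; simp [hy]⟩
  exact (RingHom.isIntegralElem_map (aeval t : k[X] →ₐ[k] M).toRingHom).add _
    ((RingHom.isIntegralElem_map (aeval t : k[X] →ₐ[k] M).toRingHom).mul _ hyi)

theorem mem_adjoin_of_prime_mul_mem (h : IsSmoothQuadratic b c) (ht : Transcendental k t)
    (hy : y ^ 2 + aeval t b * y = aeval t c)
    [IsFractionRing (Algebra.adjoin k {t, y}) M] {z : M}
    (hz : (aeval t : k[X] →ₐ[k] M).toRingHom.IsIntegralElem z) {π : k[X]} (hπ : Prime π)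
    (hm : aeval t π * z ∈ Algebra.adjoin k {t, y}) : z ∈ Algebra.adjoin k {t, y} := by
  set f : k[X] →+* M := (aeval t : k[X] →ₐ[k] M).toRingHom with hf
  have hft (p : k[X]) : f p = aeval t p := rfl
  have hpi (p : k[X]) : f.IsIntegralElem (aeval t p) := RingHom.isIntegralElem_map f
  have hyi : f.IsIntegralElem y :=
    isIntegralElem_of_mem_adjoin hy (Algebra.subset_adjoin (by simp))
  obtain ⟨P, Q, hPQ⟩ := (mem_adjoin_pair_iff t y hy _).1 hm
  have hπM : aeval t π ≠ 0 := fun h0 => ht ⟨π, hπ.ne_zero, h0⟩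
  by_cases hdvd : π ∣ Q
  · obtain ⟨Q, rfl⟩ := hdvd
    have hz1 : f.IsIntegralElem (z - aeval t Q * y) := hz.sub _ ((hpi Q).mul _ hyi)
    obtain ⟨P, rfl⟩ := dvd_of_isIntegralElem ht hπ.ne_zero hz1 (p := P) (by
      rw [mul_sub, hPQ, map_mul]; ring)
    refine (mem_adjoin_pair_iff t y hy _).2 ⟨P, Q, mul_left_cancel₀ hπM ?_⟩
    rw [hPQ, map_mul, map_mul]; ring
  · exfalso
    obtain ⟨v, u, huv⟩ := (hπ.irreducible.coprime_iff_not_dvd.2 hdvd)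
    obtain ⟨σ, hσ, hσy⟩ := exists_conj h.no_root_self ht hy
    set a := u * P with ha
    set z1 := aeval t u * z + aeval t v * y with hz1
    have hz1i : f.IsIntegralElem z1 := ((hpi u).mul _ hz).add _ ((hpi v).mul _ hyi)
    have hz1π : aeval t π * z1 = aeval t a + y := by
      have : aeval t v * aeval t π + aeval t u * aeval t Q = 1 := by
        rw [← map_mul, ← map_mul, ← map_add, huv, map_one]
      rw [hz1, ha, map_mul]
      linear_combination aeval t u * hPQ + y * this
    have hσz1 : f.IsIntegralElem (σ z1) := by
      obtain ⟨g, hg, hg0⟩ := hz1i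
      refine ⟨g, hg, ?_⟩
      have := congrArg σ hg0
      rw [hom_eval₂, map_zero] at this
      have hc : σ.comp f = f := RingHom.ext fun p => hσ p
      rwa [hc] at this
    have hσz1π : aeval t π * σ z1 = aeval t a - aeval t b - y := by
      have := congrArg σ hz1π
      rw [map_mul, map_add σ (aeval t a) y, hσ, hσ, hσy] at this
      rw [this]; ring
    have h1 : π ∣ 2 * a - b := dvd_of_isIntegralElem ht hπ.ne_zero (hz1i.add _ hσz1) (by
      rw [mul_add, hz1π, hσz1π, map_sub (aeval t) (2 * a) b, map_mul (aeval t) 2 a, map_ofNat]; ring)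
    have h2 : π ^ 2 ∣ a ^ 2 - a * b - c :=
      dvd_of_isIntegralElem ht (pow_ne_zero 2 hπ.ne_zero) (hz1i.mul _ hσz1) (by
      have : aeval t (π ^ 2) * (z1 * σ z1) = (aeval t π * z1) * (aeval t π * σ z1) := by
        rw [map_pow]; ring
      rw [this, hz1π, hσz1π]
      simp only [map_sub, map_mul, map_pow]
      rw [← hy]; ring)
    have h3 : π ∣ a * derivative b + derivative c := by
      obtain ⟨m, hm⟩ := h2
      obtain ⟨n, hn⟩ := h1
      have := congrArg derivative hm
      simp only [derivative_sub, derivative_mul, derivative_pow] at this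
      refine ⟨derivative a * n - 2 * derivative π * m - π * derivative m, ?_⟩
      simp only [Nat.cast_ofNat, map_ofNat, Nat.add_one_sub_one, pow_one] at this
      linear_combination derivative a * hn - this
    have : Nontrivial (AdjoinRoot π) := AdjoinRoot.nontrivial _ (by
      intro h0
      exact hπ.not_isUnit (by
        rw [Polynomial.isUnit_iff_degree_eq_zero]; exact h0))
    obtain ⟨p, q, hpq⟩ := h.jacobian (B := AdjoinRoot π) (AdjoinRoot.root π)
      (- AdjoinRoot.mk π a) (by
        rw [AdjoinRoot.aeval_eq, AdjoinRoot.aeval_eq, ← sub_eq_zero]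
        simp only [← map_neg, ← map_mul, ← map_pow, ← map_add, ← map_sub]
        rw [AdjoinRoot.mk_eq_zero]
        refine ((dvd_pow_self π two_ne_zero).trans h2).trans (dvd_of_eq ?_)
        ring)
    rw [AdjoinRoot.aeval_eq, AdjoinRoot.aeval_eq, AdjoinRoot.aeval_eq] at hpq
    have e1 : 2 * -AdjoinRoot.mk π a + AdjoinRoot.mk π b = 0 := by
      have := AdjoinRoot.mk_eq_zero.2 h1
      rw [map_sub, map_mul, map_ofNat] at this
      linear_combination -this
    have e2 : AdjoinRoot.mk π (derivative b) * -AdjoinRoot.mk π a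
        - AdjoinRoot.mk π (derivative c) = 0 := by
      have := AdjoinRoot.mk_eq_zero.2 h3
      rw [map_add, map_mul] at this
      linear_combination -this
    rw [e1, e2] at hpq
    simp at hpq

/-- The coordinate ring of a smooth affine curve `y ^ 2 + b(t) y = c(t)` is integrally closed. -/
theorem mem_adjoin_iff_isIntegralElem (h : IsSmoothQuadratic b c) (ht : Transcendental k t)
    (hy : y ^ 2 + aeval t b * y = aeval t c)
    [IsFractionRing (Algebra.adjoin k {t, y}) M] {z : M} :
    z ∈ Algebra.adjoin k {t, y} ↔ (aeval t : k[X] →ₐ[k] M).toRingHom.IsIntegralElem z := by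
  refine ⟨isIntegralElem_of_mem_adjoin hy, fun hz => ?_⟩
  have key : ∀ d : k[X], d ≠ 0 → ∀ z : M,
      (aeval t : k[X] →ₐ[k] M).toRingHom.IsIntegralElem z →
      aeval t d * z ∈ Algebra.adjoin k {t, y} → z ∈ Algebra.adjoin k {t, y} := by
    intro d
    induction d using UniqueFactorizationMonoid.induction_on_prime with
    | h₁ => intro h; exact absurd rfl h
    | h₂ x hx =>
      intro _ z _ hm
      obtain ⟨r, hr, rfl⟩ := Polynomial.isUnit_iff.1 hx
      have := Subalgebra.smul_mem _ hm r⁻¹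
      rw [aeval_C, ← Algebra.smul_def, smul_smul, inv_mul_cancel₀ hr.ne_zero, one_smul] at this
      exact this
    | h₃ a π ha hπ ih =>
      intro _ z hz hm
      apply mem_adjoin_of_prime_mul_mem h ht hy hz hπ
      apply ih ha _ ((RingHom.isIntegralElem_map _).mul _ hz)
      rw [map_mul] at hm
      convert hm using 1
      simp only [AlgHom.toRingHom_eq_coe, RingHom.coe_coe]
      ring
  obtain ⟨s₁, s₂, hs₂, rfl⟩ := IsFractionRing.div_surjective (A := Algebra.adjoin k {t, y}) z
  obtain ⟨p, q, hpq⟩ := (mem_adjoin_pair_iff t y hy _).1 s₂.2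
  have hs20 : s₂ ≠ 0 := nonZeroDivisors.ne_zero hs₂
  have hs2M : (s₂ : M) ≠ 0 := fun h0 => hs20 (Subtype.ext h0)
  have hconj : aeval t p - aeval t q * aeval t b - aeval t q * y ∈ Algebra.adjoin k {t, y} :=
    (mem_adjoin_pair_iff t y hy _).2 ⟨p - q * b, - q, by simp; ring⟩
  have hN : aeval t (p ^ 2 - b * p * q - c * q ^ 2) =
      (aeval t p - aeval t q * aeval t b - aeval t q * y) * s₂ := by
    rw [hpq]
    simp only [map_sub, map_mul, map_pow]
    rw [← hy]; ring
  apply key (p ^ 2 - b * p * q - c * q ^ 2) _ _ hz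
  · rw [hN]
    have : (aeval t p - aeval t q * aeval t b - aeval t q * y) * (s₂ : M) *
        (algebraMap (Algebra.adjoin k {t, y}) M s₁ / algebraMap (Algebra.adjoin k {t, y}) M s₂) =
        (aeval t p - aeval t q * aeval t b - aeval t q * y) * s₁ := by
      have h1 : algebraMap (Algebra.adjoin k {t, y}) M s₂ = s₂ := rfl
      have h2 : algebraMap (Algebra.adjoin k {t, y}) M s₁ = s₁ := rfl
      rw [h1, h2]; field_simp
    rw [this]
    exact mul_mem hconj s₁.2
  · intro h0
    rw [h0, map_zero] at hN
    rcases mul_eq_zero.1 hN.symm with h1 | h1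
    · have h2 : aeval t (p - q * b) + aeval t (-q) * y = 0 := by
        rw [← h1]; simp; ring
      obtain ⟨h3, h4⟩ := aeval_add_aeval_mul_eq_zero t y h.no_root_self ht hy h2
      have hq : q = 0 := by simpa using h4
      subst hq
      have hp : p = 0 := by simpa using h3
      subst hp
      exact hs2M (by rw [hpq]; simp)
    · exact hs2M h1

end FractionField

end BirationalSection

namespace BirationalSection

open Polynomial

section Smoothness

variable {k : Type u} [Field k] {M : Type u} [Field M] [Algebra k M] {t y : M} {b c : k[X]}

theorem root_quadPoly {R : Type*} [CommRing R] (b c : R) :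
    AdjoinRoot.root (quadPoly b c) ^ 2 + AdjoinRoot.of (quadPoly b c) b *
      AdjoinRoot.root (quadPoly b c) = AdjoinRoot.of (quadPoly b c) c := by
  have := AdjoinRoot.eval₂_root (quadPoly b c)
  rwa [eval₂_quadPoly, sub_eq_zero] at this

theorem aeval_of_X {R : Type*} [CommRing R] (F : R[X][X]) (f : R[X]) :
    aeval (AdjoinRoot.of F X) f = AdjoinRoot.of F f := by
  have h1 := aeval_algHom_apply (IsScalarTower.toAlgHom R R[X] (AdjoinRoot F)) X f
  rw [aeval_X_left_apply] at h1
  exact h1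

theorem algebraFiniteType_adjoin_pair : Algebra.FiniteType k (Algebra.adjoin k {t, y}) :=
  (Subalgebra.fg_iff_finiteType _).1 (Subalgebra.fg_def.2 ⟨_, Set.toFinite _, rfl⟩)

theorem exists_jacobian_adjoin (h : IsSmoothQuadratic b c)
    (hy : y ^ 2 + aeval t b * y = aeval t c) :
    ∃ p ∈ Algebra.adjoin k {t, y}, ∃ q ∈ Algebra.adjoin k {t, y},
      p * (2 * y + aeval t b) + q * (aeval t (derivative b) * y - aeval t (derivative c)) = 1 := by
  let S := Algebra.adjoin k {t, y}
  let t' : S := ⟨t, Algebra.subset_adjoin (by simp)⟩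
  let y' : S := ⟨y, Algebra.subset_adjoin (by simp)⟩
  have hv (f : k[X]) : ((aeval t' f : S) : M) = aeval t f := by
    have := aeval_algHom_apply S.val t' f
    exact this.symm
  obtain ⟨p, q, hpq⟩ := h.jacobian t' y' (Subtype.ext (by
    simp only [AddMemClass.coe_add, SubmonoidClass.coe_pow, MulMemClass.coe_mul, hv]
    exact hy))
  refine ⟨p, p.2, q, q.2, ?_⟩
  have := congrArg (fun z : S => (z : M)) hpq
  simp only [AddMemClass.coe_add, AddSubgroupClass.coe_sub, MulMemClass.coe_mul, hv] at this
  exact this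

theorem formallySmooth_adjoin (h : IsSmoothQuadratic b c) (ht : Transcendental k t)
    (hy : y ^ 2 + aeval t b * y = aeval t c) :
    Algebra.FormallySmooth k (Algebra.adjoin k {t, y}) := by
  have e := quadEquiv t y h.no_root_self ht hy
  suffices Algebra.FormallySmooth k (AdjoinRoot (quadPoly b c)) from .of_equiv e
  apply Algebra.FormallySmooth.of_comp_surjective
  intro B _ _ I hI φ
  let t' : AdjoinRoot (quadPoly b c) := AdjoinRoot.of _ X
  let y' : AdjoinRoot (quadPoly b c) := AdjoinRoot.root _
  have hv (f : k[X]) : aeval t' f = AdjoinRoot.of (quadPoly b c) f := aeval_of_X _ f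
  have hy' : y' ^ 2 + aeval t' b * y' = aeval t' c := by
    rw [hv, hv]; exact root_quadPoly b c
  obtain ⟨p, q, hpq⟩ := h.jacobian t' y' hy'
  obtain ⟨t₀, ht₀⟩ := Ideal.Quotient.mkₐ_surjective k I (φ t')
  obtain ⟨y₀, hy₀⟩ := Ideal.Quotient.mkₐ_surjective k I (φ y')
  obtain ⟨p₀, hp₀⟩ := Ideal.Quotient.mkₐ_surjective k I (φ p)
  obtain ⟨q₀, hq₀⟩ := Ideal.Quotient.mkₐ_surjective k I (φ q)
  have hmk (f : k[X]) : Ideal.Quotient.mkₐ k I (aeval t₀ f) = φ (aeval t' f) := by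
    rw [← aeval_algHom_apply, ← aeval_algHom_apply, ht₀]
  set ε := y₀ ^ 2 + aeval t₀ b * y₀ - aeval t₀ c with hε
  have hεI : ε ∈ I := by
    rw [← Ideal.Quotient.eq_zero_iff_mem, ← Ideal.Quotient.mkₐ_eq_mk k, hε]
    simp only [map_sub, map_add, map_mul, map_pow, hmk, hy₀]
    simp only [← map_add, ← map_mul, ← map_pow, hy', sub_self]
  have hδI : p₀ * (2 * y₀ + aeval t₀ b) +
      q₀ * (aeval t₀ (derivative b) * y₀ - aeval t₀ (derivative c)) - 1 ∈ I := by
    rw [← Ideal.Quotient.eq_zero_iff_mem, ← Ideal.Quotient.mkₐ_eq_mk k]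
    simp only [map_sub, map_add, map_mul, hmk, hy₀, hp₀, hq₀, map_one, map_ofNat]
    have := congrArg φ hpq
    simp only [map_sub, map_add, map_mul, map_one, map_ofNat] at this
    rw [this, sub_self]
  have hsq {x z : B} (hx : x ∈ I) (hz : z ∈ I) : x * z = 0 := by
    have : x * z ∈ I ^ 2 := by rw [pow_two]; exact Ideal.mul_mem_mul hx hz
    rwa [hI] at this
  have hε2 : ε * ε = 0 := hsq hεI hεI
  have hεδ := hsq hεI hδI
  have ht1 (f : k[X]) : aeval (t₀ + (-(q₀ * ε))) f =
      aeval t₀ f + aeval t₀ (derivative f) * (-(q₀ * ε)) :=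
    aeval_add_of_sq_eq_zero _ _ _ (by linear_combination q₀ ^ 2 * hε2)
  have hy1 : (y₀ - p₀ * ε) ^ 2 + aeval (t₀ + (-(q₀ * ε))) b * (y₀ - p₀ * ε) =
      aeval (t₀ + (-(q₀ * ε))) c := by
    rw [ht1, ht1]
    linear_combination (p₀ ^ 2 + aeval t₀ (derivative b) * p₀ * q₀) * hε2 - hεδ - hε
  refine ⟨quadEval _ _ hy1, ?_⟩
  have hmkI {x : B} (hx : x ∈ I) : Ideal.Quotient.mk I x = 0 :=
    Ideal.Quotient.eq_zero_iff_mem.2 hx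
  apply AlgHom.ext
  intro z
  obtain ⟨f, g, rfl⟩ := exists_eq_of_add_of_mul_root z
  have h1 (f : k[X]) : Ideal.Quotient.mkₐ k I (aeval (t₀ + (-(q₀ * ε))) f) = φ (aeval t' f) := by
    rw [ht1, map_add, hmk, Ideal.Quotient.mkₐ_eq_mk, hmkI (x := _ * _), add_zero]
    exact Ideal.mul_mem_left _ _ (neg_mem (Ideal.mul_mem_left _ _ hεI))
  have h2 : Ideal.Quotient.mkₐ k I (y₀ - p₀ * ε) = φ y' := by
    rw [map_sub, hy₀, Ideal.Quotient.mkₐ_eq_mk, hmkI (x := _ * _), sub_zero]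
    exact Ideal.mul_mem_left _ _ hεI
  rw [AlgHom.comp_apply, map_add, map_mul, quadEval_of, quadEval_of, quadEval_root, map_add,
    map_mul, h1, h1, h2, map_add, map_mul, hv, hv]

theorem smooth_adjoin (h : IsSmoothQuadratic b c) (ht : Transcendental k t)
    (hy : y ^ 2 + aeval t b * y = aeval t c) :
    Algebra.Smooth k (Algebra.adjoin k {t, y}) where
  formallySmooth := formallySmooth_adjoin h ht hy
  finitePresentation :=
    have := algebraFiniteType_adjoin_pair (k := k) (t := t) (y := y)
    Algebra.FinitePresentation.of_finiteType.1 this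

open KaehlerDifferential

theorem exists_D_eq_smul {ω : Ω[M⁄k]} {S : Subalgebra k M} [IsFractionRing S M]
    (hω : ∀ s ∈ S, ∃ r ∈ S, D k M s = r • ω) (z : M) : ∃ r : M, D k M z = r • ω := by
  obtain ⟨s₁, s₂, -, rfl⟩ := IsFractionRing.div_surjective (A := S) z
  obtain ⟨r₁, -, h₁⟩ := hω s₁ s₁.2
  obtain ⟨r₂, -, h₂⟩ := hω s₂ s₂.2
  change ∃ r : M, D k M ((s₁ : M) / s₂) = r • ω
  rw [Derivation.leibniz_div, h₁, h₂, smul_smul, smul_smul, ← sub_smul, smul_smul]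
  exact ⟨_, rfl⟩

theorem exists_generator_differentials (h : IsSmoothQuadratic b c) (ht : Transcendental k t)
    (hy : y ^ 2 + aeval t b * y = aeval t c)
    [IsFractionRing (Algebra.adjoin k {t, y}) M] :
    ∃ ω : Ω[M⁄k], (∃ p ∈ Algebra.adjoin k {t, y}, ∃ q ∈ Algebra.adjoin k {t, y},
        ω = p • D k M t + q • D k M y) ∧
      D k M t = (2 * y + aeval t b) • ω ∧
      (∀ s ∈ Algebra.adjoin k {t, y}, ∃ r ∈ Algebra.adjoin k {t, y}, D k M s = r • ω) ∧
      ω ≠ 0 ∧ ∀ η : Ω[M⁄k], ∃ m : M, η = m • ω := by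
  obtain ⟨p, hp, q, hq, hpq⟩ := exists_jacobian_adjoin h hy
  have hrel : (2 * y + aeval t b) • D k M y +
      (aeval t (derivative b) * y - aeval t (derivative c)) • D k M t = 0 := by
    have := congrArg (D k M) hy
    rw [map_add, Derivation.leibniz, Derivation.leibniz_pow, Derivation.map_aeval,
      Derivation.map_aeval] at this
    rw [sub_smul, ← this]
    module
  set ω := p • D k M t - q • D k M y with hω
  have h1 : D k M t = (2 * y + aeval t b) • ω := by
    have : D k M t = (p * (2 * y + aeval t b) +
        q * (aeval t (derivative b) * y - aeval t (derivative c))) • D k M t := by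
      rw [hpq, one_smul]
    rw [this, hω]
    have h2 := congrArg (fun z => q • z) hrel
    simp only [smul_zero, smul_add] at h2
    rw [← sub_eq_zero]
    refine Eq.trans ?_ h2
    module
  have h2 : D k M y = (aeval t (derivative c) - aeval t (derivative b) * y) • ω := by
    have : D k M y = (p * (2 * y + aeval t b) +
        q * (aeval t (derivative b) * y - aeval t (derivative c))) • D k M y := by
      rw [hpq, one_smul]
    rw [this, hω]
    have h2 := congrArg (fun z => p • z) hrel
    simp only [smul_zero, smul_add] at h2
    rw [← sub_eq_zero]
    refine Eq.trans ?_ h2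
    module
  have htm : t ∈ Algebra.adjoin k {t, y} := Algebra.subset_adjoin (by simp)
  have hym : y ∈ Algebra.adjoin k {t, y} := Algebra.subset_adjoin (by simp)
  have ha (f : k[X]) : aeval t f ∈ Algebra.adjoin k {t, y} :=
    Algebra.adjoin_mono (by simp) (aeval_mem_adjoin_singleton k t (p := f))
  have h3 : ∀ s ∈ Algebra.adjoin k {t, y}, ∃ r ∈ Algebra.adjoin k {t, y}, D k M s = r • ω := by
    intro s hs
    induction hs using Algebra.adjoin_induction with
    | mem x hx =>
      rcases hx with rfl | rfl
      · exact ⟨_, add_mem (mul_mem (ofNat_mem _ 2) hym) (ha b), h1⟩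
      · exact ⟨_, sub_mem (ha _) (mul_mem (ha _) hym), h2⟩
    | algebraMap r => exact ⟨0, zero_mem _, by simp⟩
    | add x z _ _ hx hz =>
      obtain ⟨r₁, hr₁, e₁⟩ := hx
      obtain ⟨r₂, hr₂, e₂⟩ := hz
      exact ⟨r₁ + r₂, add_mem hr₁ hr₂, by rw [map_add, e₁, e₂, add_smul]⟩
    | mul x z hx' hz' hx hz =>
      obtain ⟨r₁, hr₁, e₁⟩ := hx
      obtain ⟨r₂, hr₂, e₂⟩ := hz
      exact ⟨x * r₂ + z * r₁, add_mem (mul_mem hx' hr₂) (mul_mem hz' hr₁), by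
        rw [Derivation.leibniz, e₁, e₂, add_smul, mul_smul, mul_smul]⟩
  have h4 : ∀ η : Ω[M⁄k], ∃ m : M, η = m • ω := by
    intro η
    have hη : η ∈ Submodule.span M (Set.range (D k M)) := by
      rw [KaehlerDifferential.span_range_derivation]; trivial
    have hle : Submodule.span M (Set.range (D k M)) ≤ Submodule.span M {ω} := by
      rw [Submodule.span_le]
      rintro _ ⟨z, rfl⟩
      obtain ⟨r, hr⟩ := exists_D_eq_smul h3 z
      rw [hr]
      exact Submodule.smul_mem _ _ (Submodule.mem_span_singleton_self _)
    obtain ⟨m, hm⟩ := Submodule.mem_span_singleton.1 (hle hη)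
    exact ⟨m, hm.symm⟩
  refine ⟨ω, ⟨p, hp, -q, neg_mem hq, by rw [hω]; module⟩, h1, h3, ?_, h4⟩
  intro h0
  have hsub : Subsingleton Ω[M⁄k] := by
    refine ⟨fun x z => ?_⟩
    obtain ⟨m, rfl⟩ := h4 x
    obtain ⟨n, rfl⟩ := h4 z
    rw [h0, smul_zero, smul_zero]
  have : Algebra.FormallyUnramified k M := ⟨hsub⟩
  have := algebraFiniteType_adjoin_pair (k := k) (t := t) (y := y)
  have : Algebra.EssFiniteType (Algebra.adjoin k {t, y}) M :=
    .of_isLocalization _ (nonZeroDivisors (Algebra.adjoin k {t, y}))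
  have : Algebra.EssFiniteType k M := .comp k (Algebra.adjoin k {t, y}) M
  have := Algebra.FormallyUnramified.isSeparable k M
  exact ht (Algebra.IsAlgebraic.isAlgebraic t)

/-- The coordinate ring of a smooth plane quadratic cover is smooth of relative dimension one. -/
theorem locally_isStandardSmooth_adjoin (h : IsSmoothQuadratic b c) (ht : Transcendental k t)
    (hy : y ^ 2 + aeval t b * y = aeval t c)
    [IsFractionRing (Algebra.adjoin k {t, y}) M] :
    RingHom.Locally (RingHom.IsStandardSmoothOfRelativeDimension 1)
      (algebraMap k (Algebra.adjoin k {t, y})) := by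
  have := smooth_adjoin h ht hy
  obtain ⟨s, hs, hstd⟩ :=
    Algebra.Smooth.exists_span_eq_top_isStandardSmooth k (Algebra.adjoin k {t, y})
  obtain ⟨ω, -, -, -, hω, hspan⟩ := exists_generator_differentials h ht hy
  refine ⟨s \ {0}, ?_, ?_⟩
  · rw [Ideal.span_sdiff_singleton_zero, hs]
  rintro r ⟨hr, hr0⟩
  have hr0 : r ≠ 0 := hr0
  have := hstd r hr
  let A := Algebra.adjoin k {t, y}
  let T := Localization.Away r
  have hle : Submonoid.powers r ≤ nonZeroDivisors A :=
    powers_le_nonZeroDivisors_of_noZeroDivisors hr0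
  have : IsDomain T := IsLocalization.isDomain_localization hle
  let : Algebra T M := (IsLocalization.lift (M := Submonoid.powers r) (S := T)
    (g := algebraMap A M) (fun z => IsUnit.mk0 _ (by
      rw [Ne, map_eq_zero_iff _ (IsFractionRing.injective A M)]
      exact nonZeroDivisors.ne_zero (hle z.2)))).toAlgebra
  have : IsScalarTower A T M := .of_algebraMap_eq fun x =>
    (IsLocalization.lift_eq _ x).symm
  have : IsScalarTower k T M := .of_algebraMap_eq fun x => by
    rw [IsScalarTower.algebraMap_apply k A M, IsScalarTower.algebraMap_apply k A T,
      ← IsScalarTower.algebraMap_apply A T M]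
  have : IsFractionRing T M :=
    IsFractionRing.isFractionRing_of_isDomain_of_isLocalization (Submonoid.powers r) T M
  have hcomp : (algebraMap A T).comp (algebraMap k A) = algebraMap k T := rfl
  rw [hcomp, RingHom.isStandardSmoothOfRelativeDimension_algebraMap,
    Algebra.IsStandardSmoothOfRelativeDimension.iff_of_isStandardSmooth]
  rw [← IsLocalizedModule.rank_eq (nonZeroDivisors T) le_rfl (KaehlerDifferential.map k k T M),
    ← IsLocalization.rank_eq M (nonZeroDivisors T) le_rfl, Nat.cast_one]
  exact rank_eq_one ω hω fun w => (hspan w).imp fun _ h => h.symm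

end Smoothness

section TensorProduct

variable {k : Type u} [Field k] {M : Type u} [Field M] [Algebra k M] {t y : M} {b c : k[X]}

open TensorProduct

theorem isDomain_tensorProduct_adjoin (h : IsSmoothQuadratic b c) (ht : Transcendental k t)
    (hy : y ^ 2 + aeval t b * y = aeval t c) (L : Type u) [Field L] [Algebra k L] :
    IsDomain (L ⊗[k] Algebra.adjoin k {t, y}) := by
  let A := AdjoinRoot (quadPoly b c)
  let bL := b.map (algebraMap k L)
  let cL := c.map (algebraMap k L)
  let T := AdjoinRoot (quadPoly bL cL)
  have : IsDomain T := isDomain_adjoinRoot_quadPoly bL cL h.no_root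
  suffices IsDomain (L ⊗[k] A) from
    (Algebra.TensorProduct.congr (AlgEquiv.refl (R := k) (A₁ := L))
      (quadEquiv t y h.no_root_self ht hy)).symm.toMulEquiv.isDomain
  have : IsScalarTower k L T := inferInstance
  have hTof (f : k[X]) : aeval (AdjoinRoot.of (quadPoly bL cL) X) f =
      AdjoinRoot.of (quadPoly bL cL) (f.map (algebraMap k L)) := by
    rw [← aeval_map_algebraMap L, aeval_of_X]
  let φ : A →ₐ[k] T := quadEval (AdjoinRoot.of _ X) (AdjoinRoot.root _) (by
    rw [hTof, hTof]; exact root_quadPoly bL cL)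
  let Φ : L ⊗[k] A →ₐ[L] T := Algebra.TensorProduct.lift (Algebra.ofId L T) φ
    fun _ _ => Commute.all _ _
  let ι : A →ₐ[k] L ⊗[k] A := Algebra.TensorProduct.includeRight
  have hιof (f : k[X]) : aeval (ι (AdjoinRoot.of (quadPoly b c) X)) (f.map (algebraMap k L)) =
      ι (AdjoinRoot.of (quadPoly b c) f) := by
    rw [aeval_map_algebraMap, aeval_algHom_apply, aeval_of_X]
  let Ψ : T →ₐ[L] L ⊗[k] A := quadEval (ι (AdjoinRoot.of _ X)) (ι (AdjoinRoot.root _)) (by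
    rw [hιof, hιof, ← map_pow, ← map_mul, ← map_add, root_quadPoly])
  have hΨΦ : Ψ.comp Φ = AlgHom.id L _ := by
    apply Algebra.TensorProduct.ext
    · ext
    · apply AlgHom.ext
      intro z
      obtain ⟨p, q, rfl⟩ := exists_eq_of_add_of_mul_root z
      have hp (p : k[X]) : Ψ (φ (AdjoinRoot.of _ p)) = ι (AdjoinRoot.of _ p) := by
        rw [quadEval_of, hTof, quadEval_of, hιof]
      have hr : Ψ (φ (AdjoinRoot.root _)) = ι (AdjoinRoot.root _) := by
        rw [quadEval_root, quadEval_root]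
      have hz (z : A) : Φ (ι z) = φ z := by simp [Φ, ι]
      change Ψ (Φ (ι _)) = ι _
      rw [hz, map_add, map_mul, map_add, map_mul, hp, hp, hr, map_add, map_mul]
  have hinj : Function.Injective Φ := by
    have : Function.LeftInverse Ψ Φ := fun x => DFunLike.congr_fun hΨΦ x
    exact this.injective
  exact hinj.isDomain Φ.toRingHom

end TensorProduct

end BirationalSection

namespace BirationalSection

open Polynomial

section RationalFunctionField

variable {k : Type u} [Field k] {K : Type u} [Field K] [Algebra k K] {t : K}

theorem mem_range_of_isAlgebraic (ht : Transcendental k t)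
    [IsFractionRing (Algebra.adjoin k {t}) K] {x : K} (hx : IsAlgebraic k x) :
    x ∈ (algebraMap k K).range := by
  obtain ⟨s₁, s₂, hs₂, hs⟩ := IsFractionRing.div_surjective (A := Algebra.adjoin k {t}) x
  have hle : Algebra.adjoin k {t} ≤ (aeval t : k[X] →ₐ[k] K).range :=
    (Algebra.adjoin_singleton_eq_range_aeval k t).le
  obtain ⟨p, hp⟩ := hle s₁.2
  obtain ⟨d, hd⟩ := hle s₂.2
  have hs20 : (s₂ : K) ≠ 0 := fun h0 => nonZeroDivisors.ne_zero hs₂ (Subtype.ext h0)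
  have hd0 : d ≠ 0 := by
    rintro rfl
    exact hs20 (by rw [← hd]; simp)
  have hd' : aeval t d = (s₂ : K) := hd
  have hp' : aeval t p = (s₁ : K) := hp
  have hxs : (s₂ : K) * x = s₁ := by
    rw [← hs]; change (s₂ : K) * ((s₁ : K) / s₂) = s₁; field_simp
  have hxi : (aeval t : k[X] →ₐ[k] K).toRingHom.IsIntegralElem x := by
    obtain ⟨f, hf, hf0⟩ := isAlgebraic_iff_isIntegral.1 hx
    refine ⟨f.map C, hf.map _, ?_⟩
    have hcomp : (aeval t : k[X] →ₐ[k] K).toRingHom.comp C = algebraMap k K :=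
      RingHom.ext fun r => aeval_C t r
    rw [eval₂_map, hcomp, hf0]
  obtain ⟨r, rfl⟩ := dvd_of_isIntegralElem ht hd0 hxi (p := p) (by rw [hd', hp', hxs])
  have hxr : x = aeval t r := by
    apply mul_left_cancel₀ hs20
    rw [hxs, ← hp', map_mul, hd']
  have : r.natDegree = 0 := by
    by_contra h0
    exact ht.aeval r h0 (mem_nonZeroDivisors_of_ne_zero (by
      rw [Ne, leadingCoeff_eq_zero]; rintro rfl; simp at h0)) (hxr ▸ hx)
  rw [eq_C_of_natDegree_eq_zero this, aeval_C] at hxr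
  exact ⟨_, hxr.symm⟩

variable (k K) in
theorem isSeparable_of_isAlgebraic {Ω : Type u} [Field Ω] [Algebra K Ω] [Algebra k Ω]
    [IsScalarTower k K Ω] [Algebra.IsSeparable K Ω]
    (hK : ∀ x : K, IsAlgebraic k x → x ∈ (algebraMap k K).range)
    {x : Ω} (hx : IsAlgebraic k x) : IsSeparable k x := by
  have hxk : IsIntegral k x := isAlgebraic_iff_isIntegral.1 hx
  have hxK : IsIntegral K x := Algebra.IsIntegral.isIntegral x
  have hdvd : minpoly K x ∣ (minpoly k x).map (algebraMap k K) :=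
    minpoly.dvd_map_of_isScalarTower k K x
  have hcoeff (i : ℕ) : (minpoly K x).coeff i ∈ (algebraMap k K).range :=
    hK _ (isAlgebraic_iff_isIntegral.2
      (isIntegral_coeff_of_dvd _ _ (minpoly.monic hxk) (minpoly.monic hxK) hdvd i))
  have hlift : minpoly K x ∈ lifts (algebraMap k K) := by
    rw [lifts_iff_coeff_lifts]
    exact hcoeff
  obtain ⟨q, hq⟩ := (mem_lifts _).1 hlift
  have hsep : (minpoly K x).Separable := Algebra.IsSeparable.isSeparable K x
  rw [← hq, separable_map] at hsep
  refine hsep.of_dvd (minpoly.dvd k x ?_)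
  rw [← aeval_map_algebraMap K, hq, minpoly.aeval]

theorem isGalois_algebraicClosure {Ω : Type u} [Field Ω] [Algebra K Ω] [Algebra k Ω]
    [IsScalarTower k K Ω] [IsSepClosure K Ω]
    (hK : ∀ x : K, IsAlgebraic k x → x ∈ (algebraMap k K).range) :
    IsGalois k (algebraicClosure k Ω) := by
  have : IsSepClosed Ω := IsSepClosure.sep_closed K
  have : Algebra.IsSeparable K Ω := IsSepClosure.separable
  have heq : algebraicClosure k Ω = separableClosure k Ω := by
    apply le_antisymm
    · intro x hx
      exact mem_separableClosure_iff.2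
        (isSeparable_of_isAlgebraic k K hK (mem_algebraicClosure_iff.1 hx))
    · intro x hx
      exact mem_algebraicClosure_iff.2 (mem_separableClosure_iff.1 hx).isIntegral.isAlgebraic
  rw [heq]
  infer_instance

end RationalFunctionField

section Sections

variable {k K Ω : Type u} [Field k] [Field K] [Field Ω] [Algebra k K] [Algebra K Ω] [Algebra k Ω]
  [IsScalarTower k K Ω]

theorem IsGaloisSection.apply_coe
    {s : (algebraicClosure k Ω ≃ₐ[k] algebraicClosure k Ω) →* (Ω ≃ₐ[K] Ω)}
    (hs : IsGaloisSection k K Ω s) (τ : algebraicClosure k Ω ≃ₐ[k] algebraicClosure k Ω)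
    (a : algebraicClosure k Ω) : s τ a = τ a := by
  rw [← galProj_apply_coe k]
  have := DFunLike.congr_fun hs.2 τ
  exact congrArg (fun z => ((z a : algebraicClosure k Ω) : Ω)) this

theorem mem_range_of_forall_fixed [IsGalois k (algebraicClosure k Ω)] (a : algebraicClosure k Ω)
    (h : ∀ τ : algebraicClosure k Ω ≃ₐ[k] algebraicClosure k Ω, τ a = a) :
    ∃ c : k, algebraMap k (algebraicClosure k Ω) c = a := by
  have := (InfiniteGalois.mem_bot_iff_fixed a).2 h
  exact IntermediateField.mem_bot.1 this

theorem continuous_galois_iff [Algebra.IsIntegral K Ω] {G : Type*} [Group G] [TopologicalSpace G]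
    [IsTopologicalGroup G] (φ : G →* (Ω ≃ₐ[K] Ω)) :
    Continuous φ ↔ ∀ x : Ω, IsOpen {g | φ g x = x} := by
  constructor
  · intro h x
    exact (stabilizer_isOpen_of_isIntegral x).preimage h
  · intro h
    refine continuous_of_continuousAt_one φ ?_
    rw [ContinuousAt, map_one]
    intro U hU
    obtain ⟨E, hE, hEU⟩ := (krullTopology_mem_nhds_one_iff K Ω U).1 hU
    obtain ⟨S, rfl⟩ : E.FG := IntermediateField.essFiniteType_iff.1 inferInstance
    have : (⋂ x ∈ S, {g | φ g x = x}) ∈ nhds (1 : G) :=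
      (Filter.biInter_finset_mem S).2 fun x _ => (h x).mem_nhds (by simp)
    refine Filter.mem_map.2 (Filter.mem_of_superset this fun g hg => hEU ?_)
    change φ g ∈ (IntermediateField.adjoin K (S : Set Ω)).fixingSubgroup
    rw [IntermediateField.mem_fixingSubgroup_iff]
    intro x hx
    induction hx using IntermediateField.adjoin_induction with
    | mem x hx => exact Set.mem_iInter₂.1 hg x hx
    | algebraMap x => exact AlgEquiv.commutes _ _
    | add x y _ _ hx hy => exact (map_add _ _ _).trans (congrArg₂ _ hx hy)
    | inv x _ hx => exact (map_inv₀ _ _).trans (congrArg _ hx)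
    | mul x y _ _ hx hy => exact (map_mul _ _ _).trans (congrArg₂ _ hx hy)

theorem exists_conjugate_pair [Algebra.IsIntegral K Ω] [IsGalois k (algebraicClosure k Ω)]
    {s : (algebraicClosure k Ω ≃ₐ[k] algebraicClosure k Ω) →* (Ω ≃ₐ[K] Ω)}
    (hs : IsGaloisSection k K Ω s) {z z' : Ω}
    (hσ : ∀ σ : Ω ≃ₐ[K] Ω, (σ z = z ∧ σ z' = z') ∨ (σ z = z' ∧ σ z' = z)) :
    (∀ τ, s τ z = z) ∨ ∃ e e' : algebraicClosure k Ω, e ≠ e' ∧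
      ∀ τ, (s τ z = z ∧ τ e = e ∧ τ e' = e') ∨ (s τ z = z' ∧ τ e = e' ∧ τ e' = e) := by
  by_cases hall : ∀ τ, s τ z = z
  · exact Or.inl hall
  right
  push Not at hall
  obtain ⟨τ₀, hτ₀⟩ := hall
  have hopen : IsOpen {τ | s τ z = z} := (continuous_galois_iff s).1 hs.1 z
  let N : Subgroup (algebraicClosure k Ω ≃ₐ[k] algebraicClosure k Ω) :=
    (MulAction.stabilizer (Ω ≃ₐ[K] Ω) z).comap s
  have hNmem (τ) : τ ∈ N ↔ s τ z = z := Iff.rfl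
  have hNo : IsOpen (N : Set (algebraicClosure k Ω ≃ₐ[k] algebraicClosure k Ω)) := hopen
  let N' : ClosedSubgroup (algebraicClosure k Ω ≃ₐ[k] algebraicClosure k Ω) :=
    ⟨N, N.isClosed_of_isOpen hNo⟩
  have hfix := InfiniteGalois.fixingSubgroup_fixedField N'
  have hτ₀N : τ₀ ∉ (IntermediateField.fixedField N'.1).fixingSubgroup := by
    rw [hfix]; exact hτ₀
  rw [IntermediateField.mem_fixingSubgroup_iff] at hτ₀N
  push Not at hτ₀N
  obtain ⟨e, he, heτ⟩ := hτ₀N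
  have heN (τ) (hτ : s τ z = z) : τ e = e := he ⟨τ, hτ⟩
  have hsw : s τ₀ z = z' ∧ s τ₀ z' = z := (hσ (s τ₀)).resolve_left fun h => hτ₀ h.1
  have hsi : s τ₀⁻¹ z = z' ∧ s τ₀⁻¹ z' = z := by
    refine (hσ (s τ₀⁻¹)).resolve_left fun h => hτ₀ ?_
    have h1 := congrArg (s τ₀) h.1
    rw [← AlgEquiv.mul_apply, ← map_mul, mul_inv_cancel, map_one] at h1
    exact h1.symm
  refine ⟨e, τ₀ e, fun h => heτ h.symm, fun τ => ?_⟩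
  rcases hσ (s τ) with ⟨h1, h2⟩ | ⟨h1, h2⟩
  · left
    refine ⟨h1, heN τ h1, ?_⟩
    have h3 := heN (τ₀⁻¹ * τ * τ₀) (by
      rw [map_mul, map_mul, AlgEquiv.mul_apply, AlgEquiv.mul_apply, hsw.1, h2, hsi.2])
    have h4 := congrArg τ₀ h3
    rw [← AlgEquiv.mul_apply, ← mul_assoc, ← mul_assoc, mul_inv_cancel, one_mul,
      AlgEquiv.mul_apply] at h4
    exact h4
  · right
    refine ⟨h1, ?_, ?_⟩
    · have h3 := heN (τ₀⁻¹ * τ) (by rw [map_mul, AlgEquiv.mul_apply, h1, hsi.2])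
      have h4 := congrArg τ₀ h3
      rw [← AlgEquiv.mul_apply, ← mul_assoc, mul_inv_cancel, one_mul] at h4
      exact h4
    · have h3 := heN (τ * τ₀) (by rw [map_mul, AlgEquiv.mul_apply, hsw.1, h2])
      rwa [AlgEquiv.mul_apply] at h3

theorem exists_fixed_sqrt [IsSepClosed Ω] [Algebra.IsIntegral K Ω]
    [IsGalois k (algebraicClosure k Ω)] (h2 : (2 : k) ≠ 0)
    {s : (algebraicClosure k Ω ≃ₐ[k] algebraicClosure k Ω) →* (Ω ≃ₐ[K] Ω)}
    (hs : IsGaloisSection k K Ω s) (p : K) :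
    ∃ c : k, c ≠ 0 ∧ ∃ y : Ω, y ^ 2 = algebraMap k Ω c * algebraMap K Ω p ∧ ∀ τ, s τ y = y := by
  have h2Ω : (2 : Ω) ≠ 0 := by
    rw [← map_ofNat (algebraMap k Ω) 2]; exact (_root_.map_ne_zero _).2 h2
  have : NeZero ((2 : ℕ) : Ω) := ⟨by simpa using h2Ω⟩
  obtain ⟨z, hz⟩ := IsSepClosed.exists_pow_nat_eq (algebraMap K Ω p) 2
  rcases exists_conjugate_pair hs (z := z) (z' := -z) (fun σ => by
    have : (σ z - z) * (σ z + z) = 0 := by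
      have := congrArg σ hz
      rw [map_pow, AlgEquiv.commutes] at this
      linear_combination this - hz
    rcases mul_eq_zero.1 this with h | h
    · left; rw [map_neg, sub_eq_zero.1 h]; simp
    · right; rw [map_neg, eq_neg_of_add_eq_zero_left h]; simp) with h | ⟨e, e', hne, he⟩
  · exact ⟨1, one_ne_zero, z, by rw [hz, map_one, one_mul], h⟩
  · obtain ⟨c, hc⟩ := mem_range_of_forall_fixed ((e - e') ^ 2) (fun τ => by
      rcases he τ with ⟨-, h3, h4⟩ | ⟨-, h3, h4⟩
      · rw [map_pow, map_sub, h3, h4]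
      · rw [map_pow, map_sub, h3, h4]; ring)
    have hcΩ : algebraMap k Ω c = ((e : Ω) - e') ^ 2 := by
      have := congrArg (fun x : algebraicClosure k Ω => (x : Ω)) hc
      exact this
    refine ⟨c, ?_, (e - e') * z, ?_, fun τ => ?_⟩
    · rintro rfl
      rw [map_zero] at hc
      exact (pow_ne_zero 2 (sub_ne_zero.2 hne)) hc.symm
    · rw [mul_pow, hz, hcΩ]
    · rw [map_mul, map_sub, hs.apply_coe, hs.apply_coe]
      rcases he τ with ⟨h5, h3, h4⟩ | ⟨h5, h3, h4⟩
      · rw [h5, h3, h4]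
      · rw [h5, h3, h4]; ring

theorem exists_fixed_artinSchreier [IsSepClosed Ω] [Algebra.IsIntegral K Ω]
    [IsGalois k (algebraicClosure k Ω)] (h2 : (2 : k) = 0)
    {s : (algebraicClosure k Ω ≃ₐ[k] algebraicClosure k Ω) →* (Ω ≃ₐ[K] Ω)}
    (hs : IsGaloisSection k K Ω s) (p : K) :
    ∃ c : k, ∃ y : Ω, y ^ 2 + y = algebraMap K Ω p + algebraMap k Ω c ∧ ∀ τ, s τ y = y := by
  have h2Ω : (2 : Ω) = 0 := by
    rw [← map_ofNat (algebraMap k Ω) 2, h2, map_zero]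
  obtain ⟨z, hz⟩ := IsSepClosed.exists_root_C_mul_X_pow_add_C_mul_X_add_C (n := 2) (1 : Ω) 1
    (- algebraMap K Ω p) (by simpa using h2Ω) le_rfl one_ne_zero
  have hz : z ^ 2 + z = algebraMap K Ω p := by linear_combination hz
  rcases exists_conjugate_pair hs (z := z) (z' := z + 1) (fun σ => by
    have : (σ z - z) * (σ z - (z + 1)) = 0 := by
      have := congrArg σ hz
      rw [map_add, map_pow, AlgEquiv.commutes] at this
      linear_combination this - hz + (z ^ 2 - σ z * z + z - σ z) * h2Ω
    rcases mul_eq_zero.1 this with h | h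
    · left; rw [map_add, map_one, sub_eq_zero.1 h]; simp
    · right; rw [map_add, map_one, sub_eq_zero.1 h]
      exact ⟨rfl, by linear_combination h2Ω⟩) with h | ⟨e, e', hne, he⟩
  · exact ⟨0, z, by rw [hz, map_zero, add_zero], h⟩
  · have h2k : (2 : algebraicClosure k Ω) = 0 := Subtype.ext h2Ω
    have hsum : e + e' ≠ 0 := fun h => hne (by linear_combination h - e' * h2k)
    set β := e / (e + e') with hβ
    have hββ : e' / (e + e') = β + 1 := by
      rw [hβ]; field_simp; linear_combination -e * h2k
    have hτ (τ) : (s τ z = z ∧ τ β = β) ∨ (s τ z = z + 1 ∧ τ β = β + 1) := by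
      rcases he τ with ⟨h5, h3, h4⟩ | ⟨h5, h3, h4⟩
      · left; exact ⟨h5, by rw [hβ, map_div₀, map_add, h3, h4]⟩
      · right; exact ⟨h5, by rw [← hββ, hβ, map_div₀, map_add, h3, h4, add_comm]⟩
    obtain ⟨c, hc⟩ := mem_range_of_forall_fixed (β ^ 2 + β) (fun τ => by
      rcases hτ τ with ⟨-, h3⟩ | ⟨-, h3⟩
      · rw [map_add, map_pow, h3]
      · rw [map_add, map_pow, h3]; linear_combination (β + 1) * h2k)
    have hcΩ : algebraMap k Ω c = (β : Ω) ^ 2 + β := by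
      have := congrArg (fun x : algebraicClosure k Ω => (x : Ω)) hc
      exact this
    refine ⟨c, z + β, ?_, fun τ => ?_⟩
    · rw [hcΩ, ← hz]; linear_combination z * β * h2Ω
    · rw [map_add, hs.apply_coe]
      rcases hτ τ with ⟨h5, h3⟩ | ⟨h5, h3⟩
      · rw [h5, h3]
      · rw [h5, h3]
        simp only [IntermediateField.coe_add, IntermediateField.coe_one]
        linear_combination h2Ω

end Sections

end BirationalSection

namespace BirationalSection

open Polynomial

section Transfer

open scoped Pointwise

variable {k K Ω : Type u} [Field k] [Field K] [Field Ω] [Algebra k K] [Algebra K Ω] [Algebra k Ω]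
  [IsScalarTower k K Ω]

theorem range_le_decompositionSubgroup_iff {G : Type*} [Group G] (φ : G →* (Ω ≃ₐ[K] Ω))
    (W : ValuationSubring Ω) :
    φ.range ≤ W.decompositionSubgroup K ↔ ∀ g, ∀ x ∈ W, φ g x ∈ W := by
  constructor
  · rintro h g x hx
    have hg : φ g • W = W := h ⟨g, rfl⟩
    rw [← hg]
    exact ValuationSubring.smul_mem_pointwise_smul (φ g) x W hx
  · rintro h _ ⟨g, rfl⟩
    change φ g • W = W
    ext x
    rw [ValuationSubring.mem_pointwise_smul_iff_inv_smul_mem, ← map_inv]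
    refine ⟨fun hx => ?_, fun hx => h g⁻¹ x hx⟩
    have := h g _ hx
    rwa [AlgEquiv.smul_def, ← AlgEquiv.mul_apply, ← map_mul, mul_inv_cancel, map_one] at this

theorem exists_decompositionGroup_iff {G : Type*} [Group G] (φ : G →* (Ω ≃ₐ[K] Ω))
    (O : Subring K) :
    (∃ D ∈ decompositionGroups Ω O, φ.range ≤ D) ↔ ∃ W : ValuationSubring Ω,
      W.toSubring.comap (algebraMap K Ω) = O ∧ ∀ g, ∀ x ∈ W, φ g x ∈ W := by
  constructor
  · rintro ⟨_, ⟨W, hW, rfl⟩, h⟩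
    exact ⟨W, hW, (range_le_decompositionSubgroup_iff φ W).1 h⟩
  · rintro ⟨W, hW, h⟩
    exact ⟨_, ⟨W, hW, rfl⟩, (range_le_decompositionSubgroup_iff φ W).2 h⟩

variable {M : Type u} [Field M] [Algebra k M] [Algebra K M] [Algebra M Ω] [IsScalarTower K M Ω]
  [IsScalarTower k M Ω]

/-- A section whose image fixes a field `M`, as a section for `M`. -/
def liftSection (s : (algebraicClosure k Ω ≃ₐ[k] algebraicClosure k Ω) →* (Ω ≃ₐ[K] Ω))
    (h : ∀ τ (m : M), s τ (algebraMap M Ω m) = algebraMap M Ω m) :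
    (algebraicClosure k Ω ≃ₐ[k] algebraicClosure k Ω) →* (Ω ≃ₐ[M] Ω) where
  toFun τ := AlgEquiv.ofRingEquiv (f := (s τ).toRingEquiv) (h τ)
  map_one' := by ext x; simp
  map_mul' _ _ := by ext x; simp

theorem isGaloisSection_liftSection [Algebra.IsIntegral K Ω]
    {s : (algebraicClosure k Ω ≃ₐ[k] algebraicClosure k Ω) →* (Ω ≃ₐ[K] Ω)}
    (hs : IsGaloisSection k K Ω s)
    (h : ∀ τ (m : M), s τ (algebraMap M Ω m) = algebraMap M Ω m) :
    IsGaloisSection k M Ω (liftSection s h) := by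
  have : Algebra.IsIntegral M Ω := Algebra.IsIntegral.tower_top K
  constructor
  · rw [continuous_galois_iff]
    exact (continuous_galois_iff s).1 hs.1
  · ext τ x
    exact hs.apply_coe τ x

theorem exists_sub_mem_nonunits [IsGalois k (algebraicClosure k Ω)]
    {s : (algebraicClosure k Ω ≃ₐ[k] algebraicClosure k Ω) →* (Ω ≃ₐ[K] Ω)}
    (hs : IsGaloisSection k K Ω s) {W : ValuationSubring Ω}
    (hkW : ∀ c : k, algebraMap k Ω c ∈ W) (hW : ∀ τ, ∀ x ∈ W, s τ x ∈ W)
    {y β₁ β₂ : Ω} (hy : ∀ τ, s τ y = y) (h₁ : IsAlgebraic k β₁) (h₂ : IsAlgebraic k β₂)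
    (hyβ : (y - β₁) * (y - β₂) ∈ W.nonunits) :
    ∃ c : k, y - algebraMap k Ω c ∈ W.nonunits := by
  have hint {x : Ω} (hx : IsAlgebraic k x) : x ∈ W := by
    obtain ⟨f, hf, hf0⟩ := isAlgebraic_iff_isIntegral.1 hx
    let φ : k →+* W := (algebraMap k Ω).codRestrict W.toSubring hkW
    have : IsIntegral W x := by
      refine ⟨f.map φ, hf.map _, ?_⟩
      rw [eval₂_map]
      exact hf0
    obtain ⟨w, rfl⟩ := (IsIntegrallyClosed.isIntegral_iff (R := W) (K := Ω)).1 this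
    exact w.2
  have key : ∀ β : Ω, IsAlgebraic k β → y - β ∈ W.nonunits →
      ∃ c : k, y - algebraMap k Ω c ∈ W.nonunits := by
    intro β hβ hyβ
    let b : algebraicClosure k Ω := ⟨β, mem_algebraicClosure_iff.2 hβ⟩
    obtain ⟨c, hc⟩ := mem_range_of_forall_fixed b (fun τ => by
      have h1 : y - s τ β ∈ W.nonunits := by
        have hτ : s τ (y - β) = y - s τ β := by rw [map_sub, hy]
        rw [← hτ, ValuationSubring.mem_nonunits_iff_or]
        rw [ValuationSubring.mem_nonunits_iff_or] at hyβ
        rcases hyβ with h | h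
        · left; rw [h, map_zero]
        · right
          intro h'
          apply h
          have := hW τ⁻¹ _ h'
          rwa [← map_inv₀ (s τ), ← AlgEquiv.mul_apply, ← map_mul, inv_mul_cancel, map_one] at this
      have h2 : β - s τ β ∈ W.nonunits := by
        have := sub_mem h1 hyβ
        rwa [sub_sub_sub_cancel_left] at this
      have h3 : s τ β = (τ b : algebraicClosure k Ω) := hs.apply_coe τ b
      rw [h3] at h2
      by_contra hne
      have hne' : β - (τ b : algebraicClosure k Ω) ≠ 0 := fun h0 =>
        hne (Subtype.ext (sub_eq_zero.1 h0).symm)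
      have h4 : IsAlgebraic k (β - (τ b : algebraicClosure k Ω))⁻¹ :=
        (hβ.sub (mem_algebraicClosure_iff.1 (τ b).2)).inv
      rcases W.mem_nonunits_iff_or.1 h2 with h | h
      · exact hne' h
      · exact h (hint h4))
    refine ⟨c, ?_⟩
    have : algebraMap k Ω c = β := congrArg (fun x : algebraicClosure k Ω => (x : Ω)) hc
    rwa [this]
  rw [ValuationSubring.mem_nonunits_iff, map_mul] at hyβ
  by_cases h : W.valuation (y - β₁) < 1
  · exact key β₁ h₁ h
  · refine key β₂ h₂ ?_
    rw [ValuationSubring.mem_nonunits_iff]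
    by_contra h'
    rw [not_lt] at h h'
    exact absurd hyβ (not_lt.2 (one_le_mul h h'))

end Transfer

end BirationalSection

namespace BirationalSection

section LocalRing

variable {X : Scheme.{u}} [AlgebraicGeometry.IsIntegral X] {U : X.Opens} [Nonempty U]

theorem mem_localRing_fromSpec_iff (hU : IsAffineOpen U) (p : PrimeSpectrum Γ(X, U))
    (z : X.functionField) :
    z ∈ localRing (hU.fromSpec p) ↔
      ∃ a b : Γ(X, U), b ∉ p.asIdeal ∧ z * X.germToFunctionField U b = X.germToFunctionField U a := by
  have hp : hU.fromSpec p ∈ U := by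
    have := Set.mem_range_self (f := hU.fromSpec) p
    rwa [hU.range_fromSpec] at this
  let _ := TopCat.Presheaf.algebra_section_stalk X.presheaf ⟨hU.fromSpec p, hp⟩
  have hloc : IsLocalization.AtPrime (X.presheaf.stalk (hU.fromSpec p)) p.asIdeal :=
    hU.isLocalization_stalk' p hp
  have htower := functionField_isScalarTower X U ⟨hU.fromSpec p, hp⟩
  have hmap (a : Γ(X, U)) : algebraMap (X.presheaf.stalk (hU.fromSpec p)) X.functionField
      (algebraMap Γ(X, U) (X.presheaf.stalk (hU.fromSpec p)) a) = X.germToFunctionField U a :=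
    (htower.algebraMap_apply _ _ _ a).symm
  constructor
  · rintro ⟨w, rfl⟩
    obtain ⟨⟨a, b⟩, h⟩ := IsLocalization.surj p.asIdeal.primeCompl w
    refine ⟨a, b, b.2, ?_⟩
    rw [← hmap, ← hmap, ← map_mul, h]
  · rintro ⟨a, b, hb, h⟩
    obtain ⟨v, hv⟩ := isUnit_iff_exists_inv.1
      (IsLocalization.map_units (X.presheaf.stalk (hU.fromSpec p)) (⟨b, hb⟩ : p.asIdeal.primeCompl))
    refine ⟨algebraMap _ _ a * v, ?_⟩
    rw [map_mul, hmap, ← h, mul_assoc, ← hmap, ← map_mul, hv, map_one, mul_one]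

omit [AlgebraicGeometry.IsIntegral X] [Nonempty U] in
theorem exists_fromSpec_eq (hU : IsAffineOpen U) {x : X} (hx : x ∈ U) :
    ∃ p, hU.fromSpec p = x :=
  ⟨hU.primeIdealOf ⟨x, hx⟩, hU.fromSpec_primeIdealOf _⟩

omit [AlgebraicGeometry.IsIntegral X] [Nonempty U] in
theorem fromSpec_mem (hU : IsAffineOpen U) (p : PrimeSpectrum Γ(X, U)) : hU.fromSpec p ∈ U := by
  have := Set.mem_range_self (f := hU.fromSpec) p
  rwa [hU.range_fromSpec] at this

theorem germ_mem_localRing {x : X} (hx : x ∈ U) (a : Γ(X, U)) :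
    X.germToFunctionField U a ∈ localRing x :=
  ⟨X.presheaf.germ U x hx a, Scheme.algebraMap_germ_eq_germToFunctionField X hx a⟩

theorem exists_germ_eq_of_forall_mem_localRing (hU : IsAffineOpen U) (z : X.functionField)
    (h : ∀ x ∈ U, z ∈ localRing x) : ∃ a, X.germToFunctionField U a = z := by
  let I : Ideal Γ(X, U) :=
    { carrier := {b | ∃ a, z * X.germToFunctionField U b = X.germToFunctionField U a}
      add_mem' := by
        rintro b b' ⟨a, ha⟩ ⟨a', ha'⟩
        exact ⟨a + a', by rw [map_add, mul_add, ha, ha', map_add]⟩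
      zero_mem' := ⟨0, by simp⟩
      smul_mem' := by
        rintro c b ⟨a, ha⟩
        exact ⟨c * a, by rw [smul_eq_mul, map_mul, mul_left_comm, ha, map_mul]⟩ }
  have hI : I = ⊤ := by
    by_contra hI
    obtain ⟨m, hm, hIm⟩ := Ideal.exists_le_maximal I hI
    obtain ⟨a, b, hb, hab⟩ := (mem_localRing_fromSpec_iff hU ⟨m, hm.isPrime⟩ z).1
      (h _ (fromSpec_mem hU _))
    exact hb (hIm ⟨a, hab⟩)
  obtain ⟨a, ha⟩ := (Ideal.eq_top_iff_one I).1 hI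
  exact ⟨a, by rw [← ha, map_one, mul_one]⟩

end LocalRing

section RationalPoint

variable {k : Type u} [Field k] {X : Scheme.{u}} (f : X ⟶ Spec (.of k))

/-- The `k`-algebra structure on the sections over an open subset of a `k`-scheme. -/
noncomputable def sectionsHom (U : X.Opens) : k →+* Γ(X, U) :=
  ((Scheme.ΓSpecIso (.of k)).inv ≫ f.appLE ⊤ U (by simp)).hom

theorem fromSpec_comp_eq {U : X.Opens} (hU : IsAffineOpen U) :
    hU.fromSpec ≫ f = Spec.map (CommRingCat.ofHom (sectionsHom f U)) := by
  rw [← IsAffineOpen.SpecMap_appLE_fromSpec f (isAffineOpen_top _) hU (by simp),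
    IsAffineOpen.fromSpec_top, Scheme.isoSpec_Spec_inv, ← Spec.map_comp]
  rfl

variable [AlgebraicGeometry.IsIntegral X] {U : X.Opens} [Nonempty U]

theorem germ_sectionsHom (c : k) :
    X.germToFunctionField U (sectionsHom f U c) = constantsHom f c := by
  exact X.presheaf.germ_res_apply (homOfLE le_top) (genericPoint X) _
    (f.appTop ((Scheme.ΓSpecIso (.of k)).inv c))

variable {f}

omit [AlgebraicGeometry.IsIntegral X] [Nonempty U] in
theorem exists_evaluation (hU : IsAffineOpen U) (x : RationalPoint f) (hx : x.point ∈ U) :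
    ∃ ε : Γ(X, U) →+* k, (∀ c, ε (sectionsHom f U c) = c) ∧
      x.1 = Spec.map (CommRingCat.ofHom ε) ≫ hU.fromSpec := by
  have hle : Set.range x.1 ⊆ Set.range hU.fromSpec := by
    rw [hU.range_fromSpec]
    rintro _ ⟨p, rfl⟩
    rwa [show p = IsLocalRing.closedPoint k from Subsingleton.elim (α := PrimeSpectrum k) _ _]
  obtain ⟨ε, hε⟩ := Spec.map_surjective (IsOpenImmersion.lift hU.fromSpec x.1 hle)
  have h1 : x.1 = Spec.map ε ≫ hU.fromSpec := by rw [hε, IsOpenImmersion.lift_fac]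
  refine ⟨ε.hom, fun c => ?_, h1⟩
  have h2 := x.2
  rw [h1, Category.assoc, fromSpec_comp_eq, ← Spec.map_comp, ← Spec.map_id] at h2
  exact congr($(Spec.map_injective h2) c)

omit [AlgebraicGeometry.IsIntegral X] [Nonempty U] in
theorem point_eq_fromSpec (hU : IsAffineOpen U) {x : RationalPoint f} {ε : Γ(X, U) →+* k}
    (hx : x.1 = Spec.map (CommRingCat.ofHom ε) ≫ hU.fromSpec) :
    x.point = hU.fromSpec (PrimeSpectrum.comap ε (⊥ : PrimeSpectrum k)) := by
  rw [RationalPoint.point, hx, show IsLocalRing.closedPoint k = ⊥ from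
    Subsingleton.elim (α := PrimeSpectrum k) _ _]
  rfl

theorem mem_localRing_point_iff (hU : IsAffineOpen U) {x : RationalPoint f} {ε : Γ(X, U) →+* k}
    (hx : x.1 = Spec.map (CommRingCat.ofHom ε) ≫ hU.fromSpec) (z : X.functionField) :
    z ∈ localRing x.point ↔
      ∃ a b : Γ(X, U), ε b ≠ 0 ∧ z * X.germToFunctionField U b = X.germToFunctionField U a := by
  rw [point_eq_fromSpec hU hx, mem_localRing_fromSpec_iff hU]
  rfl

omit [AlgebraicGeometry.IsIntegral X] [Nonempty U] in
theorem exists_rationalPoint_of_evaluation (hU : IsAffineOpen U) (ε : Γ(X, U) →+* k)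
    (hε : ∀ c, ε (sectionsHom f U c) = c) :
    ∃ x : RationalPoint f, x.1 = Spec.map (CommRingCat.ofHom ε) ≫ hU.fromSpec := by
  refine ⟨⟨Spec.map (CommRingCat.ofHom ε) ≫ hU.fromSpec, ?_⟩, rfl⟩
  rw [Category.assoc, fromSpec_comp_eq, ← Spec.map_comp, ← Spec.map_id]
  congr 1
  ext c
  exact hε c

omit [AlgebraicGeometry.IsIntegral X] [Nonempty U] in
theorem point_mem_of_eq (hU : IsAffineOpen U) {x : RationalPoint f} {ε : Γ(X, U) →+* k}
    (hx : x.1 = Spec.map (CommRingCat.ofHom ε) ≫ hU.fromSpec) : x.point ∈ U := by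
  rw [point_eq_fromSpec hU hx]
  exact fromSpec_mem hU _

/-- A valuation ring of the function field that contains the sections over an affine open subset and
has the base field as its residue field there is the local ring of a rational point. -/
theorem exists_rationalPoint_of_valuationSubring (hU : IsAffineOpen U)
    (hval : ∀ x ∈ U, ∀ z : X.functionField, z ∈ localRing x ∨ z⁻¹ ∈ localRing x)
    (V : ValuationSubring X.functionField)
    (hV : ∀ a : Γ(X, U), ∃ c : k, X.germToFunctionField U a - constantsHom f c ∈ V.nonunits)
    (hk : ∀ c : k, constantsHom f c ∈ V) :
    ∃ x : RationalPoint f, localRing x.point = V.toSubring := by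
  have hzero (c : k) (hc : constantsHom f c ∈ V.nonunits) : c = 0 := by
    by_contra h0
    rw [ValuationSubring.mem_nonunits_iff_exists_mem_maximalIdeal] at hc
    obtain ⟨hc1, hc2⟩ := hc
    refine (IsLocalRing.mem_maximalIdeal _).1 hc2 (isUnit_iff_exists_inv.2 ⟨⟨_, hk c⁻¹⟩, ?_⟩)
    ext
    simp [h0]
  have hsub {a b : X.functionField} (ha : a ∈ V.nonunits) (hb : b ∈ V.nonunits) :
      a - b ∈ V.nonunits := by
    rw [ValuationSubring.mem_nonunits_iff_exists_mem_maximalIdeal] at *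
    obtain ⟨ha1, ha2⟩ := ha
    obtain ⟨hb1, hb2⟩ := hb
    exact ⟨V.toSubring.sub_mem ha1 hb1, Ideal.sub_mem _ ha2 hb2⟩
  have hadd {a b : X.functionField} (ha : a ∈ V.nonunits) (hb : b ∈ V.nonunits) :
      a + b ∈ V.nonunits := by
    rw [ValuationSubring.mem_nonunits_iff_exists_mem_maximalIdeal] at *
    obtain ⟨ha1, ha2⟩ := ha
    obtain ⟨hb1, hb2⟩ := hb
    exact ⟨V.add_mem _ _ ha1 hb1, Ideal.add_mem _ ha2 hb2⟩
  have hmul {a b : X.functionField} (ha : a ∈ V) (hb : b ∈ V.nonunits) :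
      a * b ∈ V.nonunits := by
    rw [ValuationSubring.mem_nonunits_iff_exists_mem_maximalIdeal] at *
    obtain ⟨hb1, hb2⟩ := hb
    exact ⟨V.mul_mem _ _ ha hb1, Ideal.mul_mem_left _ ⟨a, ha⟩ hb2⟩
  have huniq {z : X.functionField} {c d : k} (hc : z - constantsHom f c ∈ V.nonunits)
      (hd : z - constantsHom f d ∈ V.nonunits) : c = d := by
    have := hsub hd hc
    rw [sub_sub_sub_cancel_left, ← map_sub] at this
    exact sub_eq_zero.1 (hzero _ this)
  choose e he using hV
  have hmem (a : Γ(X, U)) : X.germToFunctionField U a ∈ V := by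
    have := V.add_mem _ _ (V.nonunits_subset (he a)) (hk (e a))
    rwa [sub_add_cancel] at this
  have h0 : (0 : X.functionField) ∈ V.nonunits := by
    rw [ValuationSubring.mem_nonunits_iff_exists_mem_maximalIdeal]
    exact ⟨V.zero_mem, Ideal.zero_mem _⟩
  have hconst (c : k) : e (sectionsHom f U c) = c := by
    refine huniq (he _) ?_
    rw [germ_sectionsHom, sub_self]
    exact h0
  let ε : Γ(X, U) →+* k :=
    { toFun := e
      map_one' := by have := hconst 1; rwa [map_one] at this
      map_zero' := by have := hconst 0; rwa [map_zero] at this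
      map_add' := fun a b => by
        refine huniq (he _) ?_
        have := hadd (he a) (he b)
        convert this using 1
        simp only [map_add]
        ring
      map_mul' := fun a b => by
        refine huniq (he _) ?_
        have := hadd (hmul (hmem b) (he a)) (hmul (hk (e a)) (he b))
        convert this using 1
        simp only [map_mul]
        ring }
  obtain ⟨x, hx⟩ := exists_rationalPoint_of_evaluation hU ε hconst
  have hunit (b : Γ(X, U)) (hb : ε b ≠ 0) : (X.germToFunctionField U b)⁻¹ ∈ V := by
    rcases V.mem_or_inv_mem (X.germToFunctionField U b)⁻¹ with h | h
    · exact h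
    · by_contra h'
      refine hb (huniq (d := 0) (he b) ?_)
      rw [map_zero, sub_zero, ValuationSubring.mem_nonunits_iff_or]
      exact Or.inr h'
  refine ⟨x, le_antisymm ?_ ?_⟩
  · intro z hz
    obtain ⟨a, b, hb, hab⟩ := (mem_localRing_point_iff hU hx z).1 hz
    have hb0 : X.germToFunctionField U b ≠ 0 := by
      intro h
      refine hb (huniq (d := 0) (he b) ?_)
      rw [h, map_zero, sub_zero]
      exact h0
    rw [eq_div_of_mul_eq hb0 hab, div_eq_mul_inv]
    exact V.mul_mem _ _ (hmem a) (hunit b hb)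
  · intro z hz
    rcases hval x.point (point_mem_of_eq hU hx) z with h | h
    · exact h
    · by_cases hz0 : z = 0
      · rw [hz0]; exact Subring.zero_mem _
      obtain ⟨a, b, hb, hab⟩ := (mem_localRing_point_iff hU hx _).1 h
      have hb0 : X.germToFunctionField U b ≠ 0 := by
        intro h
        refine hb (huniq (d := 0) (he b) ?_)
        rw [h, map_zero, sub_zero]
        exact h0
      refine (mem_localRing_point_iff hU hx _).2 ⟨b, a, fun ha => ?_, ?_⟩
      · have ha' := he a
        rw [show e a = 0 from ha, map_zero, sub_zero] at ha'
        have h2 := hmul (V.mul_mem _ _ hz (hunit b hb)) ha'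
        rw [← hab] at h2
        have h3 : z * (X.germToFunctionField U b)⁻¹ * (z⁻¹ * X.germToFunctionField U b) = 1 := by
          field_simp
        rw [h3] at h2
        have h4 := hzero 1 (by rwa [map_one])
        exact one_ne_zero h4
      · rw [← hab, mul_inv_cancel_left₀ hz0]

theorem exists_sub_constantsHom (x : RationalPoint f) {z : X.functionField}
    (hz : z ∈ localRing x.point) :
    ∃ c : k, z - constantsHom f c = 0 ∨ (z - constantsHom f c)⁻¹ ∉ localRing x.point := by
  obtain ⟨_, ⟨U, hU, rfl⟩, hxU, -⟩ :=
    X.isBasis_affineOpens.exists_subset_of_mem_open (Set.mem_univ x.point) isOpen_univ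
  have : Nonempty U := ⟨⟨_, hxU⟩⟩
  obtain ⟨ε, hε, hx⟩ := exists_evaluation hU x hxU
  obtain ⟨a, b, hb, hab⟩ := (mem_localRing_point_iff hU hx z).1 hz
  refine ⟨ε a / ε b, or_iff_not_imp_left.2 fun h0 h => ?_⟩
  obtain ⟨a', b', hb', hab'⟩ := (mem_localRing_point_iff hU hx _).1 h
  have h1 : X.germToFunctionField U (b * b') = X.germToFunctionField U
      ((a - sectionsHom f U (ε a / ε b) * b) * a') := by
    simp only [map_mul, map_sub, germ_sectionsHom, ← hab, ← hab']
    field_simp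
  have h2 := congr(ε $(X.germToFunctionField_injective U h1))
  simp only [map_mul, map_sub, hε, div_mul_cancel₀ _ hb, sub_self, zero_mul] at h2
  exact mul_ne_zero hb hb' h2

theorem constantsHom_mem_localRing (c : k) (x : X) : constantsHom f c ∈ localRing x := by
  have : Nonempty (⊤ : X.Opens) := ⟨⟨x, trivial⟩⟩
  rw [← germ_sectionsHom f (U := ⊤)]
  exact germ_mem_localRing (U := ⊤) (x := x) trivial _

theorem point_eq_of_localRing_eq [IsSeparated f] {x y : X} (h : localRing x = localRing y) :
    x = y := by
  let O : Subring X.functionField := localRing x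
  have lift (z : X) (hz : localRing z = O) : ∃ φ : CommRingCat.of O ≅ X.presheaf.stalk z,
      φ.inv ≫ CommRingCat.ofHom O.subtype =
        CommRingCat.ofHom (algebraMap (X.presheaf.stalk z) X.functionField) := by
    let e : X.presheaf.stalk z ≃+* O := (RingEquiv.ofBijective
      (algebraMap (X.presheaf.stalk z) X.functionField).rangeRestrict
      ⟨fun a b hab => IsFractionRing.injective (X.presheaf.stalk z) X.functionField
        (Subtype.ext_iff.1 hab), RingHom.rangeRestrict_surjective _⟩).trans (RingEquiv.subringCongr hz)
    exact ⟨e.symm.toCommRingCatIso, rfl⟩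
  obtain ⟨φ, hφ⟩ := lift x rfl
  obtain ⟨ψ, hψ⟩ := lift y h.symm
  obtain ⟨ι, hιdef⟩ : ∃ ι : Spec X.functionField ⟶ Spec (.of O),
    ι = Spec.map (CommRingCat.ofHom O.subtype) := ⟨_, rfl⟩
  have hgen (z : X) : Spec.map (CommRingCat.ofHom
      (algebraMap (X.presheaf.stalk z) X.functionField)) ≫ X.fromSpecStalk z =
      X.fromSpecStalk (genericPoint X) :=
    Scheme.SpecMap_stalkSpecializes_fromSpecStalk ((genericPoint_spec X).specializes trivial)
  have hι : ι ≫ Spec.map φ.inv ≫ X.fromSpecStalk x = ι ≫ Spec.map ψ.inv ≫ X.fromSpecStalk y := by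
    rw [hιdef, ← Category.assoc, ← Category.assoc, ← Spec.map_comp, ← Spec.map_comp, hφ, hψ, hgen, hgen]
  have hdom : IsDominant ι := by
    rw [hιdef]
    refine ⟨(PrimeSpectrum.denseRange_comap_iff_ker_le_nilRadical _).2 ?_⟩
    rw [(RingHom.injective_iff_ker_eq_bot _).1 (Subtype.val_injective : Function.Injective O.subtype)]
    exact bot_le
  have hk (α β : Spec (.of O) ⟶ Spec (.of k)) (hαβ : ι ≫ α = ι ≫ β) : α = β := by
    obtain ⟨α, rfl⟩ := Spec.map_surjective α
    obtain ⟨β, rfl⟩ := Spec.map_surjective β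
    rw [hιdef, ← Spec.map_comp, ← Spec.map_comp] at hαβ
    congr 1
    ext c
    have := congr($(Spec.map_injective hαβ) c)
    exact this
  have heq : Spec.map φ.inv ≫ X.fromSpecStalk x = Spec.map ψ.inv ≫ X.fromSpecStalk y := by
    refine ext_of_isDominant_of_isSeparated f (hk _ _ ?_) ι hι
    rw [← Category.assoc, hι, Category.assoc]
  have hspec {z w : X} (φ : CommRingCat.of O ≅ X.presheaf.stalk z)
      (ψ : CommRingCat.of O ≅ X.presheaf.stalk w)
      (heq : Spec.map φ.inv ≫ X.fromSpecStalk z = Spec.map ψ.inv ≫ X.fromSpecStalk w) :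
      z ⤳ w := by
    have h1 : X.fromSpecStalk z = (Spec.map φ.hom ≫ Spec.map ψ.inv) ≫ X.fromSpecStalk w := by
      rw [Category.assoc, ← heq, ← Spec.map_comp_assoc, Iso.inv_hom_id, Spec.map_id,
        Category.id_comp]
    have h2 : z ∈ Set.range (X.fromSpecStalk w) := by
      refine ⟨(Spec.map φ.hom ≫ Spec.map ψ.inv) (IsLocalRing.closedPoint (X.presheaf.stalk z)), ?_⟩
      exact congr($h1.symm (IsLocalRing.closedPoint (X.presheaf.stalk z))).trans
        Scheme.fromSpecStalk_closedPoint
    rwa [Scheme.range_fromSpecStalk] at h2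
  exact (hspec φ ψ heq).antisymm (hspec ψ φ heq.symm) |>.eq

theorem rationalPoint_ext [IsSeparated f] {x y : RationalPoint f}
    (h : localRing x.point = localRing y.point) : x = y := by
  have hpt : x.point = y.point := point_eq_of_localRing_eq (f := f) h
  obtain ⟨_, ⟨U, hU, rfl⟩, hxU, -⟩ :=
    X.isBasis_affineOpens.exists_subset_of_mem_open (Set.mem_univ x.point) isOpen_univ
  have : Nonempty U := ⟨⟨_, hxU⟩⟩
  obtain ⟨ε, hε, hx⟩ := exists_evaluation hU x hxU
  obtain ⟨ε', hε', hy⟩ := exists_evaluation hU y (hpt ▸ hxU)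
  have hker (a : Γ(X, U)) (ha : ε a ≠ 0) : ε' a ≠ 0 := by
    have ha0 : X.germToFunctionField U a ≠ 0 := by
      rw [Ne, map_eq_zero_iff _ (X.germToFunctionField_injective U)]
      rintro rfl
      exact ha (map_zero _)
    have h1 : (X.germToFunctionField U a)⁻¹ ∈ localRing x.point :=
      (mem_localRing_point_iff hU hx _).2 ⟨1, a, ha, by rw [inv_mul_cancel₀ ha0, map_one]⟩
    rw [h] at h1
    obtain ⟨a', b', hb', hab⟩ := (mem_localRing_point_iff hU hy _).1 h1
    have h2 : b' = a * a' := by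
      apply X.germToFunctionField_injective U
      rw [map_mul, ← hab, mul_inv_cancel_left₀ ha0]
    rw [h2, map_mul] at hb'
    exact left_ne_zero_of_mul hb'
  have : ε = ε' := by
    ext a
    by_contra hne
    have := hker (sectionsHom f U (ε' a) - a) (by
      rw [map_sub, hε]
      exact sub_ne_zero.2 (Ne.symm hne))
    rw [map_sub, hε', sub_self] at this
    exact this rfl
  refine Subtype.ext ?_
  rw [hx, hy, this]

end RationalPoint

end BirationalSection

namespace BirationalSection

theorem _root_.MvPolynomial.IsHomogeneous.aeval_mul {σ R S : Type*} [CommSemiring R] [CommSemiring S]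
    [Algebra R S] {x : MvPolynomial σ R} {n : ℕ} (hx : x.IsHomogeneous n) (c : S) (g : σ → S) :
    MvPolynomial.aeval (fun l => c * g l) x = c ^ n * MvPolynomial.aeval g x := by
  rw [MvPolynomial.aeval_def, MvPolynomial.aeval_def, MvPolynomial.eval₂_eq, MvPolynomial.eval₂_eq,
    Finset.mul_sum]
  refine Finset.sum_congr rfl fun d hd => ?_
  have : ∑ l ∈ d.support, d l = n := by
    have := hx (MvPolynomial.mem_support_iff.1 hd)
    rwa [show (1 : σ → ℕ) = fun _ => 1 from rfl, ← Finsupp.degree_eq_weight_one,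
      Finsupp.degree_apply] at this
  simp only [mul_pow, Finset.prod_mul_distrib, Finset.prod_pow_eq_pow_sum, this]
  ring

section ProjectiveLine

attribute [local instance] MvPolynomial.gradedAlgebra

open MvPolynomial HomogeneousLocalization

variable {k : Type u} [Field k]

theorem X_mem_homogeneousSubmodule {σ R : Type*} [CommSemiring R] (i : σ) :
    (X i : MvPolynomial σ R) ∈ homogeneousSubmodule σ R 1 :=
  isHomogeneous_X R i

/-- The constants in a chart of the projective line. -/
noncomputable def awayConst (i : Fin 2) : k →+* Away (homogeneousSubmodule (Fin 2) k) (X i) :=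
  (fromZeroRingHom (homogeneousSubmodule (Fin 2) k) _).comp
    (algebraMap k (homogeneousSubmodule (Fin 2) k 0))

variable (k) in
/-- The quotient `X j / X i` of the homogeneous coordinates. -/
noncomputable def awayCoord (i j : Fin 2) : Away (homogeneousSubmodule (Fin 2) k) (X i) :=
  Away.mk _ (X_mem_homogeneousSubmodule i) 1 (X j) (by simpa using X_mem_homogeneousSubmodule j)

theorem val_awayConst (i : Fin 2) (c : k) :
    (awayConst i c).val = algebraMap (MvPolynomial (Fin 2) k) _ (C c) := by
  rw [← Localization.mk_one_eq_algebraMap]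
  rfl

theorem val_awayCoord_mul (i j : Fin 2) :
    (awayCoord k i j).val * algebraMap (MvPolynomial (Fin 2) k) _ (X i) =
      algebraMap (MvPolynomial (Fin 2) k) _ (X j) := by
  rw [awayCoord, Away.val_mk, ← Localization.mk_one_eq_algebraMap, ← Localization.mk_one_eq_algebraMap,
    Localization.mk_mul, Localization.mk_eq_mk_iff, Localization.r_iff_exists]
  exact ⟨1, by simp [mul_comm]⟩

theorem exists_eval₂_awayCoord {i j : Fin 2} (hij : i ≠ j)
    (z : Away (homogeneousSubmodule (Fin 2) k) (X i)) :
    ∃ p : Polynomial k, z = p.eval₂ (awayConst i) (awayCoord k i j) := by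
  obtain ⟨n, x, hx, rfl⟩ := Away.mk_surjective _ (X_mem_homogeneousSubmodule i) z
  have hx' : x.IsHomogeneous n := by simpa using hx
  refine ⟨aeval (fun l => if l = i then 1 else Polynomial.X) x, ?_⟩
  apply val_injective
  let Q := Localization.Away (X i : MvPolynomial (Fin 2) k)
  have h1 : ∀ x : MvPolynomial (Fin 2) k,
      (((aeval (fun l => if l = i then 1 else Polynomial.X) x : Polynomial k)).eval₂
        (awayConst i) (awayCoord k i j)).val = aeval (R := k) (S₁ := Q)
        (fun l => if l = i then 1 else (awayCoord k i j).val) x := by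
    intro x
    have : ((algebraMap _ Q).comp (Polynomial.eval₂RingHom (awayConst i) (awayCoord k i j))).comp
        (aeval (fun l => if l = i then 1 else Polynomial.X) :
          MvPolynomial (Fin 2) k →ₐ[k] Polynomial k).toRingHom =
        (aeval (R := k) (S₁ := Q)
          (fun l => if l = i then 1 else (awayCoord k i j).val)).toRingHom := by
      apply MvPolynomial.ringHom_ext
      · intro c
        simp [Polynomial.algebraMap_eq]
        rfl
      · intro l
        by_cases hl : l = i
        · simp [hl]
        · simp [hl]
          rfl
    exact congr($this x)
  rw [h1, Away.val_mk, Localization.mk_eq_mk', IsLocalization.mk'_eq_iff_eq_mul, mul_comm]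
  change _ = algebraMap _ Q (X i ^ n) * _
  rw [map_pow, ← hx'.aeval_mul]
  have h2 : (fun l => algebraMap (MvPolynomial (Fin 2) k) Q (X i) *
      if l = i then 1 else (awayCoord k i j).val) =
      fun l => algebraMap (MvPolynomial (Fin 2) k) Q (X l) := by
    funext l
    split_ifs with hl
    · rw [hl, mul_one]
    · have : l = j := by omega
      rw [this, ← val_awayCoord_mul i j, mul_comm]
  rw [h2]
  have h3 := aeval_algebraMap_apply Q (X : Fin 2 → MvPolynomial (Fin 2) k) x
  rw [aeval_X_left_apply] at h3
  exact h3.symm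

theorem eval₂_awayCoord_injective {i j : Fin 2} (hij : i ≠ j) :
    Function.Injective (Polynomial.eval₂RingHom (awayConst i) (awayCoord k i j)) := by
  let φ : Localization.Away (X i : MvPolynomial (Fin 2) k) →+* Polynomial k :=
    IsLocalization.Away.lift (X i : MvPolynomial (Fin 2) k)
      (g := (aeval (fun l => if l = i then 1 else Polynomial.X) :
        MvPolynomial (Fin 2) k →ₐ[k] Polynomial k).toRingHom) (by simp)
  have hφ (x : MvPolynomial (Fin 2) k) : φ (algebraMap _ _ x) =
      aeval (fun l => if l = i then 1 else Polynomial.X) x :=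
    IsLocalization.Away.lift_eq _ _ _
  let ψ : Away (homogeneousSubmodule (Fin 2) k) (X i) →+* Polynomial k :=
    φ.comp (algebraMap _ (Localization.Away (X i : MvPolynomial (Fin 2) k)))
  have : ψ.comp (Polynomial.eval₂RingHom (awayConst i) (awayCoord k i j)) = RingHom.id _ := by
    apply Polynomial.ringHom_ext
    · intro a
      simp [ψ, val_awayConst, hφ, Polynomial.algebraMap_eq]
    · have h := congr(φ $(val_awayCoord_mul (k := k) i j))
      simpa [hφ, hij.symm, ψ] using h
  exact Function.LeftInverse.injective (g := ψ) fun p => congr($this p)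

open Proj in
theorem awayToSection_awayConst (i : Fin 2) (c : k) :
    awayToSection (homogeneousSubmodule (Fin 2) k) (X i) (awayConst i c) =
      sectionsHom (projectiveLineHom k) (basicOpen (homogeneousSubmodule (Fin 2) k) (X i)) c := by
  have hU := isAffineOpen_basicOpen (homogeneousSubmodule (Fin 2) k) (X i) (X_mem_homogeneousSubmodule i)
    one_pos
  have h1 := fromSpec_comp_eq (projectiveLineHom k) hU
  have h2 := awayι_toSpecZero (homogeneousSubmodule (Fin 2) k) (X i) (X_mem_homogeneousSubmodule i) one_pos
  rw [← basicOpenIsoSpec_inv_ι, Category.assoc, Iso.inv_comp_eq, basicOpenIsoSpec_hom, basicOpenToSpec,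
    ← hU.toSpecΓ_fromSpec, Category.assoc, Category.assoc, ← hU.isoSpec_hom,
    Iso.cancel_iso_hom_left] at h2
  have h3 := congr($h2 ≫ Spec.map (CommRingCat.ofHom
      (algebraMap k (MvPolynomial.homogeneousSubmodule (Fin 2) k 0))))
  rw [Category.assoc] at h3
  have h4 := h1.symm.trans h3
  rw [← Spec.map_comp, ← Spec.map_comp] at h4
  exact congr($(Spec.map_injective h4) c).symm

theorem awayMap_awayCoord_mul_awayMap_awayCoord :
    awayMap (homogeneousSubmodule (Fin 2) k) (X_mem_homogeneousSubmodule 1) rfl (awayCoord k 0 1) *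
      awayMap (homogeneousSubmodule (Fin 2) k) (X_mem_homogeneousSubmodule 0) (mul_comm _ _)
        (awayCoord k 1 0) = 1 := by
  apply val_injective
  have h0 := val_awayCoord_mul (k := k) 0 1
  have h1 := val_awayCoord_mul (k := k) 1 0
  rw [val_mul, val_one, val_awayMap, val_awayMap]
  generalize_proofs _ p q
  have h2 := congr(Localization.awayLift (algebraMap (MvPolynomial (Fin 2) k)
    (Localization.Away (X 0 * X 1 : MvPolynomial (Fin 2) k))) _ p $h0)
  have h3 := congr(Localization.awayLift (algebraMap (MvPolynomial (Fin 2) k)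
    (Localization.Away (X 0 * X 1 : MvPolynomial (Fin 2) k))) _ q $h1)
  rw [map_mul, Localization.awayLift, IsLocalization.Away.lift_eq,
    IsLocalization.Away.lift_eq] at h2 h3
  rw [← (p.mul q).mul_left_inj, one_mul]
  rw [mul_mul_mul_comm, h2, h3]
  exact mul_comm _ _

/-- An affine open subset of an integral scheme with a given ring of sections. -/
structure IsAffineWithSections {X : Scheme.{u}} [AlgebraicGeometry.IsIntegral X] (U : X.Opens)
    (A : Subring X.functionField) : Prop where
  isAffineOpen : IsAffineOpen U
  nonempty : Nonempty U
  range_eq : (X.germToFunctionField U).hom.range = A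

instance nontrivial_away (i : Fin 2) :
    Nontrivial (Away (homogeneousSubmodule (Fin 2) k) (X i)) :=
  have ⟨_, hj⟩ := exists_ne i
  (eval₂_awayCoord_injective hj.symm).nontrivial

instance isScalarTower_homogeneousSubmodule :
    IsScalarTower k (homogeneousSubmodule (Fin 2) k 0) (MvPolynomial (Fin 2) k) :=
  ⟨fun a b c => smul_mul_assoc a (b : MvPolynomial (Fin 2) k) c⟩

variable (k) in
/-- The standard affine open subsets of the projective line. -/
noncomputable def standardOpen (i : Fin 2) : (projectiveLine k).Opens :=
  Proj.basicOpen (homogeneousSubmodule (Fin 2) k) (X i)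

instance nonempty_standardOpen (i : Fin 2) : Nonempty (standardOpen k i) := by
  obtain ⟨p⟩ : Nonempty (Spec (.of (Away (homogeneousSubmodule (Fin 2) k) (X i)))) :=
    inferInstanceAs (Nonempty (PrimeSpectrum _))
  refine ⟨⟨Proj.awayι _ _ (X_mem_homogeneousSubmodule i) one_pos p, ?_⟩⟩
  rw [standardOpen, ← Proj.opensRange_awayι _ _ (X_mem_homogeneousSubmodule i) one_pos]
  exact ⟨p, rfl⟩

theorem isAffineOpen_standardOpen (i : Fin 2) : IsAffineOpen (standardOpen k i) :=
  Proj.isAffineOpen_basicOpen _ _ (X_mem_homogeneousSubmodule i) one_pos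

theorem standardOpen_sup_standardOpen : standardOpen k 0 ⊔ standardOpen k 1 = ⊤ := by
  have := Proj.iSup_basicOpen_eq_top' (homogeneousSubmodule (Fin 2) k)
    (fun i => (X i : MvPolynomial (Fin 2) k)) (fun i => ⟨1, X_mem_homogeneousSubmodule i⟩) (by
      rw [← top_le_iff]
      intro p _
      have hp : p ∈ Algebra.adjoin k (Set.range (X : Fin 2 → MvPolynomial (Fin 2) k)) := by
        rw [adjoin_range_X]
        trivial
      have hle : Algebra.adjoin k (Set.range (X : Fin 2 → MvPolynomial (Fin 2) k)) ≤
          (Algebra.adjoin (homogeneousSubmodule (Fin 2) k 0)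
            (Set.range (X : Fin 2 → MvPolynomial (Fin 2) k))).restrictScalars k :=
        Algebra.adjoin_le Algebra.subset_adjoin
      exact hle hp)
  refine top_le_iff.1 (this.ge.trans (iSup_le fun i => ?_))
  fin_cases i
  · exact le_sup_left (a := standardOpen k 0)
  · exact le_sup_right (b := standardOpen k 1)

theorem bijective_awayToSection (i : Fin 2) : Function.Bijective
    (Proj.awayToSection (homogeneousSubmodule (Fin 2) k) (X i)) := by
  have : IsIso (Proj.awayToSection (homogeneousSubmodule (Fin 2) k) (X i)) := by
    rw [← Proj.basicOpenIsoAway_hom _ _ (X_mem_homogeneousSubmodule i) one_pos]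
    infer_instance
  exact ConcreteCategory.bijective_of_isIso _

/-- The inclusion of the ring of a standard affine open subset in the function field. -/
noncomputable def awayToFunctionField (i : Fin 2) :
    Away (homogeneousSubmodule (Fin 2) k) (X i) →+* (projectiveLine k).functionField :=
  ((projectiveLine k).germToFunctionField (standardOpen k i)).hom.comp
      (Proj.awayToSection (homogeneousSubmodule (Fin 2) k) (X i)).hom

theorem awayToFunctionField_injective (i : Fin 2) :
    Function.Injective (awayToFunctionField (k := k) i) :=
  ((projectiveLine k).germToFunctionField_injective (standardOpen k i)).comp
    (bijective_awayToSection i).1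

theorem range_awayToFunctionField (i : Fin 2) :
    (awayToFunctionField (k := k) i).range =
      ((projectiveLine k).germToFunctionField (standardOpen k i)).hom.range := by
  ext z
  constructor
  · rintro ⟨a, rfl⟩
    exact ⟨_, rfl⟩
  · rintro ⟨a, rfl⟩
    obtain ⟨b, rfl⟩ := (bijective_awayToSection i).2 a
    exact ⟨b, rfl⟩

theorem awayToFunctionField_awayConst (i : Fin 2) (c : k) :
    awayToFunctionField i (awayConst i c) = constantsHom (projectiveLineHom k) c := by
  rw [← germ_sectionsHom (projectiveLineHom k) (U := standardOpen k i)]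
  exact congr((projectiveLine k).germToFunctionField (standardOpen k i)
    $(awayToSection_awayConst i c))

theorem awayToFunctionField_awayCoord_mul :
    awayToFunctionField 0 (awayCoord k 0 1) * awayToFunctionField 1 (awayCoord k 1 0) = 1 := by
  have hgen (i : Fin 2) : genericPoint (projectiveLine k) ∈ standardOpen k i :=
    ((genericPoint_spec (projectiveLine k)).mem_open_set_iff (standardOpen k i).isOpen).2
      (by simpa using nonempty_standardOpen i)
  let ψ := ((projectiveLine k).presheaf.germ
    (Proj.basicOpen (homogeneousSubmodule (Fin 2) k) (X 0 * X 1)) (genericPoint (projectiveLine k))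
      (by rw [Proj.basicOpen_mul]; exact ⟨hgen 0, hgen 1⟩)).hom.comp
      (Proj.awayToSection (homogeneousSubmodule (Fin 2) k) (X 0 * X 1)).hom
  have h0 (a) : awayToFunctionField (k := k) 0 a =
      ψ (awayMap _ (X_mem_homogeneousSubmodule 1) rfl a) := by
    have := congr($(Proj.awayMap_awayToSection (homogeneousSubmodule (Fin 2) k)
      (f := X 0) (X_mem_homogeneousSubmodule 1) rfl) a)
    refine Eq.trans ?_ congr((projectiveLine k).presheaf.germ _ (genericPoint (projectiveLine k))
      _ $this.symm)
    exact ((projectiveLine k).presheaf.germ_res_apply _ _ _ _).symm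
  have h1 (a) : awayToFunctionField (k := k) 1 a =
      ψ (awayMap _ (X_mem_homogeneousSubmodule 0) (mul_comm _ _) a) := by
    have := congr($(Proj.awayMap_awayToSection (homogeneousSubmodule (Fin 2) k)
      (f := X 1) (X_mem_homogeneousSubmodule 0) (mul_comm (X 0) (X 1))) a)
    refine Eq.trans ?_ congr((projectiveLine k).presheaf.germ _ (genericPoint (projectiveLine k))
      _ $this.symm)
    exact ((projectiveLine k).presheaf.germ_res_apply _ _ _ _).symm
  rw [h0, h1, ← map_mul, awayMap_awayCoord_mul_awayMap_awayCoord, map_one]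

theorem awayToFunctionField_eval₂ (i j : Fin 2) (p : Polynomial k) :
    letI := functionFieldAlgebra (projectiveLineHom k)
    awayToFunctionField i (p.eval₂ (awayConst i) (awayCoord k i j)) =
      Polynomial.aeval (awayToFunctionField i (awayCoord k i j)) p := by
  let := functionFieldAlgebra (projectiveLineHom k)
  rw [Polynomial.hom_eval₂, Polynomial.aeval_def]
  congr 1
  ext c
  exact awayToFunctionField_awayConst i c

theorem isAffineWithSections_standardOpen {i j : Fin 2} (hij : i ≠ j) :
    letI := functionFieldAlgebra (projectiveLineHom k)
    IsAffineWithSections (standardOpen k i)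
      (Algebra.adjoin k {awayToFunctionField i (awayCoord k i j)}).toSubring := by
  let := functionFieldAlgebra (projectiveLineHom k)
  refine ⟨isAffineOpen_standardOpen i, inferInstance, ?_⟩
  rw [← range_awayToFunctionField]
  ext z
  rw [Subalgebra.mem_toSubring, Algebra.adjoin_singleton_eq_range_aeval]
  constructor
  · rintro ⟨a, rfl⟩
    obtain ⟨p, rfl⟩ := exists_eval₂_awayCoord hij a
    exact ⟨p, (awayToFunctionField_eval₂ i j p).symm⟩
  · rintro ⟨p, rfl⟩
    exact ⟨_, awayToFunctionField_eval₂ i j p⟩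

theorem transcendental_awayCoord {i j : Fin 2} (hij : i ≠ j) :
    letI := functionFieldAlgebra (projectiveLineHom k)
    Transcendental k (awayToFunctionField i (awayCoord k i j)) := by
  let := functionFieldAlgebra (projectiveLineHom k)
  rw [transcendental_iff]
  intro p hp
  rw [← awayToFunctionField_eval₂, map_eq_zero_iff _ (awayToFunctionField_injective i)] at hp
  exact (map_eq_zero_iff _ (eval₂_awayCoord_injective hij)).1 hp

variable (k) in
theorem exists_coordinate_projectiveLine :
    letI := functionFieldAlgebra (projectiveLineHom k)
    ∃ (t : (projectiveLine k).functionField) (U₁ U₂ : (projectiveLine k).Opens),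
      Transcendental k t ∧ IsAffineWithSections U₁ (Algebra.adjoin k {t}).toSubring ∧
        IsAffineWithSections U₂ (Algebra.adjoin k {t⁻¹}).toSubring ∧ U₁ ⊔ U₂ = ⊤ := by
  refine ⟨_, _, _, transcendental_awayCoord zero_ne_one,
    isAffineWithSections_standardOpen zero_ne_one, ?_, standardOpen_sup_standardOpen⟩
  rw [inv_eq_of_mul_eq_one_right awayToFunctionField_awayCoord_mul]
  exact isAffineWithSections_standardOpen one_ne_zero

instance algebraFiniteType_homogeneousSubmodule :
    Algebra.FiniteType (homogeneousSubmodule (Fin 2) k 0) (MvPolynomial (Fin 2) k) :=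
  Algebra.FiniteType.of_restrictScalars_finiteType k _ _

instance isProper_projectiveLineHom : IsProper (projectiveLineHom k) := by
  have : IsIso (CommRingCat.ofHom (algebraMap k (homogeneousSubmodule (Fin 2) k 0))) := by
    rw [ConcreteCategory.isIso_iff_bijective]
    refine ⟨fun a b hab => C_injective (Fin 2) k (Subtype.ext_iff.1 hab), ?_⟩
    rintro ⟨p, hp⟩
    rw [homogeneousSubmodule_zero, Submodule.mem_one] at hp
    obtain ⟨c, rfl⟩ := hp
    exact ⟨c, rfl⟩
  have : IsProper (Proj.toSpecZero (homogeneousSubmodule (Fin 2) k)) := inferInstance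
  have : IsProper (Spec.map (CommRingCat.ofHom (algebraMap k (homogeneousSubmodule (Fin 2) k 0)))) :=
    inferInstance
  exact MorphismProperty.comp_mem @IsProper _ _ ‹_› ‹_›

end ProjectiveLine

end BirationalSection

namespace BirationalSection

open Polynomial in
theorem isIntegralElem_comp_of_range_le {R R' A B : Type*} [CommRing R] [CommRing R']
    [CommRing A] [CommRing B] {φ : R →+* A} {ψ : R' →+* A} (χ : A →+* B)
    (h : φ.range ≤ ψ.range) {b : B} (hb : (χ.comp φ).IsIntegralElem b) :
    (χ.comp ψ).IsIntegralElem b := by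
  obtain ⟨p, hp, hpb⟩ := hb
  have hl : p.map φ ∈ lifts ψ := by
    rw [lifts_iff_coeff_lifts]
    intro n
    rw [coeff_map]
    exact h ⟨_, rfl⟩
  obtain ⟨q, hq, -, hqm⟩ := lifts_and_natDegree_eq_and_monic hl (hp.map φ)
  refine ⟨q, hqm, ?_⟩
  rw [← eval₂_map, hq, eval₂_map, hpb]

theorem isIntegralElem_comp_iff_of_range_eq {R R' A B : Type*} [CommRing R] [CommRing R']
    [CommRing A] [CommRing B] {φ : R →+* A} {ψ : R' →+* A} (χ : A →+* B)
    (h : φ.range = ψ.range) (b : B) :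
    (χ.comp φ).IsIntegralElem b ↔ (χ.comp ψ).IsIntegralElem b :=
  ⟨isIntegralElem_comp_of_range_le χ h.le, isIntegralElem_comp_of_range_le χ h.ge⟩

theorem appLE_sectionsHom {k : Type u} [Field k] {Z Y : Scheme.{u}} (j : Z ⟶ Y)
    (g : Y ⟶ Spec (.of k)) (V : Y.Opens) (W : Z.Opens) (h : W ≤ j ⁻¹ᵁ V) (c : k) :
    j.appLE V W h (sectionsHom g V c) = sectionsHom (j ≫ g) W c := by
  have h1 : ((Scheme.ΓSpecIso (.of k)).inv ≫ g.appLE ⊤ V (by simp)) ≫ j.appLE V W h =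
      (Scheme.ΓSpecIso (.of k)).inv ≫ (j ≫ g).appLE ⊤ W (by simp) :=
    (Category.assoc _ _ _).trans (congrArg ((Scheme.ΓSpecIso (.of k)).inv ≫ ·)
      (Scheme.Hom.appLE_comp_appLE ..))
  exact congr($h1 c)

section Normalization

variable {k : Type u} [Field k] {X : Scheme.{u}} [AlgebraicGeometry.IsIntegral X]
  (M : Type u) [Field M] [Algebra X.functionField M]

/-- The morphism from the spectrum of an extension of the function field. -/
noncomputable def fromSpecExtension : Spec (.of M) ⟶ X :=
  Spec.map (CommRingCat.ofHom (algebraMap X.functionField M)) ≫ X.fromSpecStalk (genericPoint X)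

theorem isAffineHom_fromSpecExtension (f : X ⟶ Spec (.of k)) [IsSeparated f] :
    IsAffineHom (fromSpecExtension (X := X) M) := by
  apply MorphismProperty.of_postcomp (W := @IsAffineHom) (W' := @IsSeparated) _ f ‹_›
  infer_instance

theorem fromSpecExtension_mem {U : X.Opens} [Nonempty U] (p : Spec (.of M)) :
    fromSpecExtension (X := X) M p ∈ U := by
  have h : X.fromSpecStalk (genericPoint X)
      (Spec.map (CommRingCat.ofHom (algebraMap X.functionField M)) p) = genericPoint X := by
    rw [show Spec.map (CommRingCat.ofHom (algebraMap X.functionField M)) p =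
      IsLocalRing.closedPoint X.functionField from
      Subsingleton.elim (α := PrimeSpectrum X.functionField) _ _]
    exact Scheme.fromSpecStalk_closedPoint
  rw [fromSpecExtension, Scheme.Hom.comp_apply, h]
  exact ((genericPoint_spec X).mem_open_set_iff U.isOpen).2 (by simpa using ‹Nonempty U›)

theorem top_le_preimage_fromSpecExtension (U : X.Opens) [Nonempty U] :
    ⊤ ≤ fromSpecExtension (X := X) M ⁻¹ᵁ U := fun p _ => fromSpecExtension_mem M p

theorem fromSpecExtension_appLE {U : X.Opens} (hU : IsAffineOpen U) [Nonempty U] :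
    (fromSpecExtension (X := X) M).appLE U ⊤ (top_le_preimage_fromSpecExtension M U) ≫
      (Scheme.ΓSpecIso (.of M)).hom =
    X.germToFunctionField U ≫ CommRingCat.ofHom (algebraMap X.functionField M) := by
  have hgen : genericPoint X ∈ U :=
    ((genericPoint_spec X).mem_open_set_iff U.isOpen).2 (by simpa using ‹Nonempty U›)
  have h1 := IsAffineOpen.SpecMap_appLE_fromSpec (fromSpecExtension (X := X) M) hU
    (isAffineOpen_top _) (top_le_preimage_fromSpecExtension M U)
  have h2 : fromSpecExtension (X := X) M =
      Spec.map (X.germToFunctionField U ≫ CommRingCat.ofHom (algebraMap X.functionField M)) ≫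
        hU.fromSpec :=
    (congrArg (Spec.map (CommRingCat.ofHom (algebraMap X.functionField M)) ≫ ·)
      (hU.fromSpecStalk_eq_fromSpecStalk hgen).symm).trans ((Category.assoc _ _ _).symm.trans
        (congrArg (· ≫ hU.fromSpec) (Spec.map_comp _ _).symm))
  replace h1 := h1.trans congr(_ ≫ $h2)
  rw [IsAffineOpen.fromSpec_top, Scheme.isoSpec_Spec_inv, ← Category.assoc, cancel_mono,
    ← Spec.map_comp] at h1
  rw [← Iso.eq_comp_inv]
  exact Spec.map_injective h1

theorem exists_normalization (f : X ⟶ Spec (.of k)) [IsSeparated f]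
    [Algebra.IsAlgebraic X.functionField M] :
    ∃ (Y : Scheme.{u}) (_ : AlgebraicGeometry.IsIntegral Y) (π : Y ⟶ X) (_ : IsIntegralHom π)
      (e : Y.functionField ≃+* M),
      (∀ c, e (constantsHom (π ≫ f) c) = algebraMap _ M (constantsHom f c)) ∧
      ∀ (U : X.Opens) [Nonempty U], IsAffineOpen U → IsAffineOpen (π ⁻¹ᵁ U) ∧
        ∃ _ : Nonempty (π ⁻¹ᵁ U), ∀ z, z ∈ (Y.germToFunctionField (π ⁻¹ᵁ U)).hom.range ↔
          ((algebraMap X.functionField M).comp (X.germToFunctionField U).hom).IsIntegralElem (e z) := by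
  have := isAffineHom_fromSpecExtension (X := X) M f
  let i := fromSpecExtension (X := X) M
  have : IsAffineHom i := this
  let Y := i.normalization
  let π : Y ⟶ X := i.fromNormalization
  let j : Spec (.of M) ⟶ Y := i.toNormalization
  have hjπ : j ≫ π = i := i.toNormalization_fromNormalization
  have : AlgebraicGeometry.IsIntegral Y := inferInstanceAs (AlgebraicGeometry.IsIntegral i.normalization)
  have : IsIntegralHom π := inferInstanceAs (IsIntegralHom i.fromNormalization)
  have hgen : genericPoint Y ⤳ j (IsLocalRing.closedPoint M) :=
    (genericPoint_spec Y).specializes trivial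
  have hgen' : j (IsLocalRing.closedPoint M) ⤳ genericPoint Y := by
    rw [specializes_iff_mem_closure]
    have h1 : Set.range j = {j (IsLocalRing.closedPoint M)} := by
      have : Unique (Spec (.of M)) := inferInstanceAs (Unique (PrimeSpectrum M))
      rw [Set.range_unique]
      congr
      exact Subsingleton.elim (α := PrimeSpectrum M) _ _
    have h2 : DenseRange j := i.toNormalization.denseRange
    rw [← h1, h2.closure_range]
    trivial
  let θ : Y.functionField →+* M :=
    (Y.presheaf.stalkSpecializes hgen' ≫ Scheme.stalkClosedPointTo j).hom
  have hθ (V : Y.Opens) [Nonempty V] (hV : ⊤ ≤ j ⁻¹ᵁ V) (a : Γ(Y, V)) :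
      θ (Y.germToFunctionField V a) = (j.appLE V ⊤ hV ≫ (Scheme.ΓSpecIso (.of M)).hom) a := by
    have h1 : Y.germToFunctionField V ≫ Y.presheaf.stalkSpecializes hgen' ≫
        Scheme.stalkClosedPointTo j = j.appLE V ⊤ hV ≫ (Scheme.ΓSpecIso (.of M)).hom := by
      rw [Scheme.germToFunctionField, TopCat.Presheaf.germ_stalkSpecializes_assoc,
        Scheme.germ_stalkClosedPointTo]
      simp [Scheme.Hom.appLE]
      rfl
    exact congr($h1 a)
  have hne (U : X.Opens) [Nonempty U] : Nonempty (π ⁻¹ᵁ U) :=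
    ⟨⟨j (IsLocalRing.closedPoint M), by
      change (j ≫ π) _ ∈ U
      rw [hjπ]
      exact fromSpecExtension_mem M _⟩⟩
  have htop (U : X.Opens) [Nonempty U] : ⊤ ≤ j ⁻¹ᵁ (π ⁻¹ᵁ U) := by
    rw [← Scheme.Hom.comp_preimage, hjπ]
    exact top_le_preimage_fromSpecExtension M U
  have hrange (U : X.Opens) [Nonempty U] (hU : IsAffineOpen U) (m : M) :
      ((algebraMap X.functionField M).comp (X.germToFunctionField U).hom).IsIntegralElem m ↔
        ∃ a : Γ(Y, π ⁻¹ᵁ U), m = (j.appLE (π ⁻¹ᵁ U) ⊤ (htop U) ≫ (Scheme.ΓSpecIso (.of M)).hom) a := by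
    have hle : ⊤ ≤ i ⁻¹ᵁ U := top_le_preimage_fromSpecExtension M U
    let := (i.app U).hom.toAlgebra
    let ρ := (Spec (.of M)).presheaf.map (homOfLE hle).op ≫ (Scheme.ΓSpecIso (.of M)).hom
    have hρ : Function.Bijective ρ := by
      have : IsIso (homOfLE hle) := ⟨homOfLE le_top, rfl, rfl⟩
      exact ConcreteCategory.bijective_of_isIso _
    have h1 : ((algebraMap X.functionField M).comp (X.germToFunctionField U).hom) =
        ρ.hom.comp (i.app U).hom := by
      have h := fromSpecExtension_appLE (X := X) M hU
      rw [Scheme.Hom.appLE, Category.assoc] at h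
      exact congr(($h).hom).symm
    have h2 : j.appLE (π ⁻¹ᵁ U) ⊤ (htop U) ≫ (Scheme.ΓSpecIso (.of M)).hom =
        (i.normalizationObjIso hU).hom ≫ CommRingCat.ofHom (Subalgebra.val _).toRingHom ≫ ρ := by
      have h := i.normalizationObjIso_hom_val hU
      have h' : j.appLE (π ⁻¹ᵁ U) ⊤ (htop U) = j.appLE (π ⁻¹ᵁ U) (i ⁻¹ᵁ U) (by
          rw [← Scheme.Hom.comp_preimage, hjπ]) ≫ (Spec (.of M)).presheaf.map (homOfLE hle).op :=
        (Scheme.Hom.appLE_map ..).symm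
      rw [h', Category.assoc]
      refine Eq.trans (congrArg (· ≫ ρ) h.symm) (Category.assoc _ _ _)
    obtain ⟨m, rfl⟩ := hρ.2 m
    rw [h1, h2]
    have h3 : (ρ.hom.comp (i.app U).hom).IsIntegralElem (ρ m) ↔ _root_.IsIntegral Γ(X, U) m := by
      constructor
      · rintro ⟨p, hp, hpm⟩
        refine ⟨p, hp, hρ.1 ?_⟩
        rw [map_zero, ← hpm]
        exact Polynomial.hom_eval₂ _ _ _ _
      · rintro ⟨p, hp, hpm⟩
        refine ⟨p, hp, ?_⟩
        have := congr(ρ $hpm)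
        rw [map_zero] at this
        rw [← this]
        exact (Polynomial.hom_eval₂ _ _ _ _).symm
    rw [h3]
    constructor
    · intro hm
      refine ⟨(i.normalizationObjIso hU).inv ⟨m, hm⟩, ?_⟩
      simp
    · rintro ⟨a, ha⟩
      rw [hρ.1 ha]
      exact ((i.normalizationObjIso hU).hom a).2
  obtain ⟨_, ⟨U, hU, rfl⟩, hxU, -⟩ :=
    X.isBasis_affineOpens.exists_subset_of_mem_open (Set.mem_univ (genericPoint X)) isOpen_univ
  have : Nonempty U := ⟨⟨_, hxU⟩⟩
  have := hne U
  have hconst (c : k) : θ (constantsHom (π ≫ f) c) = algebraMap _ M (constantsHom f c) := by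
    rw [← germ_sectionsHom (π ≫ f) (U := π ⁻¹ᵁ U), ← germ_sectionsHom f (U := U), hθ _ (htop U)]
    refine Eq.trans ?_ congr($(fromSpecExtension_appLE (X := X) M hU) (sectionsHom f U c))
    refine congrArg (Scheme.ΓSpecIso (.of M)).hom ?_
    refine (appLE_sectionsHom j (π ≫ f) (π ⁻¹ᵁ U) ⊤ (htop U) c).trans
      (Eq.trans ?_ (appLE_sectionsHom i f U ⊤ (top_le_preimage_fromSpecExtension M U) c).symm)
    rw [← Category.assoc, hjπ]
  have hbij : Function.Bijective θ := by
    refine ⟨θ.injective, fun m => ?_⟩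
    have hint (m : M) (hm : ((algebraMap X.functionField M).comp
        (X.germToFunctionField U).hom).IsIntegralElem m) : m ∈ θ.range := by
      obtain ⟨a, rfl⟩ := (hrange U hU m).1 hm
      exact ⟨_, hθ _ (htop U) a⟩
    let := ((algebraMap X.functionField M).comp (X.germToFunctionField U).hom).toAlgebra
    have : IsScalarTower Γ(X, U) X.functionField M := .of_algebraMap_eq' rfl
    have := functionField_isFractionRing_of_isAffineOpen X U hU
    have hm : IsAlgebraic Γ(X, U) m :=
      (IsFractionRing.isAlgebraic_iff Γ(X, U) X.functionField M).2 (Algebra.IsAlgebraic.isAlgebraic m)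
    obtain ⟨a, ha, ham⟩ := hm.exists_integral_multiple
    obtain ⟨z, hz⟩ := hint _ ham
    obtain ⟨w, hw⟩ := hint (algebraMap Γ(X, U) M a) (RingHom.isIntegralElem_map _)
    refine ⟨z / w, ?_⟩
    have ha0 : algebraMap Γ(X, U) M a ≠ 0 := by
      rw [IsScalarTower.algebraMap_apply Γ(X, U) X.functionField M, _root_.map_ne_zero]
      exact (map_ne_zero_iff _ (X.germToFunctionField_injective U)).2 ha
    rw [map_div₀, hz, hw, Algebra.smul_def, mul_div_cancel_left₀ _ ha0]
  refine ⟨Y, ‹_›, π, ‹_›, RingEquiv.ofBijective θ hbij, hconst, fun U _ hU => ⟨hU.preimage π, hne U,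
    fun z => ?_⟩⟩
  have := hne U
  rw [RingEquiv.ofBijective_apply, hrange U hU]
  constructor
  · rintro ⟨a, rfl⟩
    exact ⟨a, hθ _ (htop U) a⟩
  · rintro ⟨a, ha⟩
    exact ⟨a, θ.injective ((hθ _ (htop U) a).trans ha.symm)⟩

end Normalization

end BirationalSection

namespace BirationalSection

section Dedekind

open Polynomial

theorem _root_.IsDedekindDomain.of_ringEquiv {A B : Type*} [CommRing A] [CommRing B]
    [hA : IsDedekindDomain A] (e : A ≃+* B) : IsDedekindDomain B :=
  have : IsDomain B := e.symm.toMulEquiv.isDomain A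
  have : IsNoetherianRing B := isNoetherianRing_of_ringEquiv A e
  have : IsIntegrallyClosed B := .of_equiv e
  have : Ring.DimensionLEOne B := .of_ringEquiv e.symm
  { }

variable {k M : Type u} [Field k] [Field M] [Algebra k M] {t y : M} {b c : k[X]}

theorem isDedekindDomain_adjoin_pair (h : IsSmoothQuadratic b c) (ht : Transcendental k t)
    (hy : y ^ 2 + aeval t b * y = aeval t c) [IsFractionRing (Algebra.adjoin k {t, y}) M] :
    IsDedekindDomain (Algebra.adjoin k {t, y}) := by
  have := algebraFiniteType_adjoin_pair (k := k) (t := t) (y := y)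
  have hN : IsNoetherianRing (Algebra.adjoin k {t, y}) := Algebra.FiniteType.isNoetherianRing k _
  let φ : k[X] →ₐ[k] Algebra.adjoin k {t, y} :=
    aeval ⟨t, Algebra.subset_adjoin (by simp)⟩
  have hφ (p : k[X]) : (φ p : M) = aeval t p := by
    rw [← Subalgebra.coe_val, ← aeval_algHom_apply]
    rfl
  let := φ.toRingHom.toAlgebra
  have hint (z : Algebra.adjoin k {t, y}) : _root_.IsIntegral k[X] z := by
    obtain ⟨p, hp, hpz⟩ := (mem_adjoin_iff_isIntegralElem h ht hy).1 z.2
    refine ⟨p, hp, Subtype.val_injective ?_⟩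
    rw [ZeroMemClass.coe_zero, ← hpz]
    refine (hom_eval₂ _ _ (Algebra.adjoin k {t, y}).subtype _).trans ?_
    congr 1
    exact RingHom.ext hφ
  have : Algebra.IsIntegral k[X] (Algebra.adjoin k {t, y}) := ⟨hint⟩
  have : Ring.DimensionLEOne (Algebra.adjoin k {t, y}) :=
    Ring.DimensionLEOne.of_isIntegral k[X] _
  have : IsIntegrallyClosed (Algebra.adjoin k {t, y}) := by
    rw [isIntegrallyClosed_iff M]
    intro z hz
    let := ((algebraMap (Algebra.adjoin k {t, y}) M).comp (algebraMap k[X] _)).toAlgebra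
    have : IsScalarTower k[X] (Algebra.adjoin k {t, y}) M := .of_algebraMap_eq' rfl
    have hz' : _root_.IsIntegral k[X] z := isIntegral_trans z hz
    refine ⟨⟨z, (mem_adjoin_iff_isIntegralElem h ht hy).2 ?_⟩, rfl⟩
    have h1 : algebraMap k[X] M = (aeval t).toRingHom := RingHom.ext hφ
    rw [← h1]
    exact hz'
  exact { }

theorem isDedekindDomain_adjoin_singleton (t : M) : IsDedekindDomain (Algebra.adjoin k {t}) := by
  have : IsPrincipalIdealRing (Algebra.adjoin k {t}) := by
    rw [Algebra.adjoin_singleton_eq_range_aeval]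
    exact .of_surjective (aeval t : k[X] →ₐ[k] M).rangeRestrict.toRingHom
      (aeval t : k[X] →ₐ[k] M).rangeRestrict_surjective
  infer_instance

end Dedekind

section Sections

variable {X : Scheme.{u}} [AlgebraicGeometry.IsIntegral X]

theorem IsAffineWithSections.exists_ringEquiv {U : X.Opens} [Nonempty U]
    {A : Subring X.functionField} (h : IsAffineWithSections U A) :
    ∃ e : Γ(X, U) ≃+* A, ∀ a, (e a : X.functionField) = X.germToFunctionField U a :=
  ⟨(RingEquiv.ofBijective (X.germToFunctionField U).hom.rangeRestrict
    ⟨fun _ _ hab => X.germToFunctionField_injective U (Subtype.ext_iff.1 hab),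
      RingHom.rangeRestrict_surjective _⟩).trans (RingEquiv.subringCongr h.range_eq), fun _ => rfl⟩

theorem IsAffineWithSections.mem_or_inv_mem {U : X.Opens} {A : Subring X.functionField}
    (h : IsAffineWithSections U A) [IsDedekindDomain A] {x : X} (hx : x ∈ U) (z : X.functionField) :
    z ∈ localRing x ∨ z⁻¹ ∈ localRing x := by
  have := h.nonempty
  obtain ⟨e, -⟩ := h.exists_ringEquiv
  have : IsDedekindDomain Γ(X, U) := .of_ringEquiv e.symm
  let _ := TopCat.Presheaf.algebra_section_stalk X.presheaf ⟨x, hx⟩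
  have : IsLocalization.AtPrime (X.presheaf.stalk x)
      (h.isAffineOpen.primeIdealOf ⟨x, hx⟩).asIdeal := h.isAffineOpen.isLocalization_stalk ⟨x, hx⟩
  have : IsDedekindDomain (X.presheaf.stalk x) :=
    IsLocalization.isDedekindDomain Γ(X, U)
      (h.isAffineOpen.primeIdealOf ⟨x, hx⟩).asIdeal.primeCompl_le_nonZeroDivisors _
  have : ValuationRing (X.presheaf.stalk x) :=
    ((tfae_of_isNoetherianRing_of_isLocalRing_of_isDomain (X.presheaf.stalk x)).out 2 1).1 ‹_›
  rcases ValuationRing.isInteger_or_isInteger (X.presheaf.stalk x) z with h | h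
  · exact Or.inl h
  · exact Or.inr h

variable {k : Type u} [Field k] (f : X ⟶ Spec (.of k))

theorem IsAffineWithSections.exists_ringEquiv_sectionsHom {U : X.Opens} [Nonempty U] :
    letI := functionFieldAlgebra f
    ∀ {A : Subalgebra k X.functionField} (_ : IsAffineWithSections U A.toSubring),
      ∃ e : A ≃+* Γ(X, U), e.toRingHom.comp (algebraMap k A) = sectionsHom f U := by
  let := functionFieldAlgebra f
  intro A h
  obtain ⟨e, he⟩ := h.exists_ringEquiv
  refine ⟨e.symm, RingHom.ext fun c => e.injective (Subtype.ext ?_)⟩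
  exact (congrArg Subtype.val (e.apply_symm_apply (algebraMap k A c))).trans
    ((he _).trans (germ_sectionsHom f c)).symm

theorem smoothOfRelativeDimension_of_sections (n : ℕ) {U V : X.Opens} (hcov : U ⊔ V = ⊤) :
    letI := functionFieldAlgebra f
    ∀ {A B : Subalgebra k X.functionField} (_ : IsAffineWithSections U A.toSubring)
      (_ : IsAffineWithSections V B.toSubring)
      (_ : RingHom.Locally (RingHom.IsStandardSmoothOfRelativeDimension n) (algebraMap k A))
      (_ : RingHom.Locally (RingHom.IsStandardSmoothOfRelativeDimension n) (algebraMap k B)),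
      SmoothOfRelativeDimension n f := by
  let := functionFieldAlgebra f
  intro A B hA hB hAs hBs
  have hiso := RingHom.locally_respectsIso
    (RingHom.isStandardSmoothOfRelativeDimension_respectsIso.{u} (n := n))
  have key {W : X.Opens} {C : Subalgebra k X.functionField}
      (hC : IsAffineWithSections W C.toSubring)
      (hCs : RingHom.Locally (RingHom.IsStandardSmoothOfRelativeDimension n) (algebraMap k C)) :
      RingHom.Locally (RingHom.IsStandardSmoothOfRelativeDimension n)
        (f.appLE ⊤ W le_top).hom := by
    have := hC.nonempty
    obtain ⟨e, he⟩ := hC.exists_ringEquiv_sectionsHom f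
    have h1 := hiso.1 _ e hCs
    rw [show e.toRingHom.comp (algebraMap k C) = _ from he] at h1
    exact (hiso.cancel_left_isIso (Scheme.ΓSpecIso (.of k)).inv (f.appLE ⊤ W le_top)).1 h1
  refine HasRingHomProperty.of_iSup_eq_top (P := @SmoothOfRelativeDimension n) (ι := Bool)
    (fun i => if i then ⟨U, hA.isAffineOpen⟩ else ⟨V, hB.isAffineOpen⟩) ?_ ?_
  · rw [iSup_bool_eq]
    exact hcov
  · rintro (_ | _)
    · exact key hB hBs
    · exact key hA hAs

open scoped TensorProduct in
theorem geometricallyConnected_of_sections {U V : X.Opens} (hcov : U ⊔ V = ⊤) :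
    letI := functionFieldAlgebra f
    ∀ {A B : Subalgebra k X.functionField} (_ : IsAffineWithSections U A.toSubring)
      (_ : IsAffineWithSections V B.toSubring)
      (_ : ∀ (F : Type u) [Field F] [Algebra k F], IsDomain (F ⊗[k] A))
      (_ : ∀ (F : Type u) [Field F] [Algebra k F], IsDomain (F ⊗[k] B)),
      GeometricallyConnected f := by
  let := functionFieldAlgebra f
  intro A B hA hB hAd hBd
  refine ⟨?_⟩
  rw [geometrically_iff_of_commRing_of_isClosedUnderIsomorphisms]
  intro F _ _
  let α : Spec (.of F) ⟶ Spec (.of k) := Spec.map (CommRingCat.ofHom (algebraMap k F))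
  let p := Limits.pullback.fst f α
  have key {W : X.Opens} {C : Subalgebra k X.functionField}
      (hC : IsAffineWithSections W C.toSubring) (hCd : IsDomain (F ⊗[k] C)) :
      IsIrreducible (p ⁻¹' (W : Set X)) := by
    have := hC.nonempty
    obtain ⟨e, he⟩ := hC.exists_ringEquiv_sectionsHom f
    let := (sectionsHom f W).toAlgebra
    let e' : C ≃ₐ[k] Γ(X, W) := AlgEquiv.ofRingEquiv (f := e) fun c => congr($he c)
    have : IsDomain (Γ(X, W) ⊗[k] F) :=
      ((Algebra.TensorProduct.comm k _ _).trans
        (Algebra.TensorProduct.congr AlgEquiv.refl e'.symm)).toMulEquiv.isDomain (F ⊗[k] C)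
    have hW := hC.isAffineOpen
    let i := (Limits.pullbackRightPullbackFstIso f α hW.fromSpec)
    have : IrreducibleSpace (Limits.pullback hW.fromSpec p : Scheme.{u}) := by
      have : IrreducibleSpace (Spec (.of (Γ(X, W) ⊗[k] F))) :=
        inferInstanceAs (IrreducibleSpace (PrimeSpectrum (Γ(X, W) ⊗[k] F)))
      have h1 : Limits.pullback (hW.fromSpec ≫ f) α ≅ Spec (.of (Γ(X, W) ⊗[k] F)) :=
        Limits.pullback.congrHom (fromSpec_comp_eq f hW) rfl ≪≫ pullbackSpecIso k Γ(X, W) F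
      have h2 := (IrreducibleSpace.isIrreducible_univ _).image _
        (i ≪≫ h1).inv.continuous.continuousOn
      rw [Set.image_univ, (i ≪≫ h1).inv.surjective.range_eq] at h2
      exact (irreducibleSpace_def _).2 h2
    have hr : p ⁻¹' (W : Set X) = Set.range (Limits.pullback.snd hW.fromSpec p) := by
      rw [IsOpenImmersion.range_pullbackSnd, hW.opensRange_fromSpec]
      rfl
    rw [hr, ← Set.image_univ]
    exact (IrreducibleSpace.isIrreducible_univ _).image _
      (Limits.pullback.snd hW.fromSpec p).continuous.continuousOn
  have hgen : ∃ z, p z = genericPoint X := by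
    have : Surjective α := by
      refine ⟨fun x => ⟨IsLocalRing.closedPoint F, Subsingleton.elim (α := PrimeSpectrum k) _ _⟩⟩
    exact p.surjective _
  obtain ⟨z, hz⟩ := hgen
  have hmem {W : X.Opens} (hW : Nonempty W) : z ∈ p ⁻¹' (W : Set X) := by
    rw [Set.mem_preimage, hz]
    exact ((genericPoint_spec X).mem_open_set_iff W.isOpen).2 (by simpa using hW)
  have hU := (key hA (hAd F)).isPreirreducible.isPreconnected
  have hV := (key hB (hBd F)).isPreirreducible.isPreconnected
  have huniv := hU.union z (hmem hA.nonempty) (hmem hB.nonempty) hV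
  rw [← Set.preimage_union, show (U : Set X) ∪ V = Set.univ from congr($hcov.1),
    Set.preimage_univ] at huniv
  have : PreconnectedSpace (Limits.pullback f α : Scheme.{u}) := ⟨huniv⟩
  exact { toNonempty := ⟨z⟩ }

end Sections

end BirationalSection

namespace BirationalSection

section Pole

open Polynomial

variable {k M : Type u} [Field k] [Field M] [Algebra k M] {t y : M} {b c b' c' : k[X]}

theorem aeval_inv_mul_pow (ht : t ≠ 0) (P : k[X]) {N : ℕ} (hN : P.natDegree ≤ N) :
    aeval t⁻¹ P * t ^ N = aeval t (reflect N P) := by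
  have h := invertibleOfNonzero ht
  have := eval₂_reflect_mul_pow (algebraMap k M) t N (reflect N P)
    ((natDegree_reflect_le).trans (max_le le_rfl hN))
  rwa [reflect_reflect, invOf_eq_inv] at this

/-- The functions on `y² + b y = c` which are regular on the affine part and have a pole of order
bounded by `n` (as polynomials in `t`) at infinity. -/
theorem mem_adjoin_and_mem_adjoin_iff (h : IsSmoothQuadratic b c) (ht : Transcendental k t)
    (hy : y ^ 2 + aeval t b * y = aeval t c) (n : ℕ)
    (hw : (y * t⁻¹ ^ (n + 2)) ^ 2 + aeval t⁻¹ b' * (y * t⁻¹ ^ (n + 2)) = aeval t⁻¹ c') (m : M) :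
    (m ∈ Algebra.adjoin k {t, y} ∧
        m * t⁻¹ ^ n ∈ Algebra.adjoin k {t⁻¹, y * t⁻¹ ^ (n + 2)}) ↔
      ∃ p ∈ degreeLT k (n + 1), m = aeval t p := by
  have ht0 : t ≠ 0 := by
    rintro rfl
    exact ht isAlgebraic_zero
  rw [mem_adjoin_pair_iff _ _ hy, mem_adjoin_pair_iff _ _ hw]
  constructor
  · rintro ⟨⟨p, q, rfl⟩, P, Q, hPQ⟩
    let N := max P.natDegree Q.natDegree
    have hP := aeval_inv_mul_pow ht0 P (le_max_left P.natDegree Q.natDegree : _ ≤ N)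
    have hQ := aeval_inv_mul_pow ht0 Q (le_max_right P.natDegree Q.natDegree : _ ≤ N)
    have hpow : t⁻¹ ^ n * t ^ n = 1 := by rw [← mul_pow, inv_mul_cancel₀ ht0, one_pow]
    have hpow' : t⁻¹ ^ (n + 2) * t ^ (n + 2) = 1 := by
      rw [← mul_pow, inv_mul_cancel₀ ht0, one_pow]
    have key : aeval t (X ^ (N + 2) * p - X ^ (n + 2) * reflect N P) +
        aeval t (X ^ (N + 2) * q - reflect N Q) * y = 0 := by
      rw [map_sub, map_sub, map_mul, map_mul, map_mul, ← hP, ← hQ]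
      simp only [map_pow, aeval_X]
      linear_combination (t ^ (n + 2) * t ^ N) * hPQ -
        (aeval t p + aeval t q * y) * t ^ (N + 2) * hpow + aeval t⁻¹ Q * t ^ N * y * hpow'
    obtain ⟨h1, h2⟩ := aeval_add_aeval_mul_eq_zero t y h.no_root_self ht hy key
    have hq : q = 0 := by
      by_contra hq
      have := congrArg natDegree (sub_eq_zero.1 h2)
      rw [natDegree_X_pow_mul _ hq] at this
      have h3 : (reflect N Q).natDegree ≤ N :=
        natDegree_reflect_le.trans (max_le le_rfl (le_max_right _ _))
      omega
    refine ⟨p, ?_, by simp [hq]⟩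
    rw [mem_degreeLT]
    rcases eq_or_ne p 0 with rfl | hp
    · simp
    · have := congrArg natDegree (sub_eq_zero.1 h1)
      rw [natDegree_X_pow_mul _ hp] at this
      have h3 : (X ^ (n + 2) * reflect N P).natDegree ≤ (n + 2) + N :=
        natDegree_mul_le.trans (add_le_add (natDegree_X_pow_le _)
          (natDegree_reflect_le.trans (max_le le_rfl (le_max_left _ _))))
      rw [degree_eq_natDegree hp, Nat.cast_lt]
      omega
  · rintro ⟨p, hp, rfl⟩
    refine ⟨⟨p, 0, by simp⟩, reflect n p, 0, ?_⟩
    have hpn : p.natDegree ≤ n := by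
      rw [mem_degreeLT] at hp
      rcases eq_or_ne p 0 with rfl | hp0
      · simp
      · exact Nat.lt_succ_iff.1 ((natDegree_lt_iff_degree_lt hp0).2 hp)
    have := aeval_inv_mul_pow (inv_ne_zero ht0) p hpn
    rw [inv_inv] at this
    rw [this]
    simp

end Pole

section Generator

open scoped KaehlerDifferential

variable {k K : Type u} [Field k] [Field K] [Algebra k K]

/-- A differential `ω` of `K / k` that generates the differentials of the subring `S` of `K`. -/
structure IsDifferentialGenerator (S : Subalgebra k K) (ω : Ω[K⁄k]) : Prop where
  exists_eq_add : ∃ t ∈ S, ∃ y ∈ S, ∃ p ∈ S, ∃ q ∈ S,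
    ω = p • KaehlerDifferential.D k K t + q • KaehlerDifferential.D k K y
  D_eq_smul : ∀ s ∈ S, ∃ r ∈ S, KaehlerDifferential.D k K s = r • ω
  ne_zero : ω ≠ 0
  eq_smul : ∀ η, ∃ m : K, η = m • ω

theorem IsDifferentialGenerator.mem_span_iff {S : Subalgebra k K} {ω : Ω[K⁄k]}
    (h : IsDifferentialGenerator S ω) {R : Subring K} (hSR : ∀ s ∈ S, s ∈ R)
    (hR : ∀ z ∈ R, ∃ a ∈ S, ∃ b ∈ S, b ≠ 0 ∧ b⁻¹ ∈ R ∧ z * b = a) (η : Ω[K⁄k]) :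
    η ∈ Submodule.span k {ω : Ω[K⁄k] | ∃ a ∈ R, ∃ b ∈ R,
      ω = a • KaehlerDifferential.D k K b} ↔ ∃ m ∈ R, η = m • ω := by
  constructor
  · intro hη
    induction hη using Submodule.span_induction with
    | mem η hη =>
      obtain ⟨z, hz, z', hz', rfl⟩ := hη
      obtain ⟨a, ha, b, hb, hb0, hbR, hab⟩ := hR z' hz'
      obtain ⟨r, hr, hra⟩ := h.D_eq_smul a ha
      obtain ⟨r', hr', hrb⟩ := h.D_eq_smul b hb
      refine ⟨z * (b⁻¹ * (r - z' * r')), mul_mem hz (mul_mem hbR (sub_mem (hSR _ hr)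
        (mul_mem hz' (hSR _ hr')))), ?_⟩
      have h1 := congrArg (KaehlerDifferential.D k K) hab
      rw [Derivation.leibniz, hra, hrb] at h1
      have h2 : b • KaehlerDifferential.D k K z' = (r - z' * r') • ω := by
        rw [sub_smul, ← h1, mul_smul, add_sub_cancel_left]
      rw [mul_smul, mul_smul, ← h2, smul_smul b⁻¹, inv_mul_cancel₀ hb0, one_smul]
    | zero => exact ⟨0, zero_mem _, (zero_smul _ _).symm⟩
    | add η η' _ _ h₁ h₂ =>
      obtain ⟨m, hm, rfl⟩ := h₁
      obtain ⟨m', hm', rfl⟩ := h₂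
      exact ⟨m + m', add_mem hm hm', (add_smul _ _ _).symm⟩
    | smul c η _ h₁ =>
      obtain ⟨m, hm, rfl⟩ := h₁
      refine ⟨algebraMap k K c * m, mul_mem (hSR _ (S.algebraMap_mem c)) hm, ?_⟩
      rw [mul_smul, algebraMap_smul]
  · rintro ⟨m, hm, rfl⟩
    obtain ⟨t, ht, y, hy, p, hp, q, hq, hω⟩ := h.exists_eq_add
    rw [hω, smul_add, smul_smul, smul_smul]
    exact add_mem
      (Submodule.subset_span ⟨_, mul_mem hm (hSR _ hp), t, hSR _ ht, rfl⟩)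
      (Submodule.subset_span ⟨_, mul_mem hm (hSR _ hq), y, hSR _ hy, rfl⟩)

open Polynomial in
theorem exists_isDifferentialGenerator {t y : K} {b c : k[X]} (h : IsSmoothQuadratic b c)
    (ht : Transcendental k t) (hy : y ^ 2 + aeval t b * y = aeval t c)
    [IsFractionRing (Algebra.adjoin k {t, y}) K] :
    ∃ ω : Ω[K⁄k], IsDifferentialGenerator (Algebra.adjoin k {t, y}) ω ∧
      KaehlerDifferential.D k K t = (2 * y + aeval t b) • ω := by
  obtain ⟨ω, ⟨p, hp, q, hq, hω⟩, hDt, hD, h0, hη⟩ := exists_generator_differentials h ht hy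
  exact ⟨ω, ⟨⟨t, Algebra.subset_adjoin (by simp), y, Algebra.subset_adjoin (by simp),
    p, hp, q, hq, hω⟩, hD, h0, hη⟩, hDt⟩

end Generator

section Global

variable {X : Scheme.{u}} [AlgebraicGeometry.IsIntegral X]

theorem IsAffineWithSections.exists_mul_eq {U : X.Opens} {A : Subring X.functionField}
    (h : IsAffineWithSections U A) {x : X} (hx : x ∈ U) {z : X.functionField}
    (hz : z ∈ localRing x) : ∃ a ∈ A, ∃ b ∈ A, b ≠ 0 ∧ b⁻¹ ∈ localRing x ∧ z * b = a := by
  have := h.nonempty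
  obtain ⟨p, rfl⟩ := exists_fromSpec_eq h.isAffineOpen hx
  obtain ⟨a, b, hb, hab⟩ := (mem_localRing_fromSpec_iff h.isAffineOpen p z).1 hz
  have hA (a : Γ(X, U)) : X.germToFunctionField U a ∈ A := h.range_eq ▸ ⟨a, rfl⟩
  have hb0 : X.germToFunctionField U b ≠ 0 := by
    intro h0
    rw [← map_zero (X.germToFunctionField U).hom] at h0
    exact hb (X.germToFunctionField_injective U h0 ▸ zero_mem _)
  refine ⟨_, hA a, _, hA b, hb0, (mem_localRing_fromSpec_iff h.isAffineOpen p _).2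
    ⟨1, b, hb, ?_⟩, hab⟩
  rw [inv_mul_cancel₀ hb0, map_one]

theorem IsAffineWithSections.mem_localRing {U : X.Opens} {A : Subring X.functionField}
    (h : IsAffineWithSections U A) {x : X} (hx : x ∈ U) {z : X.functionField} (hz : z ∈ A) :
    z ∈ localRing x := by
  have := h.nonempty
  rw [← h.range_eq] at hz
  obtain ⟨a, rfl⟩ := hz
  exact germ_mem_localRing hx a

theorem IsAffineWithSections.mem_of_forall {U : X.Opens} {A : Subring X.functionField}
    (h : IsAffineWithSections U A) {z : X.functionField} (hz : ∀ x ∈ U, z ∈ localRing x) :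
    z ∈ A := by
  have := h.nonempty
  rw [← h.range_eq]
  exact exists_germ_eq_of_forall_mem_localRing h.isAffineOpen z hz

theorem IsAffineWithSections.isFractionRing {U : X.Opens} {k : Type u} [Field k]
    [Algebra k X.functionField] {A : Subalgebra k X.functionField}
    (h : IsAffineWithSections U A.toSubring) : IsFractionRing A X.functionField := by
  have := h.nonempty
  have := functionField_isFractionRing_of_isAffineOpen X U h.isAffineOpen
  refine IsFractionRing.of_field _ _ fun z => ?_
  obtain ⟨a, b, -, rfl⟩ := IsFractionRing.div_surjective (A := Γ(X, U)) z
  have hA (a : Γ(X, U)) : X.germToFunctionField U a ∈ A.toSubring := h.range_eq ▸ ⟨a, rfl⟩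
  exact ⟨⟨_, hA a⟩, ⟨_, hA b⟩, rfl⟩

variable {k : Type u} [Field k] (f : X ⟶ Spec (.of k))

open scoped KaehlerDifferential
open Polynomial

theorem mem_globalDifferentials_iff {U V : X.Opens} (hcov : U ⊔ V = ⊤) :
    letI := functionFieldAlgebra f
    ∀ {A B : Subalgebra k X.functionField} (_ : IsAffineWithSections U A.toSubring)
      (_ : IsAffineWithSections V B.toSubring) {ω₁ ω₂ : Ω[X.functionField⁄k]}
      (_ : IsDifferentialGenerator A ω₁) (_ : IsDifferentialGenerator B ω₂)
      (η : Ω[X.functionField⁄k]),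
      η ∈ globalDifferentials f ↔ (∃ m ∈ A, η = m • ω₁) ∧ ∃ m ∈ B, η = m • ω₂ := by
  let := functionFieldAlgebra f
  intro A B hA hB ω₁ ω₂ h₁ h₂ η
  have key {W : X.Opens} {C : Subalgebra k X.functionField} {ω : Ω[X.functionField⁄k]}
      (hC : IsAffineWithSections W C.toSubring) (h : IsDifferentialGenerator C ω) {x : X}
      (hx : x ∈ W) := h.mem_span_iff (R := localRing x) (fun s hs => hC.mem_localRing hx hs)
        (fun z hz => hC.exists_mul_eq hx hz) η
  have key' {W : X.Opens} {C : Subalgebra k X.functionField} {ω : Ω[X.functionField⁄k]}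
      (hC : IsAffineWithSections W C.toSubring) (h : IsDifferentialGenerator C ω)
      (hη : η ∈ globalDifferentials f) : ∃ m ∈ C, η = m • ω := by
    obtain ⟨m, hm⟩ := h.eq_smul η
    refine ⟨m, hC.mem_of_forall fun x hx => ?_, hm⟩
    obtain ⟨m', hm', h'⟩ := (key hC h hx).1 (Submodule.mem_iInf _ |>.1 hη x)
    rwa [smul_left_injective _ h.ne_zero (hm.symm.trans h')]
  refine ⟨fun hη => ⟨key' hA h₁ hη, key' hB h₂ hη⟩, fun hη => ?_⟩
  refine Submodule.mem_iInf _ |>.2 fun x => ?_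
  obtain ⟨⟨m₁, hm₁, e₁⟩, m₂, hm₂, e₂⟩ := hη
  have hx : x ∈ U ⊔ V := hcov ▸ trivial
  rcases hx with hx | hx
  · exact (key hA h₁ hx).2 ⟨m₁, hA.mem_localRing hx hm₁, e₁⟩
  · exact (key hB h₂ hx).2 ⟨m₂, hB.mem_localRing hx hm₂, e₂⟩

theorem genus_eq_of_sections {U V : X.Opens} (hcov : U ⊔ V = ⊤) (n : ℕ) :
    letI := functionFieldAlgebra f
    ∀ {t y : X.functionField} {b c b' c' : k[X]} (_ : IsSmoothQuadratic b c)
      (_ : IsSmoothQuadratic b' c') (_ : Transcendental k t)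
      (_ : y ^ 2 + aeval t b * y = aeval t c)
      (_ : (y * t⁻¹ ^ (n + 2)) ^ 2 + aeval t⁻¹ b' * (y * t⁻¹ ^ (n + 2)) = aeval t⁻¹ c')
      (_ : aeval t⁻¹ b' = t⁻¹ ^ (n + 2) * aeval t b) (_ : 2 * y + aeval t b ≠ 0)
      (_ : IsAffineWithSections U (Algebra.adjoin k {t, y}).toSubring)
      (_ : IsAffineWithSections V (Algebra.adjoin k {t⁻¹, y * t⁻¹ ^ (n + 2)}).toSubring),
      genus f = n + 1 := by
  let := functionFieldAlgebra f
  intro t y b c b' c' h h' ht hy hw hb h0 hU hV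
  have ht0 : t ≠ 0 := by
    rintro rfl
    exact ht isAlgebraic_zero
  have hu : Transcendental k t⁻¹ := by
    intro hu
    exact ht (by simpa using hu.inv)
  have := hU.isFractionRing
  have := hV.isFractionRing
  obtain ⟨ω₁, h₁, hD₁⟩ := exists_isDifferentialGenerator h ht hy
  obtain ⟨ω₂, h₂, hD₂⟩ := exists_isDifferentialGenerator h' hu hw
  have hω : t⁻¹ ^ n • ω₂ = - ω₁ := by
    have h3 := Derivation.leibniz_inv (KaehlerDifferential.D k X.functionField) t
    rw [hD₁, hD₂, hb, smul_smul] at h3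
    have h4 : (t⁻¹ ^ 2 * (2 * y + aeval t b)) • (t⁻¹ ^ n • ω₂ + ω₁) = 0 := by
      rw [smul_add, smul_smul]
      have : t⁻¹ ^ 2 * (2 * y + aeval t b) * t⁻¹ ^ n =
        2 * (y * t⁻¹ ^ (n + 2)) + t⁻¹ ^ (n + 2) * aeval t b := by ring
      rw [this, h3, ← add_smul]
      ring_nf
      exact zero_smul _ _
    rcases smul_eq_zero.1 h4 with h5 | h5
    · exact absurd h5 (mul_ne_zero (pow_ne_zero _ (inv_ne_zero ht0)) h0)
    · exact eq_neg_of_add_eq_zero_left h5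
  have hmem (η : Ω[X.functionField⁄k]) :
      η ∈ globalDifferentials f ↔ ∃ p ∈ degreeLT k (n + 1), η = aeval t p • ω₁ := by
    rw [mem_globalDifferentials_iff f hcov hU hV h₁ h₂]
    constructor
    · rintro ⟨⟨m, hm, rfl⟩, m', hm', e⟩
      have : m * t⁻¹ ^ n = - m' := by
        refine smul_left_injective _ h₂.ne_zero ?_
        change (m * t⁻¹ ^ n) • ω₂ = (-m') • ω₂
        rw [mul_smul, hω, smul_neg, e, neg_smul]
      obtain ⟨p, hp, rfl⟩ := (mem_adjoin_and_mem_adjoin_iff h ht hy n hw m).1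
        ⟨hm, this ▸ neg_mem hm'⟩
      exact ⟨p, hp, rfl⟩
    · rintro ⟨p, hp, rfl⟩
      obtain ⟨h3, h4⟩ := (mem_adjoin_and_mem_adjoin_iff h ht hy n hw _).2 ⟨p, hp, rfl⟩
      refine ⟨⟨_, h3, rfl⟩, _, neg_mem h4, ?_⟩
      rw [neg_smul, mul_smul, hω, smul_neg, neg_neg]
  let φ : degreeLT k (n + 1) →ₗ[k] Ω[X.functionField⁄k] :=
    ((LinearMap.toSpanSingleton X.functionField _ ω₁).restrictScalars k).comp
      ((aeval t).toLinearMap.comp (degreeLT k (n + 1)).subtype)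
  have hφ : Function.Injective φ := by
    intro p q hpq
    exact Subtype.ext (transcendental_iff_injective.1 ht (smul_left_injective _ h₁.ne_zero hpq))
  have hr : LinearMap.range φ = globalDifferentials f := by
    ext η
    rw [hmem, LinearMap.mem_range]
    exact ⟨fun ⟨p, hp⟩ => ⟨p, p.2, hp.symm⟩, fun ⟨p, hp, e⟩ => ⟨⟨p, hp⟩, e.symm⟩⟩
  have h6 : Module.finrank k (globalDifferentials f) = n + 1 := by
    rw [← hr, LinearMap.finrank_range_of_inj hφ, (degreeLTEquiv k (n + 1)).finrank_eq,
      Module.finrank_fin_fun]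
  exact h6

end Global

end BirationalSection

namespace BirationalSection

section SmoothQuadratic

open Polynomial

variable {k : Type u} [Field k]

theorem separable_X_sub_X_pow {N : ℕ} (hN : 2 ≤ N) (h : (N : k) - 1 ≠ 0) :
    (X - X ^ N : k[X]).Separable := by
  obtain ⟨m, rfl⟩ := Nat.exists_eq_add_of_le' hN
  rw [separable_def']
  refine ⟨C ((m : k) + 2) * C ((m : k) + 1)⁻¹ * (C ((m : k) + 2) * X ^ m),
    1 - X * C ((m : k) + 1)⁻¹ * (C ((m : k) + 2) * X ^ m), ?_⟩
  have h1 : C ((m : k) + 1)⁻¹ * C ((m : k) + 1) = 1 := by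
    rw [← C_mul, inv_mul_cancel₀, C_1]
    intro h0
    apply h
    push_cast
    linear_combination h0
  have h2 : derivative (X - X ^ (m + 2) : k[X]) = 1 - C ((m : k) + 2) * X ^ (m + 1) := by
    simp
    rw [C_ofNat]
    ring
  rw [h2]
  rw [show (C ((m : k) + 2) : k[X]) = C ((m : k) + 1) + 1 by
    rw [← C_1, ← C_add]
    congr 1
    ring]
  linear_combination (X ^ (m + 1) * (C ((m : k) + 1) + 1)) * h1

theorem separable_C_mul {α : k} (hα : α ≠ 0) {p : k[X]} (hp : p.Separable) :
    (C α * p).Separable := by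
  have hu : IsUnit (C α) := isUnit_C.2 hα.isUnit
  rw [separable_def, derivative_C_mul]
  exact (isCoprime_mul_unit_left hu _ _).2 hp

theorem isSmoothQuadratic_zero (h2 : (2 : k) ≠ 0) {c : k[X]} (hc : c.Separable)
    (hd : 1 ≤ c.natDegree) : IsSmoothQuadratic 0 c where
  jacobian {B} _ _ t y hy := by
    obtain ⟨p, q, hpq⟩ := hc
    have h := congrArg (aeval t) hpq
    simp only [map_add, map_mul, map_one] at h
    have hi : algebraMap k B 2⁻¹ * 2 = 1 := by
      rw [← map_ofNat (algebraMap k B) 2, ← map_mul, inv_mul_cancel₀ h2, map_one]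
    refine ⟨aeval t p * y * algebraMap k B 2⁻¹, -aeval t q, ?_⟩
    simp only [map_zero, map_zero] at hy ⊢
    linear_combination h + aeval t p * y ^ 2 * hi + aeval t p * hy
  no_root {L} _ _ r hr := by
    rw [Polynomial.map_zero, zero_mul, add_zero] at hr
    have hs : (c.map (algebraMap k L)).Separable := hc.map
    have hu : IsUnit r := hs.squarefree r (by rw [← hr, sq])
    have hu' := hu.pow 2
    rw [hr] at hu'
    have := natDegree_eq_zero_of_isUnit hu'
    rw [natDegree_map] at this
    omega

theorem isSmoothQuadratic_one (h2 : (2 : k) = 0) {c : k[X]} (hc : Odd c.natDegree) :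
    IsSmoothQuadratic (C 1) c where
  jacobian {B} _ _ t y _ := by
    have h2' : (2 : B) = 0 := by rw [← map_ofNat (algebraMap k B) 2, h2, map_zero]
    exact ⟨1, 0, by simp [h2']⟩
  no_root {L} _ _ r hr := by
    rw [Polynomial.map_C, map_one, C_1, one_mul] at hr
    have h := congrArg natDegree hr
    rw [natDegree_map] at h
    rcases Nat.eq_zero_or_pos r.natDegree with h0 | h0
    · have h1 : (r ^ 2 + r).natDegree ≤ 0 := by
        refine natDegree_add_le_of_degree_le (natDegree_pow_le.trans ?_) h0.le
        rw [h0]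
      obtain ⟨m, hm⟩ := hc
      omega
    · rw [natDegree_add_eq_left_of_natDegree_lt, natDegree_pow] at h
      · rw [← h] at hc
        exact Nat.not_odd_iff_even.2 (even_two_mul _) hc
      · rw [natDegree_pow]
        omega

theorem isSmoothQuadratic_X_pow (h2 : (2 : k) = 0) (n : ℕ) (α : k) :
    IsSmoothQuadratic (C 1 * X ^ (n + 2)) (X + C α * X ^ (2 * (n + 2))) where
  jacobian {B} _ _ t y _ := by
    have h2' : (2 : B) = 0 := by rw [← map_ofNat (algebraMap k B) 2, h2, map_zero]
    refine ⟨((n : B) + 2) ^ 2 * t ^ n * y ^ 2, -(((n : B) + 2) * t ^ (n + 1) * y + 1), ?_⟩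
    have hd : derivative (X ^ (2 * (n + 2)) : k[X]) = 0 := by
      rw [derivative_X_pow, Nat.cast_mul, Nat.cast_ofNat, h2, zero_mul, C_0, zero_mul]
    simp [hd]
    linear_combination (((n : B) + 2) ^ 2 * t ^ n * y ^ 3) * h2'
  no_root {L} _ _ r hr := by
    have h0 := congrArg (eval 0) hr
    simp at h0
    obtain ⟨s, rfl⟩ := X_dvd_iff.2 ((coeff_zero_eq_eval_zero r).trans h0)
    have h1 := congrArg (fun p => coeff p 1) hr
    simp [mul_pow, coeff_X_pow_mul'] at h1
    rw [if_neg (by omega)] at h1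
    simp at h1

end SmoothQuadratic

section Roots

variable {Ω : Type u} [Field Ω] [IsSepClosed Ω]

theorem exists_mul_eq_sq_add_mul_sub {b c : Ω} (h : (2 : Ω) ≠ 0 ∨ b ≠ 0 ∨ c = 0) :
    ∃ β₁ β₂ : Ω, β₁ + β₂ = - b ∧ β₁ * β₂ = - c := by
  suffices ∃ β : Ω, β ^ 2 + b * β = c by
    obtain ⟨β, hβ⟩ := this
    exact ⟨β, - b - β, by ring, by linear_combination -hβ⟩
  rcases eq_or_ne (2 : Ω) 0 with h2 | h2
  · rcases eq_or_ne b 0 with hb | hb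
    · exact ⟨0, by simp_all⟩
    · open Polynomial in
      obtain ⟨β, hβ⟩ := IsSepClosed.exists_root (X ^ 2 + (C b * X + C (-c)) : Polynomial Ω) (by
          rw [degree_add_eq_left_of_degree_lt] <;> rw [degree_X_pow]
          · decide
          · exact degree_linear_lt (b := b) (c := c)) (by
          rw [separable_def']
          refine ⟨0, C b⁻¹, ?_⟩
          have : (2 : Polynomial Ω) = 0 := by rw [← C_ofNat, h2, C_0]
          rw [derivative_add, derivative_X_pow, Nat.cast_ofNat, C_ofNat, this]
          simp [← C_mul, hb])
      refine ⟨β, ?_⟩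
      simp at hβ
      linear_combination hβ
  · have : NeZero ((2 : ℕ) : Ω) := ⟨by exact_mod_cast h2⟩
    obtain ⟨z, hz⟩ := IsSepClosed.exists_pow_nat_eq (b ^ 2 + 4 * c) 2
    refine ⟨(z - b) / 2, ?_⟩
    field_simp
    linear_combination hz

end Roots

section Residue

variable {k K : Type u} [Field k] [Field K] [Algebra k K]

theorem add_mem_nonunits {V : ValuationSubring K} {x y : K} (hx : x ∈ V.nonunits)
    (hy : y ∈ V.nonunits) : x + y ∈ V.nonunits :=
  V.valuation.map_add_lt hx hy

theorem mul_mem_nonunits {V : ValuationSubring K} {x y : K} (hx : x ∈ V)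
    (hy : y ∈ V.nonunits) : x * y ∈ V.nonunits := by
  rw [ValuationSubring.mem_nonunits_iff, map_mul]
  exact (mul_le_of_le_one_left' ((V.valuation_le_one_iff x).2 hx)).trans_lt hy

theorem mem_of_sub_mem_nonunits {V : ValuationSubring K} {x y : K} (h : x - y ∈ V.nonunits)
    (hy : y ∈ V) : x ∈ V := by
  have := add_mem (V.nonunits_subset h) hy
  rwa [sub_add_cancel] at this

theorem exists_sub_mem_nonunits_of_mem_adjoin (V : ValuationSubring K)
    (hk : ∀ c : k, algebraMap k K c ∈ V) {s : Set K}
    (hs : ∀ z ∈ s, ∃ c : k, z - algebraMap k K c ∈ V.nonunits) {z : K}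
    (hz : z ∈ Algebra.adjoin k s) : ∃ c : k, z - algebraMap k K c ∈ V.nonunits := by
  induction hz using Algebra.adjoin_induction with
  | mem z hz => exact hs z hz
  | algebraMap c => exact ⟨c, by simp⟩
  | add z z' _ _ h h' =>
    obtain ⟨c, hc⟩ := h
    obtain ⟨c', hc'⟩ := h'
    exact ⟨c + c', by simpa only [map_add, add_sub_add_comm] using add_mem_nonunits hc hc'⟩
  | mul z z' _ _ h h' =>
    obtain ⟨c, hc⟩ := h
    obtain ⟨c', hc'⟩ := h'
    refine ⟨c * c', ?_⟩
    have := add_mem_nonunits (mul_mem_nonunits (mem_of_sub_mem_nonunits hc (hk c)) hc')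
      (mul_mem_nonunits (hk c') hc)
    convert this using 1
    rw [map_mul]
    ring

end Residue

end BirationalSection

namespace BirationalSection

section Reciprocal

open Polynomial

variable {k : Type u} [Field k]

/-- The equations `y² + b(t) y = c(t)` and `w² + b'(u) w = c'(u)` are both smooth and correspond
to each other under `u = 1 / t` and `w = y / t ^ (n + 2)`. -/
structure IsReciprocalPair (n : ℕ) (b c b' c' : k[X]) : Prop where
  smooth : IsSmoothQuadratic b c
  smooth' : IsSmoothQuadratic b' c'
  aeval_b : ∀ {L : Type u} [Field L] [Algebra k L] (t : L), t ≠ 0 →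
    aeval t⁻¹ b' = t⁻¹ ^ (n + 2) * aeval t b
  aeval_c : ∀ {L : Type u} [Field L] [Algebra k L] (t : L), t ≠ 0 →
    aeval t⁻¹ c' = t⁻¹ ^ (2 * (n + 2)) * aeval t c
  discrim_ne_zero : b ^ 2 + 4 * c ≠ 0
  separable : ∀ x : k, (2 : k) ≠ 0 ∨ b.eval x ≠ 0 ∨ c.eval x = 0
  separable' : ∀ x : k, (2 : k) ≠ 0 ∨ b'.eval x ≠ 0 ∨ c'.eval x = 0

namespace IsReciprocalPair

variable {n : ℕ} {b c b' c' : k[X]} {L : Type u} [Field L] [Algebra k L] {t y : L}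

theorem inv_eq (h : IsReciprocalPair n b c b' c') (ht : t ≠ 0)
    (hy : y ^ 2 + aeval t b * y = aeval t c) :
    (y * t⁻¹ ^ (n + 2)) ^ 2 + aeval t⁻¹ b' * (y * t⁻¹ ^ (n + 2)) = aeval t⁻¹ c' := by
  rw [h.aeval_b t ht, h.aeval_c t ht, ← hy]
  ring

theorem two_mul_add_ne_zero (h : IsReciprocalPair n b c b' c') (ht : Transcendental k t)
    (hy : y ^ 2 + aeval t b * y = aeval t c) : 2 * y + aeval t b ≠ 0 := by
  intro h0
  apply h.discrim_ne_zero
  refine transcendental_iff_injective.1 ht ?_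
  rw [map_add, map_mul, map_pow, ← hy, map_zero, map_ofNat]
  linear_combination (2 * y + aeval t b) * h0

end IsReciprocalPair

variable (k) in
theorem exists_separable_reciprocal (n : ℕ) :
    ∃ c c' : k[X], c.Separable ∧ c'.Separable ∧ 1 ≤ c.natDegree ∧ 1 ≤ c'.natDegree ∧
      ∀ {L : Type u} [Field L] [Algebra k L] (t : L), t ≠ 0 →
        aeval t⁻¹ c' = t⁻¹ ^ (2 * (n + 2)) * aeval t c := by
  have hdeg (N : ℕ) (hN : 2 ≤ N) : 1 ≤ (X - X ^ N : k[X]).natDegree := by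
    rw [natDegree_sub_eq_right_of_natDegree_lt] <;> rw [natDegree_X_pow]
    · omega
    · rw [natDegree_X]
      omega
  by_cases h : ((2 * n + 3 : ℕ) : k) = 0
  · have hs : (X - X ^ (2 * n + 3) : k[X]).Separable :=
      separable_X_sub_X_pow (by omega) (by rw [h]; simp)
    refine ⟨X - X ^ (2 * n + 3), C (-1) * (X - X ^ (2 * n + 3)), hs,
      separable_C_mul (by simp) hs, hdeg _ (by omega), ?_, ?_⟩
    · rw [natDegree_C_mul (by simp)]
      exact hdeg _ (by omega)
    · intro L _ _ t ht
      simp only [map_sub, map_mul, map_neg, map_one, aeval_X, map_pow]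
      have hu : t⁻¹ * t = 1 := inv_mul_cancel₀ ht
      have hm : t⁻¹ ^ (2 * n + 3) * t ^ (2 * n + 3) = 1 := by rw [← mul_pow, hu, one_pow]
      linear_combination -(t⁻¹ ^ (2 * n + 3)) * hu + t⁻¹ * hm
  · refine ⟨X ^ (2 * n + 3) - C 1, X - X ^ (2 * n + 4),
      separable_X_pow_sub_C 1 h one_ne_zero, separable_X_sub_X_pow (by omega) ?_, ?_,
      hdeg _ (by omega), ?_⟩
    · intro h0
      apply h
      push_cast at h0 ⊢
      linear_combination h0
    · rw [natDegree_X_pow_sub_C]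
      omega
    · intro L _ _ t ht
      simp only [map_sub, map_one, aeval_X, map_pow]
      have hm : t⁻¹ ^ (2 * n + 3) * t ^ (2 * n + 3) = 1 := by rw [← mul_pow, inv_mul_cancel₀ ht, one_pow]
      linear_combination -t⁻¹ * hm

theorem isReciprocalPair_zero (h2 : (2 : k) ≠ 0) {n : ℕ} {c c' : k[X]} (hc : c.Separable)
    (hc' : c'.Separable) (hd : 1 ≤ c.natDegree) (hd' : 1 ≤ c'.natDegree)
    (h : ∀ {L : Type u} [Field L] [Algebra k L] (t : L), t ≠ 0 →
        aeval t⁻¹ c' = t⁻¹ ^ (2 * (n + 2)) * aeval t c) :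
    IsReciprocalPair n 0 c 0 c' where
  smooth := isSmoothQuadratic_zero h2 hc hd
  smooth' := isSmoothQuadratic_zero h2 hc' hd'
  aeval_b t _ := by simp
  aeval_c := h
  discrim_ne_zero := by
    have h4 : (4 : k[X]) ≠ 0 := by
      rw [← C_ofNat 4, Ne, C_eq_zero, show (4 : k) = 2 * 2 by norm_num]
      exact mul_ne_zero h2 h2
    have hc0 : c ≠ 0 := by
      rintro rfl
      simp at hd
    simpa using ⟨h4, hc0⟩
  separable _ := Or.inl h2
  separable' _ := Or.inl h2

theorem isReciprocalPair_one (h2 : (2 : k) = 0) (n : ℕ) (α : k) :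
    IsReciprocalPair n (C 1) (X ^ (2 * n + 3) + C α) (C 1 * X ^ (n + 2))
      (X + C α * X ^ (2 * (n + 2))) where
  smooth := isSmoothQuadratic_one h2 (by
    rw [natDegree_X_pow_add_C]
    exact ⟨n + 1, by omega⟩)
  smooth' := isSmoothQuadratic_X_pow h2 n α
  aeval_b t _ := by simp
  aeval_c t ht := by
    simp only [map_add, map_mul, aeval_C, aeval_X, map_pow]
    have hm : t⁻¹ ^ (2 * n + 3) * t ^ (2 * n + 3) = 1 := by
      rw [← mul_pow, inv_mul_cancel₀ ht, one_pow]
    linear_combination -t⁻¹ * hm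
  discrim_ne_zero := by
    have h4 : (4 : k[X]) = 0 := by
      rw [← C_ofNat 4, C_eq_zero, show (4 : k) = 2 * 2 by norm_num, h2, zero_mul]
    simp [h4]
  separable _ := by simp
  separable' x := by
    rcases eq_or_ne x 0 with rfl | hx
    · simp
    · simp [hx]

variable {K Ω : Type u} [Field K] [Field Ω] [Algebra k K] [Algebra K Ω] [Algebra k Ω]
  [IsScalarTower k K Ω]

/-- Every section fixes the function field of a quadratic cover of the line of genus `n + 1`. -/
theorem exists_fixed_root [IsSepClosed Ω] [Algebra.IsIntegral K Ω]
    [IsGalois k (algebraicClosure k Ω)]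
    {s : (algebraicClosure k Ω ≃ₐ[k] algebraicClosure k Ω) →* (Ω ≃ₐ[K] Ω)}
    (hs : IsGaloisSection k K Ω s) (t : K) (n : ℕ) :
    ∃ b c b' c' : k[X], IsReciprocalPair n b c b' c' ∧ ∃ y : Ω,
      y ^ 2 + aeval (algebraMap K Ω t) b * y = aeval (algebraMap K Ω t) c ∧
      ∀ τ, s τ y = y := by
  by_cases h2 : (2 : k) = 0
  · obtain ⟨α, y, hy, hfix⟩ := exists_fixed_artinSchreier h2 hs (t ^ (2 * n + 3))
    exact ⟨_, _, _, _, isReciprocalPair_one h2 n α, y, by simpa using hy, hfix⟩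
  · obtain ⟨c, c', hc, hc', hd, hd', h⟩ := exists_separable_reciprocal k n
    obtain ⟨α, hα, y, hy, hfix⟩ := exists_fixed_sqrt h2 hs (aeval t c)
    refine ⟨0, C α * c, 0, C α * c', isReciprocalPair_zero h2 (separable_C_mul hα hc)
      (separable_C_mul hα hc') (by rwa [natDegree_C_mul hα]) (by rwa [natDegree_C_mul hα]) ?_,
      y, ?_, hfix⟩
    · intro L _ _ t ht
      rw [map_mul, map_mul, h t ht, aeval_C, aeval_C]
      ring
    · rw [map_zero, zero_mul, add_zero, map_mul, aeval_C, aeval_algebraMap_apply, hy]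

end Reciprocal

section FractionRing

open IntermediateField

variable {k K Ω : Type u} [Field k] [Field K] [Field Ω] [Algebra k K] [Algebra K Ω] [Algebra k Ω]
  [IsScalarTower k K Ω]

theorem isFractionRing_adjoin_pair {t : K} [IsFractionRing (Algebra.adjoin k {t}) K] (y : Ω) :
    IsFractionRing (Algebra.adjoin k {algebraMap K K⟮y⟯ t, AdjoinSimple.gen K y}) K⟮y⟯ := by
  set S := Algebra.adjoin k {algebraMap K K⟮y⟯ t, AdjoinSimple.gen K y} with hS
  have ht : algebraMap K K⟮y⟯ t ∈ S := Algebra.subset_adjoin (by simp)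
  have hle : ∀ a ∈ Algebra.adjoin k {t}, algebraMap K K⟮y⟯ a ∈ S := by
    intro a ha
    have : Algebra.adjoin k {t} ≤ S.comap (IsScalarTower.toAlgHom k K K⟮y⟯) :=
      Algebra.adjoin_le (by simpa using ht)
    exact this ha
  have key : ∀ z : K⟮y⟯, ∃ a ∈ S, ∃ b ∈ S, z = a / b := by
    rintro ⟨z, hz⟩
    induction hz using adjoin_induction with
    | mem z hz =>
      rw [Set.mem_singleton_iff] at hz
      subst hz
      exact ⟨AdjoinSimple.gen K z, Algebra.subset_adjoin (by simp), 1, one_mem _, (div_one _).symm⟩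
    | algebraMap z =>
      obtain ⟨a, b, -, rfl⟩ := IsFractionRing.div_surjective (A := Algebra.adjoin k {t}) z
      exact ⟨_, hle a a.2, _, hle b b.2, map_div₀ (algebraMap K K⟮y⟯) (a : K) (b : K)⟩
    | add x z _ _ hx hz =>
      obtain ⟨a, ha, b, hb, hx⟩ := hx
      obtain ⟨a', ha', b', hb', hz⟩ := hz
      refine Exists.imp (fun _ => And.imp_right (Exists.imp fun _ => And.imp_right
        (congr($hx + $hz)).trans)) ?_
      rcases eq_or_ne b 0 with rfl | h0
      · exact ⟨a', ha', b', hb', by simp⟩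
      rcases eq_or_ne b' 0 with rfl | h0'
      · exact ⟨a, ha, b, hb, by simp⟩
      exact ⟨_, add_mem (mul_mem ha hb') (mul_mem hb ha'), _, mul_mem hb hb', div_add_div _ _ h0 h0'⟩
    | inv x _ hx =>
      obtain ⟨a, ha, b, hb, hx⟩ := hx
      exact ⟨b, hb, a, ha, congr($hx⁻¹).trans (inv_div a b)⟩
    | mul x z _ _ hx hz =>
      obtain ⟨a, ha, b, hb, hx⟩ := hx
      obtain ⟨a', ha', b', hb', hz⟩ := hz
      exact ⟨_, mul_mem ha ha', _, mul_mem hb hb',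
        (congr($hx * $hz)).trans (div_mul_div_comm _ _ _ _)⟩
  refine IsFractionRing.of_field _ _ fun z => ?_
  obtain ⟨a, ha, b, hb, h⟩ := key z
  exact ⟨⟨a, ha⟩, ⟨b, hb⟩, h⟩

end FractionRing

end BirationalSection

namespace BirationalSection

theorem isFractionRing_adjoin_iff {k M : Type u} [Field k] [Field M] [Algebra k M] {s : Set M} :
    IsFractionRing (Algebra.adjoin k s) M ↔ IntermediateField.adjoin k s = ⊤ := by
  constructor
  · intro h
    refine eq_top_iff.2 fun z _ => ?_
    obtain ⟨a, b, -, rfl⟩ := IsFractionRing.div_surjective (A := Algebra.adjoin k s) z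
    exact (IntermediateField.mem_adjoin_iff_div).2 ⟨a, a.2, b, b.2, rfl⟩
  · intro h
    refine IsFractionRing.of_field _ _ fun z => ?_
    have hz : z ∈ IntermediateField.adjoin k s := h ▸ IntermediateField.mem_top
    obtain ⟨a, ha, b, hb, e⟩ := (IntermediateField.mem_adjoin_iff_div).1 hz
    exact ⟨⟨a, ha⟩, ⟨b, hb⟩, e⟩

theorem isFractionRing_adjoin_inv_pair {k M : Type u} [Field k] [Field M] [Algebra k M] {t y : M}
    (ht : t ≠ 0) (n : ℕ) [h : IsFractionRing (Algebra.adjoin k {t, y}) M] :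
    IsFractionRing (Algebra.adjoin k {t⁻¹, y * t⁻¹ ^ n}) M := by
  rw [isFractionRing_adjoin_iff] at h ⊢
  rw [eq_top_iff, ← h, IntermediateField.adjoin_le_iff]
  have h1 : t⁻¹ ∈ IntermediateField.adjoin k {t⁻¹, y * t⁻¹ ^ n} :=
    IntermediateField.subset_adjoin _ _ (by simp)
  have h2 : y * t⁻¹ ^ n ∈ IntermediateField.adjoin k {t⁻¹, y * t⁻¹ ^ n} :=
    IntermediateField.subset_adjoin _ _ (by simp)
  have h3 : t ∈ IntermediateField.adjoin k {t⁻¹, y * t⁻¹ ^ n} := by simpa using inv_mem h1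
  rintro _ (rfl | rfl)
  · exact h3
  · have := mul_mem h2 (pow_mem h3 n)
    rwa [mul_assoc, ← mul_pow, inv_mul_cancel₀ ht, one_pow, mul_one] at this

section Cover

open Polynomial

variable {k : Type u} [Field k] {X : Scheme.{u}} [AlgebraicGeometry.IsIntegral X]
  (f : X ⟶ Spec (.of k)) {M : Type u} [Field M] [Algebra X.functionField M]

theorem isAffineWithSections_preimage :
    letI := functionFieldAlgebra f
    ∀ [Algebra k M] [IsScalarTower k X.functionField M]
      {Y : Scheme.{u}} [AlgebraicGeometry.IsIntegral Y] (π : Y ⟶ X) (e : Y.functionField ≃+* M)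
      (_ : ∀ c, e (constantsHom (π ≫ f) c) = algebraMap k M c)
      {U : X.Opens} {t : X.functionField} {y : M} {b c : k[X]}
      (_ : IsAffineWithSections U (Algebra.adjoin k {t}).toSubring)
      (_ : IsAffineOpen (π ⁻¹ᵁ U)) (_ : Nonempty (π ⁻¹ᵁ U))
      (_ : ∀ [Nonempty U] z, z ∈ (Y.germToFunctionField (π ⁻¹ᵁ U)).hom.range ↔
        ((algebraMap X.functionField M).comp (X.germToFunctionField U).hom).IsIntegralElem (e z))
      (_ : IsSmoothQuadratic b c) (_ : Transcendental k t)
      (_ : y ^ 2 + aeval (algebraMap X.functionField M t) b * y =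
        aeval (algebraMap X.functionField M t) c)
      [IsFractionRing (Algebra.adjoin k {algebraMap X.functionField M t, y}) M],
      letI := functionFieldAlgebra (π ≫ f)
      IsAffineWithSections (π ⁻¹ᵁ U)
        (Algebra.adjoin k {e.symm (algebraMap X.functionField M t), e.symm y}).toSubring := by
  let := functionFieldAlgebra f
  intro _ _ Y _ π e he U t y b c hU hV hne hsec h ht hy _
  let := functionFieldAlgebra (π ≫ f)
  have := hU.nonempty
  have htM : Transcendental k (algebraMap X.functionField M t) :=
    (transcendental_algebraMap_iff (algebraMap X.functionField M).injective).2 ht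
  let e' : Y.functionField ≃ₐ[k] M := AlgEquiv.ofRingEquiv (f := e) he
  refine ⟨hV, hne, Subring.ext fun z => ?_⟩
  have h1 : (X.germToFunctionField U).hom.range = (aeval t : k[X] →ₐ[k] _).toRingHom.range := by
    rw [hU.range_eq, Algebra.adjoin_singleton_eq_range_aeval]
    rfl
  have h2 : (algebraMap X.functionField M).comp (aeval t : k[X] →ₐ[k] _).toRingHom =
      (aeval (algebraMap X.functionField M t) : k[X] →ₐ[k] M).toRingHom :=
    RingHom.ext fun p => (aeval_algebraMap_apply M t p).symm
  refine (hsec z).trans ((isIntegralElem_comp_iff_of_range_eq _ h1 _).trans ?_)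
  rw [h2, ← mem_adjoin_iff_isIntegralElem h htM hy]
  have h3 := AlgHom.map_adjoin e'.toAlgHom
    {e.symm (algebraMap X.functionField M t), e.symm y}
  have h4 : e'.toAlgHom '' {e.symm (algebraMap X.functionField M t), e.symm y} =
      {algebraMap X.functionField M t, y} := by
    rw [Set.image_pair]
    congr 1
    · exact e.apply_symm_apply _
    · exact congrArg _ (e.apply_symm_apply _)
  rw [h4] at h3
  rw [← h3]
  constructor
  · rintro ⟨z', hz', e2⟩
    rwa [← e.injective e2]
  · exact fun hz => ⟨z, hz, rfl⟩

end Cover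

section Properties

open Polynomial

variable {k : Type u} [Field k] {Y : Scheme.{u}} [AlgebraicGeometry.IsIntegral Y]
  (f : Y ⟶ Spec (.of k))

/-- A curve with an affine cover by two charts `y² + b(t) y = c(t)` and `w² + b'(u) w = c'(u)`, where
`u = 1 / t` and `w = y / t ^ (n + 2)`. -/
structure IsQuadraticCover (n : ℕ) (b c b' c' : k[X]) (t y : Y.functionField)
    (V₁ V₂ : Y.Opens) : Prop where
  pair : IsReciprocalPair n b c b' c'
  transcendental : letI := functionFieldAlgebra f; Transcendental k t
  equation : letI := functionFieldAlgebra f; y ^ 2 + aeval t b * y = aeval t c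
  sections₁ : letI := functionFieldAlgebra f
    IsAffineWithSections V₁ (Algebra.adjoin k {t, y}).toSubring
  sections₂ : letI := functionFieldAlgebra f
    IsAffineWithSections V₂ (Algebra.adjoin k {t⁻¹, y * t⁻¹ ^ (n + 2)}).toSubring
  sup_eq_top : V₁ ⊔ V₂ = ⊤

namespace IsQuadraticCover

variable {f} {n : ℕ} {b c b' c' : k[X]} {t y : Y.functionField} {V₁ V₂ : Y.Opens}

theorem ne_zero (h : IsQuadraticCover f n b c b' c' t y V₁ V₂) : t ≠ 0 := by
  rintro rfl
  let := functionFieldAlgebra f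
  exact h.transcendental isAlgebraic_zero

theorem transcendental_inv (h : IsQuadraticCover f n b c b' c' t y V₁ V₂) :
    letI := functionFieldAlgebra f; Transcendental k t⁻¹ := by
  let := functionFieldAlgebra f
  exact fun hu => h.transcendental (by simpa using hu.inv)

theorem genus_eq (h : IsQuadraticCover f n b c b' c' t y V₁ V₂) : genus f = n + 1 :=
  let := functionFieldAlgebra f
  genus_eq_of_sections f h.sup_eq_top n h.pair.smooth h.pair.smooth' h.transcendental h.equation
    (h.pair.inv_eq h.ne_zero h.equation) (h.pair.aeval_b t h.ne_zero)
    (h.pair.two_mul_add_ne_zero h.transcendental h.equation) h.sections₁ h.sections₂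

theorem smoothOfRelativeDimension (h : IsQuadraticCover f n b c b' c' t y V₁ V₂) :
    SmoothOfRelativeDimension 1 f :=
  let := functionFieldAlgebra f
  have := h.sections₁.isFractionRing
  have := h.sections₂.isFractionRing
  smoothOfRelativeDimension_of_sections f 1 h.sup_eq_top h.sections₁ h.sections₂
    (locally_isStandardSmooth_adjoin h.pair.smooth h.transcendental h.equation)
    (locally_isStandardSmooth_adjoin h.pair.smooth' h.transcendental_inv
      (h.pair.inv_eq h.ne_zero h.equation))

theorem geometricallyConnected (h : IsQuadraticCover f n b c b' c' t y V₁ V₂) :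
    GeometricallyConnected f :=
  let := functionFieldAlgebra f
  geometricallyConnected_of_sections f h.sup_eq_top h.sections₁ h.sections₂
    (fun F _ _ => isDomain_tensorProduct_adjoin h.pair.smooth h.transcendental h.equation F)
    (fun F _ _ => isDomain_tensorProduct_adjoin h.pair.smooth' h.transcendental_inv
      (h.pair.inv_eq h.ne_zero h.equation) F)

theorem isProper (h : IsQuadraticCover f n b c b' c' t y V₁ V₂) [IsSeparated f]
    [UniversallyClosed f] : IsProper f := by
  have := h.smoothOfRelativeDimension
  have : Smooth f := SmoothOfRelativeDimension.smooth 1 f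
  have : QuasiCompact f := inferInstance
  exact { }

end IsQuadraticCover

/-- The quadratic cover of the projective line with a given function field. -/
theorem exists_isQuadraticCover {X : Scheme.{u}} [AlgebraicGeometry.IsIntegral X]
    (f : X ⟶ Spec (.of k)) [IsProper f] {U₁ U₂ : X.Opens} (hcov : U₁ ⊔ U₂ = ⊤)
    {M : Type u} [Field M] [Algebra X.functionField M] [Algebra.IsAlgebraic X.functionField M] :
    letI := functionFieldAlgebra f
    ∀ [Algebra k M] [IsScalarTower k X.functionField M] {t : X.functionField} {y : M} {n : ℕ}
      {b c b' c' : k[X]} (_ : IsReciprocalPair n b c b' c') (_ : Transcendental k t)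
      (_ : IsAffineWithSections U₁ (Algebra.adjoin k {t}).toSubring)
      (_ : IsAffineWithSections U₂ (Algebra.adjoin k {t⁻¹}).toSubring)
      (_ : y ^ 2 + aeval (algebraMap X.functionField M t) b * y =
        aeval (algebraMap X.functionField M t) c)
      [IsFractionRing (Algebra.adjoin k {algebraMap X.functionField M t, y}) M],
      ∃ (Y : Scheme.{u}) (_ : AlgebraicGeometry.IsIntegral Y) (g : Y ⟶ Spec (.of k))
        (_ : IsProper g) (e : Y.functionField ≃+* M) (V₁ V₂ : Y.Opens),
        (∀ c, e (constantsHom g c) = algebraMap k M c) ∧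
        IsQuadraticCover g n b c b' c' (e.symm (algebraMap X.functionField M t)) (e.symm y)
          V₁ V₂ := by
  let := functionFieldAlgebra f
  intro _ _ t y n b c b' c' hp ht hU₁ hU₂ hy _
  obtain ⟨Y, _, π, _, e, he, hsec⟩ := exists_normalization M f
  have ht0 : t ≠ 0 := by
    rintro rfl
    exact ht isAlgebraic_zero
  have htM : Transcendental k (algebraMap X.functionField M t) :=
    (transcendental_algebraMap_iff (algebraMap X.functionField M).injective).2 ht
  have htM0 : algebraMap X.functionField M t ≠ 0 := (_root_.map_ne_zero _).2 ht0
  have he' (c) : e (constantsHom (π ≫ f) c) = algebraMap k M c :=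
    (he c).trans (IsScalarTower.algebraMap_apply k X.functionField M c).symm
  let := functionFieldAlgebra (π ≫ f)
  let e' : Y.functionField ≃ₐ[k] M := AlgEquiv.ofRingEquiv (f := e) he'
  have := hU₁.nonempty
  have := hU₂.nonempty
  obtain ⟨hV₁, hne₁, hsec₁⟩ := hsec U₁ hU₁.isAffineOpen
  obtain ⟨hV₂, hne₂, hsec₂⟩ := hsec U₂ hU₂.isAffineOpen
  have hinv : algebraMap X.functionField M t⁻¹ = (algebraMap X.functionField M t)⁻¹ := map_inv₀ _ _
  have hF := isFractionRing_adjoin_inv_pair (k := k) (y := y) htM0 (n + 2)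
  rw [← hinv] at hF
  have hw := hp.inv_eq htM0 hy
  rw [← hinv] at hw
  have hs₁ := isAffineWithSections_preimage f π e he' hU₁ hV₁ hne₁ hsec₁ hp.smooth ht hy
  have hs₂ := isAffineWithSections_preimage f π e he' hU₂ hV₂ hne₂ hsec₂ hp.smooth'
    (fun hu => ht (by simpa using hu.inv)) hw
  have hcover : IsQuadraticCover (π ≫ f) n b c b' c' (e.symm (algebraMap X.functionField M t))
      (e.symm y) (π ⁻¹ᵁ U₁) (π ⁻¹ᵁ U₂) := by
    refine ⟨hp, ?_, ?_, hs₁, ?_, ?_⟩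
    · intro halg
      exact htM (by simpa [e'] using halg.algHom e'.toAlgHom)
    · have := congrArg e'.symm hy
      rwa [map_add, map_mul, map_pow, ← aeval_algHom_apply, ← aeval_algHom_apply] at this
    · have h1 : e.symm (y * algebraMap X.functionField M t⁻¹ ^ (n + 2)) =
        e.symm y * (e.symm (algebraMap X.functionField M t))⁻¹ ^ (n + 2) := by
        rw [map_mul, map_pow, hinv, map_inv₀]
      rw [h1, hinv, map_inv₀] at hs₂
      exact hs₂
    · exact congrArg (π ⁻¹ᵁ ·) hcov
  exact ⟨Y, ‹_›, π ≫ f, hcover.isProper, e, _, _, he', hcover⟩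

end Properties

end BirationalSection

namespace BirationalSection

section Valuation

theorem mem_nonunits_iff_inv_notMem {K : Type*} [Field K] {V : ValuationSubring K} {z : K} :
    z ∈ V.nonunits ↔ z = 0 ∨ z⁻¹ ∉ V := by
  rcases eq_or_ne z 0 with rfl | hz
  · simp
  · rw [ValuationSubring.mem_nonunits_iff, ← ValuationSubring.valuation_le_one_iff, map_inv₀, not_le,
      one_lt_inv₀ (zero_lt_iff.2 ((_root_.map_ne_zero _).2 hz))]
    simp [hz]

theorem mem_nonunits_comap_iff {K L : Type*} [Field K] [Field L] {V : ValuationSubring L}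
    (φ : K →+* L) {z : K} : z ∈ (V.comap φ).nonunits ↔ φ z ∈ V.nonunits := by
  rw [mem_nonunits_iff_inv_notMem, mem_nonunits_iff_inv_notMem, map_eq_zero,
    ValuationSubring.mem_comap, map_inv₀]

open Polynomial

variable {k K Ω : Type u} [Field k] [Field K] [Field Ω] [Algebra k K] [Algebra K Ω] [Algebra k Ω]
  [IsScalarTower k K Ω]

theorem aeval_sub_eval_mem_nonunits {W : ValuationSubring K}
    (hkW : ∀ c : k, algebraMap k K c ∈ W) {t : K} {x : k} (ht : t - algebraMap k K x ∈ W.nonunits)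
    (p : k[X]) : aeval t p - algebraMap k K (p.eval x) ∈ W.nonunits := by
  obtain ⟨q, hq⟩ := X_sub_C_dvd_sub_C_eval (a := x) (p := p)
  have h := congrArg (aeval t) hq
  rw [map_sub, map_mul, map_sub, aeval_X, aeval_C, aeval_C, mul_comm] at h
  rw [h]
  refine mul_mem_nonunits ?_ ht
  have htW := mem_of_sub_mem_nonunits ht (hkW x)
  have : Algebra.adjoin k {t} ≤
      { W.toSubring with algebraMap_mem' := hkW : Subalgebra k K } :=
    Algebra.adjoin_le (by simpa using htW)
  exact this (aeval_mem_adjoin_singleton k t)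

theorem exists_root_sub_mem_nonunits [IsSepClosed Ω] [IsGalois k (algebraicClosure k Ω)]
    {s : (algebraicClosure k Ω ≃ₐ[k] algebraicClosure k Ω) →* (Ω ≃ₐ[K] Ω)}
    (hs : IsGaloisSection k K Ω s) {W : ValuationSubring Ω}
    (hkW : ∀ c : k, algebraMap k Ω c ∈ W) (hW : ∀ τ, ∀ x ∈ W, s τ x ∈ W)
    {t y : Ω} {b c : k[X]} (hsep : ∀ x : k, (2 : k) ≠ 0 ∨ b.eval x ≠ 0 ∨ c.eval x = 0)
    (hy : y ^ 2 + aeval t b * y = aeval t c) (hfix : ∀ τ, s τ y = y) {x : k}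
    (ht : t - algebraMap k Ω x ∈ W.nonunits) :
    ∃ z : k, y - algebraMap k Ω z ∈ W.nonunits := by
  have hb := aeval_sub_eval_mem_nonunits hkW ht b
  have hc := aeval_sub_eval_mem_nonunits hkW ht c
  obtain ⟨β₁, β₂, hadd, hmul⟩ := exists_mul_eq_sq_add_mul_sub
    (b := algebraMap k Ω (b.eval x)) (c := algebraMap k Ω (c.eval x)) (by
      rcases hsep x with h | h | h
      · left
        rw [← map_ofNat (algebraMap k Ω) 2]
        exact (_root_.map_ne_zero _).2 h
      · exact Or.inr (Or.inl ((_root_.map_ne_zero _).2 h))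
      · exact Or.inr (Or.inr (by rw [h, map_zero])))
  have halg (β : Ω) (hβ : β ^ 2 + algebraMap k Ω (b.eval x) * β = algebraMap k Ω (c.eval x)) :
      IsAlgebraic k β := by
    refine ⟨quadPoly (b.eval x) (c.eval x), (monic_quadPoly _ _).ne_zero, ?_⟩
    rw [quadPoly]
    simp [hβ]
  have hyW : y ∈ W := by
    rcases W.mem_or_inv_mem y with h | h
    · exact h
    rcases eq_or_ne y 0 with rfl | h0
    · exact zero_mem _
    have hbW := mem_of_sub_mem_nonunits hb (hkW _)
    have hcW := mem_of_sub_mem_nonunits hc (hkW _)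
    convert sub_mem (mul_mem hcW h) hbW using 1
    field_simp
    linear_combination hy
  refine exists_sub_mem_nonunits hs hkW hW hfix (halg β₁ ?_) (halg β₂ ?_) ?_
  · linear_combination β₁ * hadd - hmul
  · linear_combination β₂ * hadd - hmul
  · have h := add_mem_nonunits (mul_mem_nonunits (neg_mem hyW) hb) hc
    convert h using 1
    linear_combination hy - y * hadd + hmul

end Valuation

section RationalPoint

variable {k : Type u} [Field k] {X : Scheme.{u}} [AlgebraicGeometry.IsIntegral X]
  (f : X ⟶ Spec (.of k))

theorem IsAffineWithSections.exists_rationalPoint {U : X.Opens} :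
    letI := functionFieldAlgebra f
    ∀ {s : Set X.functionField} (_ : IsAffineWithSections U (Algebra.adjoin k s).toSubring)
      [IsDedekindDomain (Algebra.adjoin k s)] (V : ValuationSubring X.functionField)
      (_ : ∀ c : k, algebraMap k X.functionField c ∈ V)
      (_ : ∀ z ∈ s, ∃ c : k, z - algebraMap k X.functionField c ∈ V.nonunits),
      ∃ x : RationalPoint f, localRing x.point = V.toSubring := by
  let := functionFieldAlgebra f
  intro s hU hD V hk hs
  have := hU.nonempty
  have : IsDedekindDomain (Algebra.adjoin k s).toSubring := hD
  refine exists_rationalPoint_of_valuationSubring hU.isAffineOpen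
    (fun x hx z => hU.mem_or_inv_mem hx z) V (fun a => ?_) hk
  refine exists_sub_mem_nonunits_of_mem_adjoin V hk hs ?_
  have : X.germToFunctionField U a ∈ (Algebra.adjoin k s).toSubring := hU.range_eq ▸ ⟨a, rfl⟩
  exact this

variable {f} in
theorem RationalPoint.exists_sub_mem_nonunits (x : RationalPoint f)
    {V : ValuationSubring X.functionField} (hV : V.toSubring = localRing x.point)
    {z : X.functionField} (hz : z ∈ V) : ∃ c : k, z - constantsHom f c ∈ V.nonunits := by
  have hmem (z) : z ∈ V ↔ z ∈ localRing x.point := by rw [← hV]; rfl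
  obtain ⟨c, hc⟩ := exists_sub_constantsHom x ((hmem z).1 hz)
  exact ⟨c, mem_nonunits_iff_inv_notMem.2 (by rwa [hmem])⟩

end RationalPoint

section Transfer

open Polynomial

variable {k : Type u} [Field k] {X : Scheme.{u}} [AlgebraicGeometry.IsIntegral X]
  (f : X ⟶ Spec (.of k)) [IsSeparated f] {U₁ U₂ : X.Opens} (hcov : U₁ ⊔ U₂ = ⊤)
  {Y : Scheme.{u}} [AlgebraicGeometry.IsIntegral Y] (g : Y ⟶ Spec (.of k))

include hcov in
theorem existsUnique_rationalPoint_of_isQuadraticCover (hY : BGASC g) :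
    letI := functionFieldAlgebra f
    letI := functionFieldAlgebra g
    ∀ [Algebra X.functionField Y.functionField]
      [IsScalarTower k X.functionField Y.functionField]
      {Ω : Type u} [Field Ω] [Algebra X.functionField Ω] [Algebra Y.functionField Ω] [Algebra k Ω]
      [IsScalarTower k X.functionField Ω] [IsScalarTower X.functionField Y.functionField Ω]
      [IsSepClosure X.functionField Ω]
      {t : X.functionField} {y : Y.functionField} {n : ℕ} {b c b' c' : k[X]} {V₁ V₂ : Y.Opens}
      (_ : Transcendental k t)
      (_ : IsAffineWithSections U₁ (Algebra.adjoin k {t}).toSubring)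
      (_ : IsAffineWithSections U₂ (Algebra.adjoin k {t⁻¹}).toSubring)
      (_ : IsQuadraticCover g n b c b' c' (algebraMap X.functionField Y.functionField t) y V₁ V₂)
      {s : (algebraicClosure k Ω ≃ₐ[k] algebraicClosure k Ω) →* (Ω ≃ₐ[X.functionField] Ω)}
      (_ : IsGaloisSection k X.functionField Ω s)
      (_ : ∀ τ (m : Y.functionField), s τ (algebraMap _ Ω m) = algebraMap _ Ω m),
      ∃! x : RationalPoint f, ∃ D ∈ decompositionGroups Ω (localRing x.point), s.range ≤ D := by
  let := functionFieldAlgebra f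
  let := functionFieldAlgebra g
  intro _ _ Ω _ _ _ _ _ _ _ t y n b c b' c' V₁ V₂ ht hU₁ hU₂ hc s hs hfix
  have : IsScalarTower k Y.functionField Ω := .of_algebraMap_eq fun c => by
    rw [IsScalarTower.algebraMap_apply k X.functionField Ω,
      IsScalarTower.algebraMap_apply k X.functionField Y.functionField,
      ← IsScalarTower.algebraMap_apply X.functionField Y.functionField Ω]
  have : IsSepClosed Ω := IsSepClosure.sep_closed X.functionField
  have : Algebra.IsSeparable X.functionField Ω := IsSepClosure.separable
  have : Algebra.IsSeparable Y.functionField Ω :=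
    Algebra.isSeparable_tower_top_of_isSeparable X.functionField Y.functionField Ω
  have : IsSepClosure Y.functionField Ω := ⟨‹_›, ‹_›⟩
  have : Algebra.IsIntegral X.functionField Ω := inferInstance
  have := hU₁.isFractionRing
  have : IsGalois k (algebraicClosure k Ω) := isGalois_algebraicClosure (K := X.functionField)
    fun x hx => mem_range_of_isAlgebraic ht hx
  have hD₁ := isDedekindDomain_adjoin_singleton (k := k) t
  have hD₂ := isDedekindDomain_adjoin_singleton (k := k) t⁻¹
  have hconst (W : ValuationSubring Ω) (x : RationalPoint f)
      (hWx : W.toSubring.comap (algebraMap X.functionField Ω) = localRing x.point) (c : k) :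
      algebraMap k Ω c ∈ W := by
    have h : constantsHom f c ∈ localRing x.point := constantsHom_mem_localRing c _
    rw [← hWx] at h
    rw [IsScalarTower.algebraMap_apply k X.functionField Ω]
    exact h
  obtain ⟨y₀, hy₀, huniq⟩ := hY Ω (liftSection s hfix) (isGaloisSection_liftSection hs hfix)
  rw [exists_decompositionGroup_iff] at hy₀
  obtain ⟨W₀, hW₀, hstab₀⟩ := hy₀
  -- a rational point of `X` whose decomposition group contains the section lifts to `Y`
  have hlift (x : RationalPoint f) (W : ValuationSubring Ω)
      (hWx : W.toSubring.comap (algebraMap X.functionField Ω) = localRing x.point)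
      (hstab : ∀ τ, ∀ z ∈ W, s τ z ∈ W) :
      W.toSubring.comap (algebraMap Y.functionField Ω) = localRing y₀.point := by
    suffices ∃ x' : RationalPoint g,
        localRing x'.point = (W.comap (algebraMap Y.functionField Ω)).toSubring by
      obtain ⟨x', hx'⟩ := this
      have : x' = y₀ := huniq x' ((exists_decompositionGroup_iff _ _).2 ⟨W, hx'.symm, hstab⟩)
      rw [← this, hx']
      rfl
    have key {u : X.functionField} {w : Y.functionField} {b c : k[X]}
        (hu : u ∈ localRing x.point)
        (hsep : ∀ x : k, (2 : k) ≠ 0 ∨ b.eval x ≠ 0 ∨ c.eval x = 0)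
        (hw : w ^ 2 + aeval (algebraMap X.functionField Y.functionField u) b * w =
          aeval (algebraMap X.functionField Y.functionField u) c) {V : Y.Opens}
        (hV : IsAffineWithSections V
          (Algebra.adjoin k {algebraMap X.functionField Y.functionField u, w}).toSubring)
        (hD : IsDedekindDomain
          (Algebra.adjoin k {algebraMap X.functionField Y.functionField u, w})) :
        ∃ x' : RationalPoint g,
          localRing x'.point = (W.comap (algebraMap Y.functionField Ω)).toSubring := by
      obtain ⟨a, ha⟩ := x.exists_sub_mem_nonunits
        (V := W.comap (algebraMap X.functionField Ω)) hWx (z := u) (by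
          rw [← hWx] at hu
          exact hu)
      rw [mem_nonunits_comap_iff, map_sub] at ha
      have ha' : algebraMap X.functionField Ω u - algebraMap k Ω a ∈ W.nonunits := by
        rw [IsScalarTower.algebraMap_apply k X.functionField Ω]
        exact ha
      have hw' := congrArg (algebraMap Y.functionField Ω) hw
      rw [map_add, map_mul, map_pow, ← aeval_algebraMap_apply, ← aeval_algebraMap_apply,
        ← IsScalarTower.algebraMap_apply X.functionField Y.functionField Ω] at hw'
      obtain ⟨z, hz⟩ := exists_root_sub_mem_nonunits hs (hconst W x hWx) hstab hsep hw'
        (fun τ => hfix τ w) ha'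
      refine hV.exists_rationalPoint g _ (fun c => ?_) ?_
      · rw [ValuationSubring.mem_comap, ← IsScalarTower.algebraMap_apply]
        exact hconst W x hWx c
      · rintro _ (rfl | rfl)
        · refine ⟨a, ?_⟩
          rw [mem_nonunits_comap_iff, map_sub, ← IsScalarTower.algebraMap_apply,
            ← IsScalarTower.algebraMap_apply]
          exact ha'
        · refine ⟨z, ?_⟩
          rw [mem_nonunits_comap_iff, map_sub, ← IsScalarTower.algebraMap_apply]
          exact hz
    have hx : x.point ∈ U₁ ⊔ U₂ := hcov ▸ trivial
    rcases hx with hx | hx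
    · have := hc.sections₁.isFractionRing
      exact key (hU₁.mem_localRing hx (Algebra.subset_adjoin (by simp))) hc.pair.separable
        hc.equation hc.sections₁
        (isDedekindDomain_adjoin_pair hc.pair.smooth hc.transcendental hc.equation)
    · have := hc.sections₂.isFractionRing
      have hw := hc.pair.inv_eq hc.ne_zero hc.equation
      have hD := isDedekindDomain_adjoin_pair hc.pair.smooth' hc.transcendental_inv hw
      have hV := hc.sections₂
      rw [← map_inv₀] at hw hD hV
      exact key (hU₂.mem_localRing hx (Algebra.subset_adjoin (by simp))) hc.pair.separable' hw hV hD
  have hcomap {W : ValuationSubring Ω}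
      (h : W.toSubring.comap (algebraMap Y.functionField Ω) = localRing y₀.point) :
      W.toSubring.comap (algebraMap X.functionField Ω) =
        (localRing y₀.point).comap (algebraMap X.functionField Y.functionField) := by
    rw [← h, Subring.comap_comap, ← IsScalarTower.algebraMap_eq]
  have hex : ∃ x : RationalPoint f,
      localRing x.point = (W₀.comap (algebraMap X.functionField Ω)).toSubring := by
    have hk (c : k) : algebraMap k Y.functionField c ∈ W₀.comap (algebraMap Y.functionField Ω) := by
      have h : constantsHom g c ∈ localRing y₀.point := constantsHom_mem_localRing c _
      rw [← hW₀] at h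
      exact h
    have key {u : X.functionField} (hu : algebraMap X.functionField Ω u ∈ W₀) {U : X.Opens}
        (hU : IsAffineWithSections U (Algebra.adjoin k {u}).toSubring) :
        ∃ x : RationalPoint f,
          localRing x.point = (W₀.comap (algebraMap X.functionField Ω)).toSubring := by
      have := isDedekindDomain_adjoin_singleton (k := k) u
      refine hU.exists_rationalPoint f _ (fun c => ?_) ?_
      · have := hk c
        rw [ValuationSubring.mem_comap, ← IsScalarTower.algebraMap_apply] at this ⊢
        exact this
      · rintro _ rfl
        rw [IsScalarTower.algebraMap_apply X.functionField Y.functionField Ω] at hu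
        obtain ⟨a, ha⟩ := y₀.exists_sub_mem_nonunits
          (V := W₀.comap (algebraMap Y.functionField Ω)) hW₀ hu
        refine ⟨a, ?_⟩
        rw [mem_nonunits_comap_iff, map_sub] at ha ⊢
        rw [IsScalarTower.algebraMap_apply X.functionField Y.functionField Ω,
          ← IsScalarTower.algebraMap_apply k X.functionField Ω,
          IsScalarTower.algebraMap_apply k Y.functionField Ω]
        exact ha
    rcases W₀.mem_or_inv_mem (algebraMap X.functionField Ω t) with h | h
    · exact key h hU₁
    · rw [← map_inv₀] at h
      exact key h hU₂
  obtain ⟨x, hx⟩ := hex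
  refine ⟨x, (exists_decompositionGroup_iff _ _).2 ⟨W₀, hx.symm, hstab₀⟩, fun x' hx' => ?_⟩
  obtain ⟨W, hW, hstab⟩ := (exists_decompositionGroup_iff _ _).1 hx'
  refine rationalPoint_ext ?_
  rw [← hW, hx, hcomap (hlift x' W hW hstab)]
  exact (hcomap hW₀).symm

end Transfer

end BirationalSection

theorem proposition2p2 {k : Type u} [Field k] (g : ℕ) (hg : 1 ≤ g)
    (h : ∀ (X : Scheme.{u}) (f : X ⟶ Spec (.of k)) [AlgebraicGeometry.IsIntegral X] [IsProper f]
      [SmoothOfRelativeDimension 1 f] [GeometricallyConnected f],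
      BirationalSection.genus f = g → BirationalSection.BGASC f) :
    BirationalSection.BGASC (BirationalSection.projectiveLineHom k) := by
  open BirationalSection Polynomial IntermediateField in
  let K := (projectiveLine k).functionField
  let := functionFieldAlgebra (projectiveLineHom k)
  obtain ⟨n, rfl⟩ := Nat.exists_eq_add_of_le' hg
  obtain ⟨t, U₁, U₂, ht, hU₁, hU₂, hcov⟩ := exists_coordinate_projectiveLine k
  intro Ω _ _ _ _ _ s hs
  have : IsSepClosed Ω := IsSepClosure.sep_closed K
  have : Algebra.IsSeparable K Ω := IsSepClosure.separable
  have := hU₁.isFractionRing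
  have : IsGalois k (algebraicClosure k Ω) := isGalois_algebraicClosure (K := K)
    fun x hx => mem_range_of_isAlgebraic ht hx
  obtain ⟨b, c, b', c', hpair, y, hy, hfix⟩ := exists_fixed_root hs t n
  let M := K⟮y⟯
  have : IsScalarTower k M Ω := .of_algebraMap_eq fun c => rfl
  let yM : M := AdjoinSimple.gen K y
  have hyM : yM ^ 2 + aeval (algebraMap K M t) b * yM = aeval (algebraMap K M t) c := by
    apply (algebraMap M Ω).injective
    rw [map_add, map_mul, map_pow, ← aeval_algebraMap_apply, ← aeval_algebraMap_apply]
    exact hy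
  have hfixM (τ) (m : M) : s τ (m : Ω) = m := by
    obtain ⟨m, hm⟩ := m
    induction hm using adjoin_induction with
    | mem z hz =>
      rw [Set.mem_singleton_iff] at hz
      subst hz
      exact hfix τ
    | algebraMap z => exact (s τ).commutes z
    | add x z _ _ hx hz => exact (map_add _ _ _).trans congr($hx + $hz)
    | inv x _ hx => exact (map_inv₀ _ _).trans congr($hx⁻¹)
    | mul x z _ _ hx hz => exact (map_mul _ _ _).trans congr($hx * $hz)
  have : IsFractionRing (Algebra.adjoin k {algebraMap K M t, yM}) M := isFractionRing_adjoin_pair y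
  obtain ⟨Y, _, f, _, e, V₁, V₂, he, hc⟩ :=
    exists_isQuadraticCover (projectiveLineHom k) hcov hpair ht hU₁ hU₂ hyM
  have := hc.smoothOfRelativeDimension
  have := hc.geometricallyConnected
  let := functionFieldAlgebra f
  let : Algebra K Y.functionField := (e.symm.toRingHom.comp (algebraMap K M)).toAlgebra
  let : Algebra Y.functionField Ω := ((algebraMap M Ω).comp e.toRingHom).toAlgebra
  have : IsScalarTower k K Y.functionField := .of_algebraMap_eq fun c => by
    refine e.injective ((he c).trans ?_)
    refine Eq.trans ?_ (e.apply_symm_apply _).symm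
    exact IsScalarTower.algebraMap_apply k K M c
  have : IsScalarTower K Y.functionField Ω := .of_algebraMap_eq fun c =>
    (congrArg (algebraMap M Ω) (e.apply_symm_apply (algebraMap K M c))).symm
  exact existsUnique_rationalPoint_of_isQuadraticCover (projectiveLineHom k) hcov f
    (h Y f hc.genus_eq) ht hU₁ hU₂ hc hs fun τ m => hfixM τ (e m)
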